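/- Let $F:M^n\to\mathbb{R}^{n+1}$ be a connected, smoothly immersed hypersurface with smooth unit normal field $\nu$, complete in the induced metric $g$. Let $h(X,Y)=\langle D_X\nu,Y\rangle$ be its second fundamental form, $H=\operatorname{tr}_g h$ its mean curvature, and let $\nabla H$ be the gradient of $H$ on $M$ (a tangent vector, regarded as a vector of $\mathbb{R}^{n+1}$). Suppose that $M$ is a translating soliton, i.e. there is a fixed unit vector $W\in\mathbb{R}^{n+1}$ with $$H=\langle \nu,W\rangle\quad\text{on } M .$$ Let $e\in\mathbb{R}^{n+1}$ be a unit vector such that $\langle\nabla H,e\rangle\le 0$ and $\langle\nu,e\rangle>0$ on $M$. For $R>0$ put $M_R=F^{-1}(B_R(0))$, the part of $M$ in the ball of radius $R$ of $\mathbb{R}^{n+1}$ centred at the origin. Suppose that for some real number $p<0$ the function $\langle\nu,e\rangle^{p+1}$ is integrable over $M_R$ for every $R>0$ (which is automatic if $M$ is properly immersed), and that $$\frac{1}{R^2}\int_{M_{2R}\setminus M_R}\langle\nu,e\rangle^{p+1}\,dv_g\;\longrightarrow\;0\qquad\text{as } R\to\infty .$$ Then $M$ is a hyperplane: $F$ is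 injective and its image is an affine hyperplane of $\mathbb{R}^{n+1}$. -/

import Mathlib

open Set Filter Topology MeasureTheory Manifold
open scoped ContDiff ENNReal

noncomputable section

/-- Euclidean space `ℝᵐ`. -/
abbrev Euc (m : ℕ) : Type := EuclideanSpace ℝ (Fin m)

namespace Hypersurface

section Local

variable {n : ℕ} {M : Type*} [TopologicalSpace M] [ChartedSpace (Euc n) M]

/-- The coordinate vectors `∂₁, …, ∂ₙ` at `x` of the preferred chart at `x`. -/
def coordVec (x : M) (i : Fin n) : TangentSpace (𝓡 n) x :=
  (EuclideanSpace.single i (1 : ℝ) : Euc n)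

/-- The differential `dG(v)` of a map `G` from `M` to a normed space, on a tangent vector `v` at
`x`. -/
def pushforward {V : Type*} [NormedAddCommGroup V] [NormedSpace ℝ V] (G : M → V) (x : M)
    (v : TangentSpace (𝓡 n) x) : V :=
  mfderiv (𝓡 n) 𝓘(ℝ, V) G x v

/-- The derivative `∂ᵢ G (x)` of a map `G` from `M` to a normed space. -/
def pderiv {V : Type*} [NormedAddCommGroup V] [NormedSpace ℝ V] (G : M → V) (x : M) (i : Fin n) :
    V :=
  pushforward G x (coordVec x i)

/-- The matrix `g_ij = ⟨∂ᵢF, ∂ⱼF⟩` of the metric induced on `M` by `F : M → ℝⁿ⁺¹`. -/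
def metricMatrix (F : M → Euc (n + 1)) (x : M) : Matrix (Fin n) (Fin n) ℝ :=
  Matrix.of fun i j => inner ℝ (pderiv F x i) (pderiv F x j)

/-- The matrix `h_ij = ⟨∂ᵢν, ∂ⱼF⟩` of the second fundamental form with respect to the unit
normal `ν`. -/
def secondFundamentalForm (F ν : M → Euc (n + 1)) (x : M) : Matrix (Fin n) (Fin n) ℝ :=
  Matrix.of fun i j => inner ℝ (pderiv ν x i) (pderiv F x j)

/-- The mean curvature `H = g^{ij} h_ij` with respect to the unit normal `ν` (it does not depend
on the coordinates, and equals `∑ h(eᵢ, eᵢ)` in a `g`-orthonormal frame). -/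
def meanCurvature (F ν : M → Euc (n + 1)) (x : M) : ℝ :=
  ((metricMatrix F x)⁻¹ * secondFundamentalForm F ν x).trace

/-- The gradient `∇u = g^{ij} ∂ⱼu ∂ᵢF` of `u : M → ℝ` in the induced metric, as a vector of
`ℝⁿ⁺¹` tangent to the hypersurface. -/
def tangentialGradient (F : M → Euc (n + 1)) (u : M → ℝ) (x : M) : Euc (n + 1) :=
  ∑ i, ∑ j, ((metricMatrix F x)⁻¹ i j * pderiv u x j) • pderiv F x i

/-- The distance of the induced metric: the infimum of the lengths of the `C¹` paths from `x` to
`y`, where a tangent vector `v` has length `‖dF(v)‖`. -/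
def inducedEDist (F : M → Euc (n + 1)) (x y : M) : ℝ≥0∞ :=
  letI : ∀ z : M, ENorm (TangentSpace (𝓡 n) z) :=
    fun z => ⟨fun v => ‖pushforward F z v‖ₑ⟩
  riemannianEDist (𝓡 n) x y

/-- The induced metric is complete: every sequence that is Cauchy for its distance converges. -/
def HasCompleteMetric (F : M → Euc (n + 1)) : Prop :=
  ∀ u : ℕ → M,
    (∀ ε : ℝ≥0∞, 0 < ε → ∃ N, ∀ k ≥ N, ∀ l ≥ N, inducedEDist F (u k) (u l) < ε) →
      ∃ x, Tendsto u atTop (𝓝 x)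

/-- The density `√(det ⟨∂ᵢ(F ∘ φ⁻¹), ∂ⱼ(F ∘ φ⁻¹)⟩)` of the induced volume in the coordinates of the
preferred chart `φ` at `c`. -/
def volumeDensity (F : M → Euc (n + 1)) (c : M) (y : Euc n) : ℝ :=
  Real.sqrt (Matrix.gram ℝ fun i : Fin n =>
    fderiv ℝ (F ∘ (chartAt (Euc n) c).symm) y (EuclideanSpace.single i 1)).det

variable [MeasurableSpace M]

/-- The induced volume on the domain of the preferred chart `φ` at `c`:
`A ↦ ∫_{φ(A ∩ dom φ)} √(det g_ij) dy`. -/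
def chartVolume (F : M → Euc (n + 1)) (c : M) : Measure M :=
  ((volume.withDensity fun y => ENNReal.ofReal (volumeDensity F c y)).restrict
    (chartAt (Euc n) c).target).map (chartAt (Euc n) c).symm

/-- The Riemannian volume `dv_g` of the induced metric. By the change of variables formula the
measures `chartVolume F c` agree on the overlaps of the charts, so their least upper bound is the
measure that restricts to `chartVolume F c` on each chart domain. -/
def inducedVolume (F : M → Euc (n + 1)) : Measure M :=
  ⨆ c : M, chartVolume F c

end Local

/-- `F : M → ℝⁿ⁺¹` is a smooth immersed hypersurface with smooth unit normal field `ν`. -/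
structure IsImmersedHypersurface {n : ℕ} {M : Type*} [TopologicalSpace M]
    [ChartedSpace (Euc n) M] (F ν : M → Euc (n + 1)) : Prop where
  smooth : ContMDiff (𝓡 n) 𝓘(ℝ, Euc (n + 1)) ∞ F
  immersion : ∀ x, Function.Injective (pushforward (n := n) F x)
  smooth_normal : ContMDiff (𝓡 n) 𝓘(ℝ, Euc (n + 1)) ∞ ν
  norm_normal : ∀ x, ‖ν x‖ = 1
  normal : ∀ x (v : TangentSpace (𝓡 n) x), inner ℝ (ν x) (pushforward F x v) = 0

/-- The hypersurface is a translating soliton with velocity the unit vector `W`: `H = ⟨ν, W⟩`. -/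
def IsTranslatingSoliton {n : ℕ} {M : Type*} [TopologicalSpace M] [ChartedSpace (Euc n) M]
    (F ν : M → Euc (n + 1)) (W : Euc (n + 1)) : Prop :=
  ‖W‖ = 1 ∧ ∀ x, meanCurvature F ν x = inner ℝ (ν x) W

/-- The part `M_R = B_R(0) ∩ M` of the hypersurface in the ball of radius `R` of `ℝⁿ⁺¹` around the
origin. -/
def ballPart {n : ℕ} {M : Type*} (F : M → Euc (n + 1)) (R : ℝ) : Set M :=
  F ⁻¹' Metric.ball 0 R

/-- A hyperplane of `ℝᵐ`. -/
def IsHyperplane {m : ℕ} (P : Set (Euc m)) : Prop :=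
  ∃ (v : Euc m) (c : ℝ), v ≠ 0 ∧ P = {y | inner ℝ v y = c}

end Hypersurface

end

open Hypersurface

/-!
A complete immersed hypersurface of `ℝⁿ⁺¹` with `⟨ν, e⟩ > 0` and `⟨∇H, e⟩ ≤ 0` is a hyperplane if the
area weighted with a power `f ^ (p + 1)`, `p < 0`, of `f = ⟨ν, e⟩` grows slowly. The reason is that `f` is a positive
supersolution: `Δf = ⟨∇H, e⟩ - |A|² f ≤ -|A|² f`. Testing this with `ζ² f ^ p` for a cutoff function
`ζ` gives, since `p < 0`, the Caccioppoli inequality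
`∫ ζ² f ^ (p + 1) |A|² ≤ |p|⁻¹ ∫ f ^ (p + 1) |∇ζ|²`, whose right side tends to `0` along a sequence
of cutoff functions exhausting `M`. So `A = 0`, and a complete totally geodesic hypersurface is a
hyperplane.

Since `f > 0`, the orthogonal projection `Π` of `M` to `e^⊥ ≅ ℝⁿ` is a local diffeomorphism, and its
local inverses describe `M` locally as a graph. All computations take place in these coordinates
(`GraphAtlas`). With `q` the negative of the horizontal part of `ν`, the Weingarten map is `-Dq`,
`H = -tr Dq`, `|A|² = tr (Dq ∘ Dq)`, and the vector field `√g ∇f` is `S = -Dq(q)`. Hence the formula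
for `Δf` is the flat divergence identity `div S = D(-tr Dq)(q) - tr (Dq ∘ Dq)`
(`GraphAtlas.divergence_flux`), and the measure `f dv_g` is the pullback of Lebesgue measure under
`Π` (`GraphAtlas.baseVolume_restrict`). The weak form of the inequality is integration by parts of a
Lipschitz function in `ℝⁿ`, followed by a partition of unity
(`GraphAtlas.IsLocLip.integral_mul_normSqShape_le`), and it gives the Caccioppoli inequality
(`GraphAtlas.IsLocLip.caccioppoli`).

The cutoff function is the product of one in terms of `|F|`, as the integral condition requires, and
one in terms of the intrinsic distance from a point. The second makes the support compact although
`F` need not be proper: by the Hopf–Rinow theorem (`isCompact_closedEBall_of_length`) closed balls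
of the complete induced metric are compact. Letting first the intrinsic and then the extrinsic
radius tend to infinity yields `|A|² = 0` (`GraphAtlas.normSqShape_eq_zero`).

Then `ν` is constant, so `F` maps into a hyperplane, and the differential of `F` is uniformly
bounded in the graph coordinates. By completeness every segment of `e^⊥` lifts to `M`, so that `Π`
has a continuous section, whose image is open and closed; hence `Π` is bijective
(`GraphAtlas.bijective_proj`), `F` is injective, and its image is the whole hyperplane.
-/

open Hypersurface
open scoped NNReal

/-! ### Compact balls in complete length spaces -/

/-- In a complete length space, a closed ball is compact if all smaller concentric closed balls are:
a finite net of a slightly smaller ball is a coarser net of the ball itself. -/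
theorem isCompact_closedEBall_of_lt {X : Type*} [PseudoEMetricSpace X] [CompleteSpace X]
    (hlen : ∀ (x y : X) (a b : ℝ≥0∞), a ≠ ⊤ → 0 < b → edist x y < a + b →
      ∃ z, edist x z ≤ a ∧ edist z y < b)
    (x : X) {R : ℝ≥0} (hR : 0 < R) (h : ∀ r < R, IsCompact (Metric.closedEBall x (r : ℝ≥0∞))) :
    IsCompact (Metric.closedEBall x (R : ℝ≥0∞)) := by
  refine isCompact_iff_totallyBounded_isComplete.2 ⟨?_, Metric.isClosed_closedEBall.isComplete⟩
  rw [EMetric.totallyBounded_iff]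
  intro ε hε
  obtain ⟨δ, hδ0, hδ⟩ := ENNReal.lt_iff_exists_nnreal_btwn.1 hε
  have hδ0' : 0 < δ := by exact_mod_cast hδ0
  set r' : ℝ≥0 := max (R - δ / 4) (R / 2) with hr'
  have hr'R : r' < R := max_lt (tsub_lt_self hR (by positivity)) (NNReal.half_lt_self hR.ne')
  have hRr' : R < r' + δ / 2 := by
    have h1 : R ≤ (R - δ / 4) + δ / 4 := le_tsub_add
    have h2 : R - δ / 4 ≤ r' := le_max_left _ _
    have h3 : δ / 4 < δ / 2 := by
      rw [← NNReal.coe_lt_coe]; push_cast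
      have : (0 : ℝ) < δ := by exact_mod_cast hδ0'
      linarith
    calc R ≤ (R - δ / 4) + δ / 4 := h1
      _ ≤ r' + δ / 4 := by gcongr
      _ < r' + δ / 2 := by gcongr
  obtain ⟨t, ht, htc⟩ := EMetric.totallyBounded_iff.1 (h r' hr'R).totallyBounded
    ((δ / 2 : ℝ≥0) : ℝ≥0∞) (by exact_mod_cast half_pos hδ0')
  refine ⟨t, ht, fun y hy => ?_⟩
  have hxy : edist x y < (r' : ℝ≥0∞) + ((δ / 2 : ℝ≥0) : ℝ≥0∞) := by
    rw [edist_comm]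
    exact lt_of_le_of_lt (Metric.mem_closedEBall.1 hy) (by exact_mod_cast hRr')
  obtain ⟨z, hz1, hz2⟩ := hlen x y _ _ ENNReal.coe_ne_top
    (by exact_mod_cast half_pos hδ0') hxy
  have hz : z ∈ Metric.closedEBall x (r' : ℝ≥0∞) := by
    rw [Metric.mem_closedEBall, edist_comm]; exact hz1
  obtain ⟨c, hc, hzc⟩ := mem_iUnion₂.1 (htc hz)
  refine mem_iUnion₂.2 ⟨c, hc, ?_⟩
  rw [Metric.mem_eball] at hzc ⊢
  calc edist y c ≤ edist y z + edist z c := edist_triangle _ _ _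
    _ < ((δ / 2 : ℝ≥0) : ℝ≥0∞) + ((δ / 2 : ℝ≥0) : ℝ≥0∞) := by
        rw [edist_comm y z]; exact ENNReal.add_lt_add hz2 hzc
    _ = δ := by rw [← ENNReal.coe_add, add_halves]
    _ ≤ ε := hδ.le

/-- The Hopf–Rinow theorem in the form of Cohn-Vossen: the closed balls of a complete, locally
compact length space are compact. -/
theorem isCompact_closedEBall_of_length {X : Type*} [PseudoEMetricSpace X] [CompleteSpace X]
    [WeaklyLocallyCompactSpace X]
    (hlen : ∀ (x y : X) (a b : ℝ≥0∞), a ≠ ⊤ → 0 < b → edist x y < a + b →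
      ∃ z, edist x z ≤ a ∧ edist z y < b)
    (x : X) (r : ℝ≥0) : IsCompact (Metric.closedEBall x (r : ℝ≥0∞)) := by
  have mono : ∀ {a b : ℝ≥0}, a ≤ b → IsCompact (Metric.closedEBall x (b : ℝ≥0∞)) →
      IsCompact (Metric.closedEBall x (a : ℝ≥0∞)) := fun hab hb =>
    hb.of_isClosed_subset Metric.isClosed_closedEBall
      (Metric.closedEBall_subset_closedEBall (by exact_mod_cast hab))
  -- compactness persists for slightly larger radii
  have extend : ∀ (K : Set X), IsCompact K → ∃ δ : ℝ≥0, 0 < δ ∧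
      ∀ a : ℝ≥0, (Metric.closedEBall x (a : ℝ≥0∞) ⊆ K) →
        IsCompact (Metric.closedEBall x ((a + δ : ℝ≥0) : ℝ≥0∞)) := by
    intro K hK
    obtain ⟨K', hK', hKK'⟩ := exists_compact_superset hK
    obtain ⟨δ, hδ, hsub⟩ := hK.exists_thickening_subset_open isOpen_interior hKK'
    refine ⟨(δ / 2).toNNReal, by simpa using half_pos hδ, fun a ha => ?_⟩
    refine hK'.of_isClosed_subset Metric.isClosed_closedEBall fun y hy => ?_
    refine interior_subset (hsub ?_)
    have hlt : (δ / 2).toNNReal < δ.toNNReal :=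
      (Real.toNNReal_lt_toNNReal_iff hδ).2 (half_lt_self hδ)
    have hxy : edist x y < (a : ℝ≥0∞) + ENNReal.ofReal δ := by
      rw [edist_comm]
      refine lt_of_le_of_lt (Metric.mem_closedEBall.1 hy) ?_
      rw [ENNReal.ofReal, ← ENNReal.coe_add, ENNReal.coe_lt_coe]
      gcongr
    obtain ⟨z, hz1, hz2⟩ := hlen x y _ _ ENNReal.coe_ne_top (by simpa using hδ) hxy
    rw [Metric.thickening, mem_ofPred_eq]
    refine lt_of_le_of_lt (Metric.infEDist_le_edist_of_mem (y := z) (ha ?_)) ?_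
    · rw [Metric.mem_closedEBall, edist_comm]; exact hz1
    · rw [edist_comm]; exact hz2
  by_contra hr
  set S : Set ℝ≥0 := {s | IsCompact (Metric.closedEBall x (s : ℝ≥0∞))} with hS
  have hbdd : BddAbove S := ⟨r, fun s hs => le_of_not_ge fun hrs => hr (mono hrs hs)⟩
  obtain ⟨δ₀, hδ₀, h₀⟩ : ∃ δ : ℝ≥0, 0 < δ ∧ δ ∈ S := by
    obtain ⟨K, hK, hxK⟩ := exists_compact_mem_nhds x
    obtain ⟨ε, hε, hεK⟩ := Metric.nhds_basis_closedEBall.mem_iff.1 hxK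
    obtain ⟨δ, hδ0, hδ⟩ := ENNReal.lt_iff_exists_nnreal_btwn.1 hε
    exact ⟨δ, by exact_mod_cast hδ0, hK.of_isClosed_subset Metric.isClosed_closedEBall
      ((Metric.closedEBall_subset_closedEBall hδ.le).trans hεK)⟩
  have hpos : 0 < sSup S := hδ₀.trans_le (le_csSup hbdd h₀)
  have hsup : IsCompact (Metric.closedEBall x (sSup S : ℝ≥0)) := by
    refine isCompact_closedEBall_of_lt hlen x hpos fun s hs => ?_
    obtain ⟨t, ht, hst⟩ := exists_lt_of_lt_csSup ⟨δ₀, h₀⟩ hs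
    exact mono hst.le ht
  obtain ⟨δ, hδ, hext⟩ := extend _ hsup
  have : sSup S + δ ∈ S := hext _ le_rfl
  exact absurd (le_csSup hbdd this) (not_le.2 (lt_add_of_pos_right _ hδ))

/-! ### Pointwise algebra of the Weingarten map in graph coordinates -/

section WeingartenAlgebra

variable {E : Type*} [NormedAddCommGroup E] [InnerProductSpace ℝ E]

/-- The structure equations at a point of a graph with unit normal `(-q, f)`, where `A = Dq` and
`a = Df`. The field `deriv` is the derivative of `f² + ‖q‖² = 1`, and `symm` is the symmetry of the
Hessian of the height function, whose gradient is `q / f`. -/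
structure IsGraphJet (A : E →L[ℝ] E) (a : E →L[ℝ] ℝ) (q : E) (f : ℝ) : Prop where
  pos : 0 < f
  unit : f ^ 2 + ‖q‖ ^ 2 = 1
  deriv : ∀ v, f * a v = -inner ℝ q (A v)
  symm : ∀ v v', f * inner ℝ (A v') v - inner ℝ q v * a v'
    = f * inner ℝ (A v) v' - inner ℝ q v' * a v

variable {A : E →L[ℝ] E} {a : E →L[ℝ] ℝ} {q : E} {f : ℝ}

/-- In the metric `|v|² = ‖v‖² + (⟪q, v⟫ / f)²` of the graph, `S = -A q` is the gradient of `f`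
divided by `f`. In particular `Df(S) = f |S|²`. -/
theorem IsGraphJet.deriv_apply_flux (h : IsGraphJet A a q f) :
    a (-A q) = f * (‖A q‖ ^ 2 + (inner ℝ q (A q) / f) ^ 2) := by
  have hf := h.pos.ne'
  have h1 := h.symm (A q) q
  have h2 := h.deriv q
  have h3 := h.deriv (A q)
  have h4 := h.unit
  rw [real_inner_self_eq_norm_sq, real_inner_self_eq_norm_sq] at h1
  rw [real_inner_comm] at h3
  rw [map_neg]
  field_simp
  have h5 : a q = -inner ℝ q (A q) / f := by field_simp; linarith
  have h6 : inner ℝ (A (A q)) q = -(f * a (A q)) := by linarith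
  rw [h5, h6] at h1
  field_simp at h1
  linear_combination (-1) * h1 + f * a (A q) * h4

/-- The squared norm `tr A²` of the Weingarten map is nonnegative, and vanishes only if `A` does,
because `A` is self-adjoint for the metric of the graph. -/
theorem IsGraphJet.trace_comp_self [FiniteDimensional ℝ E] (h : IsGraphJet A a q f) :
    0 ≤ LinearMap.trace ℝ E (A ∘L A : E →L[ℝ] E) ∧
      (LinearMap.trace ℝ E (A ∘L A : E →L[ℝ] E) = 0 → A = 0) := by
  have hf := h.pos.ne'
  have hf1 : 1 + f ≠ 0 := by have := h.pos; positivity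
  have hq : inner ℝ q q = 1 - f ^ 2 := by rw [real_inner_self_eq_norm_sq]; linarith [h.unit]
  -- The operator `K`, with inverse `L`, is the square root of the metric `v ↦ v + ⟪q, v⟫ q / f²`.
  let P : E →ₗ[ℝ] E := ((innerSL ℝ q).smulRight q : E →L[ℝ] E)
  have hP : ∀ v, P v = inner ℝ q v • q := fun v => rfl
  let K : E →ₗ[ℝ] E := LinearMap.id + (1 / (f * (1 + f))) • P
  let L : E →ₗ[ℝ] E := LinearMap.id - (1 / (1 + f)) • P
  have hKv : ∀ v, K v = v + (1 / (f * (1 + f)) * inner ℝ q v) • q := fun v => by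
    simp [K, hP, smul_smul]
  have hLv : ∀ v, L v = v - (1 / (1 + f) * inner ℝ q v) • q := fun v => by
    simp [L, hP, smul_smul]
  have hKL : ∀ v, K (L v) = v := fun v => by
    rw [hKv, hLv, inner_sub_right, inner_smul_right, hq, sub_add, ← sub_smul, sub_eq_self]
    convert zero_smul ℝ q
    field_simp
    ring
  have hLK : ∀ v, L (K v) = v := fun v => by
    rw [hKv, hLv, inner_add_right, inner_smul_right, hq, add_sub_assoc, ← sub_smul, add_eq_left]
    convert zero_smul ℝ q
    field_simp
    ring
  have hKsymm : ∀ v w, inner ℝ (K v) w = inner ℝ v (K w) := fun v w => by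
    rw [hKv, hKv, inner_add_left, inner_add_right, inner_smul_left, inner_smul_right,
      real_inner_comm q v]
    simp only [map_mul, conj_trivial]
    ring
  have hKK : ∀ v w, inner ℝ v (K (K w)) = inner ℝ v w + inner ℝ q v * inner ℝ q w / f ^ 2 := by
    intro v w
    rw [← hKsymm, hKv, hKv, inner_add_left, inner_add_right, inner_add_right, inner_smul_left,
      inner_smul_left, inner_smul_right, inner_smul_right, hq, real_inner_comm q v]
    simp only [map_mul, conj_trivial]
    field_simp
    ring
  have hA : ∀ v w, inner ℝ (A v) (K (K w)) = inner ℝ (A w) (K (K v)) := fun v w => by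
    have h1 := h.symm v w
    have h2 := h.deriv v
    have h3 := h.deriv w
    rw [hKK, hKK]
    field_simp
    linear_combination (-f) * h1 - inner ℝ q v * h3 + inner ℝ q w * h2
  let B : E →ₗ[ℝ] E := A
  have hB : ∀ v, B v = A v := fun v => rfl
  -- conjugation with the square root of the metric makes `A` self-adjoint for the flat metric
  let Z : E →ₗ[ℝ] E := K ∘ₗ B ∘ₗ L
  have hZv : ∀ v, Z v = K (A (L v)) := fun v => rfl
  have hZ : ∀ v w, inner ℝ (Z v) w = inner ℝ v (Z w) := fun v w => by
    have h1 := hA (L v) (L w)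
    rw [hKL, hKL] at h1
    rw [hZv, hZv, hKsymm, h1, ← hKsymm, real_inner_comm]
  have htr : LinearMap.trace ℝ E (A ∘L A : E →L[ℝ] E)
      = ∑ i, ‖Z (stdOrthonormalBasis ℝ E i)‖ ^ 2 := by
    have e1 : ((A ∘L A : E →L[ℝ] E) : E →ₗ[ℝ] E) = B ∘ₗ B := rfl
    have e2 : Z ∘ₗ Z = (K ∘ₗ B ∘ₗ B) ∘ₗ L := by
      ext v; simp [Z, hLK]
    have e3 : B ∘ₗ B = L ∘ₗ (K ∘ₗ B ∘ₗ B) := by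
      ext v; simp [hLK]
    have e4 : LinearMap.trace ℝ E (B ∘ₗ B) = LinearMap.trace ℝ E (Z ∘ₗ Z) := by
      rw [e2]
      exact (congrArg _ e3).trans (LinearMap.trace_mul_comm ℝ L (K ∘ₗ B ∘ₗ B))
    rw [e1, e4, LinearMap.trace_eq_sum_inner _ (stdOrthonormalBasis ℝ E)]
    refine Finset.sum_congr rfl fun i _ => ?_
    rw [LinearMap.comp_apply, ← hZ, real_inner_self_eq_norm_sq]
  rw [htr]
  refine ⟨Finset.sum_nonneg fun i _ => sq_nonneg _, fun h0 => ?_⟩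
  rw [Finset.sum_eq_zero_iff_of_nonneg fun i _ => sq_nonneg _] at h0
  have hZ0 : Z = 0 := (stdOrthonormalBasis ℝ E).toBasis.ext fun i => by
    simpa using h0 i (Finset.mem_univ i)
  ext v
  have : A v = L (Z (K v)) := by rw [hZv, hLK, hLK]
  rw [this, hZ0]; simp

end WeingartenAlgebra

/-! ### Integration by parts -/

section WeakForm

variable {E : Type*} [NormedAddCommGroup E] [InnerProductSpace ℝ E] [FiniteDimensional ℝ E]
  [MeasurableSpace E] [BorelSpace E]

/-- The divergence `∑ᵢ ∂ᵢSⁱ` of a vector field on Euclidean space. -/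
noncomputable def euclideanDivergence (S : E → E) (u : E) : ℝ :=
  LinearMap.trace ℝ E (fderiv ℝ S u : E →L[ℝ] E)

/-- Integration by parts of a Lipschitz function against a vector field. -/
theorem integral_fderiv_apply_eq_neg {V : Set E} (hV : IsOpen V) {S : E → E}
    (hS : ContDiffOn ℝ ∞ S V) {η : E → ℝ} {C : ℝ≥0} (hη : LipschitzWith C η)
    (hc : HasCompactSupport η) (hsupp : tsupport η ⊆ V) :
    Integrable (fun u => fderiv ℝ η u (S u)) ∧ Integrable (fun u => η u * euclideanDivergence S u) ∧
    ∫ u, fderiv ℝ η u (S u) = -∫ u, η u * euclideanDivergence S u := by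
  obtain ⟨K', hK', hK'1, hK'2⟩ := exists_compact_between hc hV hsupp
  obtain ⟨χ, hχ1, hχ0, -⟩ := exists_contMDiffMap_zero_one_nhds_of_isClosed 𝓘(ℝ, E) (n := (⊤ : ℕ∞))
    (s := (interior K')ᶜ) (t := tsupport η) isOpen_interior.isClosed_compl
    hc.isClosed (disjoint_compl_left_iff_subset.2 hK'1)
  have hχ : ContDiff ℝ ∞ χ := χ.contMDiff.contDiff
  -- near the support of `η`, the field `S` agrees with the smooth compactly supported `S'`
  let S' : E → E := fun u => χ u • S u
  have hS'eq : ∀ u ∈ tsupport η, S' =ᶠ[𝓝 u] S := fun u hu => by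
    filter_upwards [hχ0.filter_mono (nhds_le_nhdsSet hu)] with y hy
    simp [S', hy]
  have hS'supp : Function.support S' ⊆ K' := fun u hu => by
    by_contra huK
    have : χ u = 0 := hχ1.self_of_nhdsSet u fun h => huK (interior_subset h)
    simp [S', this] at hu
  have hS'c : HasCompactSupport S' := HasCompactSupport.of_support_subset_isCompact hK' hS'supp
  have hS'0 : ∀ u ∉ V, S' =ᶠ[𝓝 u] 0 := fun u hu => by
    have : u ∈ K'ᶜ := fun h => hu (hK'2 h)
    filter_upwards [hK'.isClosed.isOpen_compl.mem_nhds this] with y hy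
    by_contra hne
    exact hy (hS'supp hne)
  have hS's : ContDiff ℝ ∞ S' := by
    rw [contDiff_iff_contDiffAt]
    intro u
    by_cases hu : u ∈ V
    · exact hχ.contDiffAt.smul (hS.contDiffAt (hV.mem_nhds hu))
    · exact contDiffAt_const.congr_of_eventuallyEq (hS'0 u hu)
  let b := stdOrthonormalBasis ℝ E
  let s : Fin (Module.finrank ℝ E) → E → ℝ := fun i u => inner ℝ (b i) (S' u)
  have hs : ∀ i, ContDiff ℝ ∞ (s i) := fun i => contDiff_const.inner ℝ hS's
  have hsc : ∀ i, HasCompactSupport (s i) := fun i =>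
    hS'c.comp_left (g := fun x => inner ℝ (b i) x) (inner_zero_right _)
  have hsL : ∀ i, ∃ D, LipschitzWith D (s i) := fun i =>
    ContDiff.lipschitzWith_of_hasCompactSupport (hsc i) (hs i) (by simp)
  have hsd : ∀ i u v, lineDeriv ℝ (s i) u v = inner ℝ (b i) (fderiv ℝ S' u v) := fun i u v => by
    have h1 : DifferentiableAt ℝ S' u := hS's.differentiable (by simp) u
    rw [((hs i).differentiable (by simp) u).lineDeriv_eq_fderiv,
      fderiv_inner_apply ℝ (differentiableAt_const _) h1]
    simp
  have hI1 : ∀ i, Integrable fun u => lineDeriv ℝ (s i) u (b i) * η u := fun i => by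
    refine Continuous.integrable_of_hasCompactSupport ?_ hc.mul_left
    refine Continuous.mul ?_ hη.continuous
    simp only [hsd]
    exact continuous_const.inner ((hS's.continuous_fderiv (by simp)).clm_apply continuous_const)
  have hI2 : ∀ i, Integrable fun u => lineDeriv ℝ η u (-b i) * s i u := fun i => by
    refine (hη.locallyIntegrable_lineDeriv (-b i)).integrable_smul_right_of_hasCompactSupport
      (hs i).continuous (hsc i) |>.congr ?_
    exact Eventually.of_forall fun u => by simp
  have hkey : ∀ i, ∫ u, lineDeriv ℝ (s i) u (b i) * η u = ∫ u, lineDeriv ℝ η u (-b i) * s i u :=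
    fun i => by
      obtain ⟨D, hD⟩ := hsL i
      exact LipschitzWith.integral_lineDeriv_mul_eq hD hη hc (b i)
  have hE1 : ∀ u, ∑ i, lineDeriv ℝ (s i) u (b i) * η u = η u * euclideanDivergence S u := by
    intro u
    by_cases hu : u ∈ tsupport η
    · rw [← Finset.sum_mul, mul_comm, euclideanDivergence, LinearMap.trace_eq_sum_inner _ b,
        ← (hS'eq u hu).fderiv_eq]
      simp [hsd]
    · simp [image_eq_zero_of_notMem_tsupport hu]
  have hE2 : ∀ᵐ u, ∑ i, lineDeriv ℝ η u (-b i) * s i u = -fderiv ℝ η u (S u) := by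
    filter_upwards [hη.ae_differentiableAt] with u hu
    have h1 : ∑ i, lineDeriv ℝ η u (-b i) * s i u = -fderiv ℝ η u (S' u) := by
      conv_rhs => rw [← b.sum_repr (S' u)]
      simp [hu.lineDeriv_eq_fderiv, s, b.repr_apply_apply, mul_comm]
    rw [h1]
    by_cases hut : u ∈ tsupport η
    · rw [(hS'eq u hut).self_of_nhds]
    · have : fderiv ℝ η u = 0 := by
        have h0 : η =ᶠ[𝓝 u] fun _ => 0 := notMem_tsupport_iff_eventuallyEq.1 hut
        rw [h0.fderiv_eq]; simp
      simp [this]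
  refine ⟨?_, ?_, ?_⟩
  · refine ((integrable_finsetSum Finset.univ fun i _ => hI2 i).neg).congr ?_
    filter_upwards [hE2] with u hu
    simp only [Pi.neg_apply, hu, neg_neg]
  · refine (integrable_finsetSum Finset.univ fun i _ => hI1 i).congr ?_
    exact Eventually.of_forall fun u => hE1 u
  · have h1 : ∫ u, fderiv ℝ η u (S u) = -∫ u, ∑ i, lineDeriv ℝ η u (-b i) * s i u := by
      rw [← integral_neg]
      refine integral_congr_ae ?_
      filter_upwards [hE2] with u hu
      rw [hu, neg_neg]
    rw [h1, integral_finsetSum _ fun i _ => hI2 i, ← Finset.sum_congr rfl fun i _ => hkey i,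
      ← integral_finsetSum _ fun i _ => hI1 i]
    simp only [hE1]

end WeakForm

/-! ### Structure equations of a graph -/

section StructureEquations

variable {E : Type*} [NormedAddCommGroup E] [InnerProductSpace ℝ E]

/-- A graph of `w` with unit normal `(-q, f)` satisfies the structure equations. -/
theorem isGraphJet_fderiv {V : Set E} (hV : IsOpen V) {q : E → E} {f w : E → ℝ}
    (hq : ContDiffOn ℝ ∞ q V) (hf : ContDiffOn ℝ ∞ f V) (hw : ContDiffOn ℝ ∞ w V)
    (hpos : ∀ u ∈ V, 0 < f u) (hunit : ∀ u ∈ V, f u ^ 2 + ‖q u‖ ^ 2 = 1)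
    (hgrad : ∀ u ∈ V, ∀ v, f u * fderiv ℝ w u v = inner ℝ (q u) v) {u : E} (hu : u ∈ V) :
    IsGraphJet (fderiv ℝ q u) (fderiv ℝ f u) (q u) (f u) := by
  have hVu := hV.mem_nhds hu
  have dq : DifferentiableAt ℝ q u := (hq.contDiffAt hVu).differentiableAt (by simp)
  have df : DifferentiableAt ℝ f u := (hf.contDiffAt hVu).differentiableAt (by simp)
  have cw : ContDiffAt ℝ ∞ w u := hw.contDiffAt hVu
  have dw : DifferentiableAt ℝ (fderiv ℝ w) u :=
    (cw.fderiv_right (m := 1) (by norm_cast)).differentiableAt (by simp)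
  refine ⟨hpos u hu, hunit u hu, fun v => ?_, fun v v' => ?_⟩
  · have h1 : (fun y => f y * f y + inner ℝ (q y) (q y)) =ᶠ[𝓝 u] fun _ => (1 : ℝ) := by
      filter_upwards [hVu] with y hy
      rw [real_inner_self_eq_norm_sq, ← hunit y hy, sq (f y)]
    have h2 := congrArg (fun L : E →L[ℝ] ℝ => L v) h1.fderiv_eq
    simp only [fderiv_const_apply] at h2
    rw [fderiv_fun_add (df.fun_mul df) (dq.inner ℝ dq), fderiv_fun_mul df df] at h2
    simp only [add_apply, smul_apply, zero_apply,
      fderiv_inner_apply ℝ dq dq, smul_eq_mul] at h2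
    rw [real_inner_comm (q u)] at h2
    linarith
  · have key : ∀ v v', f u * fderiv ℝ (fderiv ℝ w) u v' v + fderiv ℝ f u v' * fderiv ℝ w u v
        = inner ℝ (fderiv ℝ q u v') v := fun v v' => by
      have h1 : (fun y => f y * fderiv ℝ w y v) =ᶠ[𝓝 u] fun y => inner ℝ (q y) v := by
        filter_upwards [hVu] with y hy using hgrad y hy v
      have h2 := congrArg (fun L : E →L[ℝ] ℝ => L v') h1.fderiv_eq
      have dwv : DifferentiableAt ℝ (fun y => fderiv ℝ w y v) u :=
        dw.clm_apply (differentiableAt_const v)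
      rw [fderiv_fun_mul df dwv, fderiv_inner_apply ℝ dq (differentiableAt_const v),
        fderiv_clm_apply dw (differentiableAt_const v)] at h2
      simp at h2
      linarith
    have hs : fderiv ℝ (fderiv ℝ w) u v' v = fderiv ℝ (fderiv ℝ w) u v v' :=
      (cw.isSymmSndFDerivAt (by
        rw [minSmoothness_of_isRCLikeNormedField]; exact WithTop.coe_le_coe.2 le_top)) v' v
    have k1 := key v v'
    have k2 := key v' v
    rw [← k1, ← k2, ← hgrad u hu v, ← hgrad u hu v', hs]
    ring

/-- The divergence of `-Dq(q)`: the trace of the Gauss–Codazzi equations in graph coordinates. -/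
theorem euclideanDivergence_neg_fderiv_self [FiniteDimensional ℝ E] {q : E → E} {u : E}
    (hq : ContDiffAt ℝ ∞ q u) :
    euclideanDivergence (fun y => -fderiv ℝ q y (q y)) u
      = fderiv ℝ (fun y => -euclideanDivergence q y) u (q u)
        - LinearMap.trace ℝ E (fderiv ℝ q u ∘L fderiv ℝ q u : E →L[ℝ] E) := by
  have dq : DifferentiableAt ℝ q u := hq.differentiableAt (by simp)
  have dq2 : DifferentiableAt ℝ (fderiv ℝ q) u :=
    (hq.fderiv_right (m := 1) (by norm_cast)).differentiableAt (by simp)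
  let b := stdOrthonormalBasis ℝ E
  have hdiv : ∀ (S : E → E) y, euclideanDivergence S y = ∑ i, inner ℝ (b i) (fderiv ℝ S y (b i)) :=
    fun S y => LinearMap.trace_eq_sum_inner _ b
  have hsymm : ∀ v, fderiv ℝ (fderiv ℝ q) u v (q u) = fderiv ℝ (fderiv ℝ q) u (q u) v :=
    fun v => (hq.isSymmSndFDerivAt (by
        rw [minSmoothness_of_isRCLikeNormedField]; exact WithTop.coe_le_coe.2 le_top)) v (q u)
  have h1 : ∀ v, fderiv ℝ (fun y => -fderiv ℝ q y (q y)) u v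
      = -(fderiv ℝ (fderiv ℝ q) u (q u) v) - fderiv ℝ q u (fderiv ℝ q u v) := fun v => by
    rw [fderiv_fun_neg, fderiv_clm_apply dq2 dq, ← hsymm]
    simp
    abel
  have h2 : fderiv ℝ (fun y => -euclideanDivergence q y) u (q u)
      = -∑ i, inner ℝ (b i) (fderiv ℝ (fderiv ℝ q) u (q u) (b i)) := by
    have d1 : ∀ i, DifferentiableAt ℝ (fun y => fderiv ℝ q y (b i)) u := fun i =>
      dq2.clm_apply (differentiableAt_const _)
    have d2 : ∀ i ∈ Finset.univ,
        DifferentiableAt ℝ (fun y => inner ℝ (b i) (fderiv ℝ q y (b i))) u :=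
      fun i _ => (differentiableAt_const _).inner ℝ (d1 i)
    simp only [hdiv]
    rw [fderiv_fun_neg, fderiv_fun_sum d2]
    simp only [neg_apply, sum_apply]
    congr 1
    refine Finset.sum_congr rfl fun i _ => ?_
    rw [fderiv_inner_apply ℝ (differentiableAt_const _) (d1 i),
      fderiv_clm_apply dq2 (differentiableAt_const _)]
    simp
  rw [hdiv, h2, LinearMap.trace_eq_sum_inner _ b]
  simp only [h1, inner_sub_right, inner_neg_right, Finset.sum_sub_distrib, Finset.sum_neg_distrib]
  rfl

end StructureEquations

/-! ### Graph coordinates -/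

section Splitting

variable {n : ℕ}

theorem exists_linearIsometry_orthogonal (e : Euc (n + 1)) (he : ‖e‖ = 1) :
    ∃ ι : Euc n →ₗᵢ[ℝ] Euc (n + 1), ∀ v, inner ℝ (ι v) e = 0 := by
  have : Fact (Module.finrank ℝ (Euc (n + 1)) = n + 1) := ⟨by simp⟩
  have he0 : e ≠ 0 := fun h => by simp [h] at he
  let b := OrthonormalBasis.fromOrthogonalSpanSingleton (𝕜 := ℝ) n he0
  refine ⟨(Submodule.subtypeₗᵢ _).comp b.repr.symm.toLinearIsometry, fun v => ?_⟩
  rw [real_inner_comm]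
  exact Submodule.mem_orthogonal_singleton_iff_inner_right.1 (b.repr.symm v).2

/-- The coordinates of the orthogonal projection onto the hyperplane `range ι`. -/
noncomputable def projCoord (ι : Euc n →ₗᵢ[ℝ] Euc (n + 1)) : Euc (n + 1) →L[ℝ] Euc n :=
  ContinuousLinearMap.adjoint ι.toContinuousLinearMap

variable (ι : Euc n →ₗᵢ[ℝ] Euc (n + 1))

theorem inner_projCoord (y : Euc (n + 1)) (v : Euc n) :
    inner ℝ (projCoord ι y) v = inner ℝ y (ι v) :=
  ContinuousLinearMap.adjoint_inner_left _ _ _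

theorem projCoord_incl (v : Euc n) : projCoord ι (ι v) = v :=
  ext_inner_right ℝ fun w => by rw [inner_projCoord, ι.inner_map_map]

variable {ι} {e : Euc (n + 1)}

theorem projCoord_dir (hι : ∀ v, inner ℝ (ι v) e = 0) : projCoord ι e = 0 :=
  ext_inner_right ℝ fun w => by rw [inner_projCoord, real_inner_comm, hι, inner_zero_left]

theorem incl_projCoord_add (he : ‖e‖ = 1) (hι : ∀ v, inner ℝ (ι v) e = 0) (y : Euc (n + 1)) :
    ι (projCoord ι y) + (inner ℝ y e : ℝ) • e = y := by
  -- `(v, t) ↦ ι v + t e` is injective between spaces of dimension `n + 1`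
  let Λ : (Euc n × ℝ) →ₗ[ℝ] Euc (n + 1) :=
    ι.toLinearMap.coprod (LinearMap.toSpanSingleton ℝ _ e)
  have hΛ : ∀ v t, Λ (v, t) = ι v + t • e := fun v t => rfl
  have hee : inner ℝ e e = (1 : ℝ) := by rw [real_inner_self_eq_norm_sq, he, one_pow]
  have hπ : ∀ v t, projCoord ι (Λ (v, t)) = v := fun v t => by
    rw [hΛ, map_add, map_smul, projCoord_incl, projCoord_dir hι, smul_zero, add_zero]
  have he' : ∀ v t, inner ℝ (Λ (v, t)) e = t := fun v t => by
    rw [hΛ, inner_add_left, hι, inner_smul_left, hee]; simp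
  have hinj : Function.Injective Λ := by
    rintro ⟨v, t⟩ ⟨v', t'⟩ h
    have h1 := hπ v t
    have h2 := he' v t
    rw [h] at h1 h2
    rw [hπ] at h1
    rw [he'] at h2
    rw [h1, h2]
  have hsurj : Function.Surjective Λ :=
    (LinearMap.injective_iff_surjective_of_finrank_eq_finrank (by simp)).1 hinj
  obtain ⟨⟨v, t⟩, rfl⟩ := hsurj y
  rw [hπ, he', hΛ]

theorem norm_sq_eq_projCoord (he : ‖e‖ = 1) (hι : ∀ v, inner ℝ (ι v) e = 0) (y : Euc (n + 1)) :
    ‖y‖ ^ 2 = ‖projCoord ι y‖ ^ 2 + (inner ℝ y e) ^ 2 := by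
  conv_lhs => rw [← incl_projCoord_add he hι y]
  rw [norm_add_sq_real, inner_smul_right, hι, ι.norm_map, norm_smul, he]
  simp

end Splitting

section GraphAtlas

variable {n : ℕ} {M : Type*} [TopologicalSpace M] [ChartedSpace (Euc n) M]

/-- The chain rule for a map into `M` followed by a map from `M`. -/
theorem fderiv_comp_eq_pushforward {V E : Type*} [NormedAddCommGroup V] [NormedSpace ℝ V]
    [NormedAddCommGroup E] [NormedSpace ℝ E] {u : M → V} {s : E → M} {a : E}
    (hu : MDifferentiableAt (𝓡 n) 𝓘(ℝ, V) u (s a))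
    (hs : MDifferentiableAt 𝓘(ℝ, E) (𝓡 n) s a) :
    DifferentiableAt ℝ (u ∘ s) a ∧ ∀ v : E, fderiv ℝ (u ∘ s) a v
      = pushforward u (s a) (mfderiv 𝓘(ℝ, E) (𝓡 n) s a v) := by
  refine ⟨mdifferentiableAt_iff_differentiableAt.1 (hu.comp a hs), fun v => ?_⟩
  exact (congrArg (fun L : E →L[ℝ] V => L v) (mfderiv_eq_fderiv (f := u ∘ s) (x := a)).symm).trans
    (mfderiv_comp_apply a hu hs v)

/-- An immersed hypersurface `F` whose normal `ν` makes an acute angle with the unit vector `e`,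
with an isometry `incl` of `ℝⁿ` onto `e^⊥` and, at each point, a coordinate system of `M` given by
the orthogonal projection to `e^⊥ ≅ ℝⁿ`. In these coordinates the hypersurface is a graph. -/
structure GraphAtlas (F ν : M → Euc (n + 1)) (e : Euc (n + 1)) where
  immersed : IsImmersedHypersurface F ν
  norm_dir : ‖e‖ = 1
  angle_pos : ∀ x, 0 < (inner ℝ (ν x) e : ℝ)
  incl : Euc n →ₗᵢ[ℝ] Euc (n + 1)
  inner_incl : ∀ v, inner ℝ (incl v) e = 0
  chart : M → OpenPartialHomeomorph M (Euc n)
  mem_source : ∀ x, x ∈ (chart x).source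
  source_subset : ∀ x, (chart x).source ⊆ (chartAt (Euc n) x).source
  chart_apply : ∀ x, ∀ y ∈ (chart x).source, chart x y = projCoord incl (F y)
  contMDiffOn_symm : ∀ x, ContMDiffOn 𝓘(ℝ, Euc n) (𝓡 n) ∞ (chart x).symm (chart x).target

/-- The projection to `e^⊥` is an immersion, since `e` is nowhere tangent to the hypersurface. -/
theorem injective_projCoord_pushforward {F ν : M → Euc (n + 1)}
    (hF : IsImmersedHypersurface F ν) {e : Euc (n + 1)} (he : ‖e‖ = 1)
    (hν : ∀ x, 0 < (inner ℝ (ν x) e : ℝ)) {ι : Euc n →ₗᵢ[ℝ] Euc (n + 1)}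
    (hι : ∀ v, inner ℝ (ι v) e = 0) (x : M) (v : TangentSpace (𝓡 n) x)
    (h : projCoord ι (pushforward F x v) = 0) : v = 0 := by
  have h1 := incl_projCoord_add he hι (pushforward F x v)
  rw [h, map_zero, zero_add] at h1
  have h2 := hF.normal x v
  rw [← h1, inner_smul_right] at h2
  have h3 := (mul_eq_zero.1 h2).resolve_right (hν x).ne'
  rw [h3, zero_smul] at h1
  exact hF.immersion x (h1.symm.trans (map_zero (mfderiv (𝓡 n) 𝓘(ℝ, Euc (n + 1)) F x)).symm)

/-- Graph coordinates exist by the inverse function theorem. -/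
theorem exists_graphAtlas [IsManifold (𝓡 n) ∞ M] {F ν : M → Euc (n + 1)}
    (hF : IsImmersedHypersurface F ν) {e : Euc (n + 1)} (he : ‖e‖ = 1)
    (hν : ∀ x, 0 < (inner ℝ (ν x) e : ℝ)) : Nonempty (GraphAtlas F ν e) := by
  obtain ⟨ι, hι⟩ := exists_linearIsometry_orthogonal e he
  have key : ∀ x : M, ∃ φ : OpenPartialHomeomorph M (Euc n), x ∈ φ.source ∧
      φ.source ⊆ (chartAt (Euc n) x).source ∧ (∀ y ∈ φ.source, φ y = projCoord ι (F y)) ∧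
      ContMDiffOn 𝓘(ℝ, Euc n) (𝓡 n) ∞ φ.symm φ.target := by
    intro x
    let c := chartAt (Euc n) x
    have hcm : c.MDifferentiable (𝓡 n) (𝓡 n) := mdifferentiable_chart x
    let G : Euc n → Euc n := fun a => projCoord ι (F (c.symm a))
    have hG : ContDiffOn ℝ ∞ G c.target := by
      have h1 : ContMDiffOn (𝓡 n) 𝓘(ℝ, Euc (n + 1)) ∞ (F ∘ c.symm) c.target :=
        hF.smooth.comp_contMDiffOn contMDiffOn_chart_symm
      exact (projCoord ι).contDiff.comp_contDiffOn (contMDiffOn_iff_contDiffOn.1 h1)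
    have hGd : ∀ a ∈ c.target, ∃ L : Euc n ≃L[ℝ] Euc n,
        HasFDerivAt G (L : Euc n →L[ℝ] Euc n) a := by
      intro a ha
      have hFs : MDifferentiableAt (𝓡 n) 𝓘(ℝ, Euc (n + 1)) F (c.symm a) :=
        (hF.smooth _).mdifferentiableAt (by simp)
      have hsa : MDifferentiableAt (𝓡 n) (𝓡 n) c.symm a := hcm.mdifferentiableAt_symm ha
      have hd : HasFDerivAt G (fderiv ℝ G a) a :=
        ((hG.contDiffAt (c.open_target.mem_nhds ha)).differentiableAt (by simp)).hasFDerivAt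
      have hval : ∀ v, fderiv ℝ G a v
          = projCoord ι (pushforward F (c.symm a) (mfderiv (𝓡 n) (𝓡 n) c.symm a v)) := by
        intro v
        obtain ⟨hFd, hFv⟩ := fderiv_comp_eq_pushforward hFs hsa
        have h1 : fderiv ℝ G a = projCoord ι ∘L fderiv ℝ (F ∘ c.symm) a :=
          ((projCoord ι).hasFDerivAt.comp a hFd.hasFDerivAt).fderiv
        rw [h1, ContinuousLinearMap.comp_apply, hFv]
      have hinj : Function.Injective (fderiv ℝ G a : Euc n →ₗ[ℝ] Euc n) := by
        rw [← LinearMap.ker_eq_bot, LinearMap.ker_eq_bot']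
        intro v hv
        have h1 := injective_projCoord_pushforward hF he hν hι _ _ ((hval v).symm.trans hv)
        have h2 := hcm.symm.mfderiv_injective ha
        exact h2 (h1.trans (map_zero _).symm)
      let L := (LinearEquiv.ofInjectiveOfFinrankEq _ hinj rfl).toContinuousLinearEquiv
      refine ⟨L, ?_⟩
      have hL : (L : Euc n →L[ℝ] Euc n) = fderiv ℝ G a := rfl
      rwa [hL]
    have hxt : c x ∈ c.target := c.map_source (mem_chart_source (Euc n) x)
    obtain ⟨L, hL⟩ := hGd (c x) hxt
    have hGs : HasStrictFDerivAt G (L : Euc n →L[ℝ] Euc n) (c x) :=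
      (hG.contDiffAt (c.open_target.mem_nhds hxt)).hasStrictFDerivAt' hL (by simp)
    let h := hGs.toOpenPartialHomeomorph G
    have hh : ∀ a, h a = G a := fun a => by
      rw [show (h : Euc n → Euc n) = G from hGs.toOpenPartialHomeomorph_coe]
    refine ⟨c.trans h, ?_, ?_, ?_, ?_⟩
    · rw [OpenPartialHomeomorph.trans_source]
      exact ⟨mem_chart_source (Euc n) x, hGs.mem_toOpenPartialHomeomorph_source⟩
    · rw [OpenPartialHomeomorph.trans_source]
      exact inter_subset_left
    · intro y hy
      rw [OpenPartialHomeomorph.trans_source] at hy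
      rw [OpenPartialHomeomorph.trans_apply, hh]
      simp only [G, c.left_inv hy.1]
    · rw [OpenPartialHomeomorph.trans_target]
      have h1 : ContMDiffOn 𝓘(ℝ, Euc n) 𝓘(ℝ, Euc n) ∞ h.symm
          (h.target ∩ h.symm ⁻¹' c.target) := by
        rw [contMDiffOn_iff_contDiffOn]
        intro a ha
        obtain ⟨L, hL⟩ := hGd (h.symm a) ha.2
        refine (h.contDiffAt_symm ha.1 (f₀' := L) ?_ ?_).contDiffWithinAt
        · rwa [show (h : Euc n → Euc n) = G from hGs.toOpenPartialHomeomorph_coe]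
        · rw [show (h : Euc n → Euc n) = G from hGs.toOpenPartialHomeomorph_coe]
          exact hG.contDiffAt (c.open_target.mem_nhds ha.2)
      exact (contMDiffOn_chart_symm (I := 𝓡 n) (n := ∞) (x := x)).comp h1 fun a ha => ha.2
  choose φ h1 h2 h3 h4 using key
  exact ⟨⟨hF, he, hν, ι, hι, φ, h1, h2, h3, h4⟩⟩

end GraphAtlas

/-! ### Calculus in graph coordinates -/

namespace GraphAtlas

variable {n : ℕ} {M : Type*} [TopologicalSpace M] [ChartedSpace (Euc n) M]
  {F ν : M → Euc (n + 1)} {e : Euc (n + 1)} (G : GraphAtlas F ν e)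

/-- The orthogonal projection of the hypersurface to `e^⊥ ≅ ℝⁿ`. -/
noncomputable def proj (x : M) : Euc n := projCoord G.incl (F x)

/-- The negative of the horizontal part of the normal. For the graph of `w` it is
`∇w / √(1 + |∇w|²)`. -/
noncomputable def slope (x : M) : Euc n := -projCoord G.incl (ν x)

/-- The function `⟨ν, e⟩`. -/
noncomputable def angle (_ : GraphAtlas F ν e) (x : M) : ℝ := inner ℝ (ν x) e

/-- The function `⟨F, e⟩`, of which the hypersurface is locally the graph. -/
noncomputable def height (_ : GraphAtlas F ν e) (x : M) : ℝ := inner ℝ (F x) e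

/-- The derivative of a function on `M` in the coordinates given by the projection to `e^⊥`.
It does not depend on the choice of the local inverse of the projection. -/
noncomputable def D {V : Type*} [NormedAddCommGroup V] [NormedSpace ℝ V] (u : M → V) (x : M) :
    Euc n →L[ℝ] V :=
  fderiv ℝ (u ∘ (G.chart x).symm) (G.proj x)

variable {V : Type*} [NormedAddCommGroup V] [NormedSpace ℝ V]

theorem chart_eq_proj {x y : M} (hy : y ∈ (G.chart x).source) : G.chart x y = G.proj y :=
  G.chart_apply x y hy

theorem proj_mem_target {x y : M} (hy : y ∈ (G.chart x).source) : G.proj y ∈ (G.chart x).target :=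
  G.chart_eq_proj hy ▸ (G.chart x).map_source hy

theorem symm_proj {x y : M} (hy : y ∈ (G.chart x).source) : (G.chart x).symm (G.proj y) = y := by
  rw [← G.chart_eq_proj hy, (G.chart x).left_inv hy]

theorem proj_symm {x : M} {a : Euc n} (ha : a ∈ (G.chart x).target) :
    G.proj ((G.chart x).symm a) = a := by
  rw [← G.chart_eq_proj ((G.chart x).map_target ha), (G.chart x).right_inv ha]

theorem symm_eventuallyEq {x y : M} (hy : y ∈ (G.chart x).source) :
    (G.chart y).symm =ᶠ[𝓝 (G.proj y)] (G.chart x).symm := by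
  have hyt := G.proj_mem_target (G.mem_source y)
  have hc : ContinuousAt (G.chart y).symm (G.proj y) := (G.chart y).continuousAt_symm hyt
  have hs : (G.chart x).source ∈ 𝓝 ((G.chart y).symm (G.proj y)) := by
    rw [G.symm_proj (G.mem_source y)]; exact (G.chart x).open_source.mem_nhds hy
  filter_upwards [hc hs, (G.chart y).open_target.mem_nhds hyt] with a ha hat
  have := G.symm_proj (mem_preimage.1 ha)
  rw [G.proj_symm hat] at this
  exact this.symm

theorem D_eq (u : M → V) {x y : M} (hy : y ∈ (G.chart x).source) :
    G.D u y = fderiv ℝ (u ∘ (G.chart x).symm) (G.proj y) :=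
  ((G.symm_eventuallyEq hy).fun_comp u).fderiv_eq

theorem D_symm (u : M → V) {x : M} {a : Euc n} (ha : a ∈ (G.chart x).target) :
    G.D u ((G.chart x).symm a) = fderiv ℝ (u ∘ (G.chart x).symm) a := by
  rw [G.D_eq u ((G.chart x).map_target ha), G.proj_symm ha]

theorem contDiffOn_comp_symm {u : M → V} (hu : ContMDiff (𝓡 n) 𝓘(ℝ, V) ∞ u) (x : M) :
    ContDiffOn ℝ ∞ (u ∘ (G.chart x).symm) (G.chart x).target :=
  contMDiffOn_iff_contDiffOn.1 (hu.comp_contMDiffOn (G.contMDiffOn_symm x))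

theorem contDiffAt_comp_symm {u : M → V} (hu : ContMDiff (𝓡 n) 𝓘(ℝ, V) ∞ u) (x : M) :
    ContDiffAt ℝ ∞ (u ∘ (G.chart x).symm) (G.proj x) :=
  (G.contDiffOn_comp_symm hu x).contDiffAt
    ((G.chart x).open_target.mem_nhds (G.proj_mem_target (G.mem_source x)))

theorem differentiableAt_comp_symm {u : M → V} (hu : ContMDiff (𝓡 n) 𝓘(ℝ, V) ∞ u) (x : M) :
    DifferentiableAt ℝ (u ∘ (G.chart x).symm) (G.proj x) :=
  (G.contDiffAt_comp_symm hu x).differentiableAt (by simp)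

theorem mdifferentiableAt_symm {x : M} {a : Euc n} (ha : a ∈ (G.chart x).target) :
    MDifferentiableAt 𝓘(ℝ, Euc n) (𝓡 n) (G.chart x).symm a :=
  ((G.contMDiffOn_symm x).contMDiffAt ((G.chart x).open_target.mem_nhds ha)).mdifferentiableAt
    (by simp)

theorem contMDiff_proj : ContMDiff (𝓡 n) 𝓘(ℝ, Euc n) ∞ G.proj :=
  (projCoord G.incl).contMDiff.comp G.immersed.smooth

theorem contMDiff_slope : ContMDiff (𝓡 n) 𝓘(ℝ, Euc n) ∞ G.slope :=
  (-projCoord G.incl).contMDiff.comp G.immersed.smooth_normal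

theorem contMDiff_angle : ContMDiff (𝓡 n) 𝓘(ℝ, ℝ) ∞ G.angle := by
  have h : ContMDiff 𝓘(ℝ, Euc (n + 1)) 𝓘(ℝ, ℝ) ∞ fun y : Euc (n + 1) => (inner ℝ y e : ℝ) :=
    (contDiff_id.inner ℝ contDiff_const).contMDiff
  exact h.comp G.immersed.smooth_normal

theorem contMDiff_height : ContMDiff (𝓡 n) 𝓘(ℝ, ℝ) ∞ G.height := by
  have h : ContMDiff 𝓘(ℝ, Euc (n + 1)) 𝓘(ℝ, ℝ) ∞ fun y : Euc (n + 1) => (inner ℝ y e : ℝ) :=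
    (contDiff_id.inner ℝ contDiff_const).contMDiff
  exact h.comp G.immersed.smooth

theorem apply_symm (x : M) {a : Euc n} (ha : a ∈ (G.chart x).target) :
    F ((G.chart x).symm a) = G.incl a + G.height ((G.chart x).symm a) • e := by
  rw [← incl_projCoord_add G.norm_dir G.inner_incl (F ((G.chart x).symm a))]
  congr 2
  exact G.proj_symm ha

theorem D_immersion (x : M) (v : Euc n) : G.D F x v = G.incl v + G.D G.height x v • e := by
  have hx := G.proj_mem_target (G.mem_source x)
  have h1 : F ∘ (G.chart x).symm =ᶠ[𝓝 (G.proj x)]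
      fun a => G.incl.toContinuousLinearMap a + (G.height ∘ (G.chart x).symm) a • e := by
    filter_upwards [(G.chart x).open_target.mem_nhds hx] with a ha using G.apply_symm x ha
  have h2 := (G.differentiableAt_comp_symm G.contMDiff_height x).hasFDerivAt.smul_const e
  have h3 := G.incl.toContinuousLinearMap.hasFDerivAt (x := G.proj x)
  rw [D, h1.fderiv_eq, (h3.fun_add h2).fderiv]
  rfl

/-- Derivatives in graph coordinates are differentials of `M` on the lifted vectors. -/
theorem D_apply_eq_pushforward {u : M → V} {x : M} (hu : MDifferentiableAt (𝓡 n) 𝓘(ℝ, V) u x)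
    (v : Euc n) : G.D u x v
      = pushforward u x (mfderiv 𝓘(ℝ, Euc n) (𝓡 n) (G.chart x).symm (G.proj x) v) := by
  have hx := G.proj_mem_target (G.mem_source x)
  have hsx := G.symm_proj (G.mem_source x)
  have hu' : MDifferentiableAt (𝓡 n) 𝓘(ℝ, V) u ((G.chart x).symm (G.proj x)) := by rwa [hsx]
  have h := (fderiv_comp_eq_pushforward hu' (G.mdifferentiableAt_symm hx)).2 v
  have h2 : ∀ z, z = x → ∀ t : Euc n, pushforward (n := n) u z t = pushforward (n := n) u x t := by
    rintro z rfl t; rfl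
  exact h.trans (h2 _ hsx _)

theorem inner_normal_D (x : M) (v : Euc n) : inner ℝ (ν x) (G.D F x v) = 0 := by
  rw [G.D_apply_eq_pushforward ((G.immersed.smooth x).mdifferentiableAt (by simp))]
  exact G.immersed.normal x _

theorem inner_normal_incl (x : M) (v : Euc n) :
    inner ℝ (ν x) (G.incl v) = -inner ℝ (G.slope x) v := by
  rw [slope, inner_neg_left, inner_projCoord, neg_neg]

/-- The gradient of the height function is `slope / angle`, because `ν` is normal. -/
theorem angle_mul_D_height (x : M) (v : Euc n) :
    G.angle x * G.D G.height x v = inner ℝ (G.slope x) v := by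
  have h := G.inner_normal_D x v
  rw [D_immersion, inner_add_right, inner_smul_right, G.inner_normal_incl] at h
  rw [angle]
  linarith

theorem angle_sq_add (x : M) : G.angle x ^ 2 + ‖G.slope x‖ ^ 2 = 1 := by
  have h := norm_sq_eq_projCoord G.norm_dir G.inner_incl (ν x)
  rw [G.immersed.norm_normal, one_pow] at h
  rw [slope, norm_neg, angle]
  linarith

theorem angle_pos' (x : M) : 0 < G.angle x := G.angle_pos x

theorem D_height (x : M) (v : Euc n) : G.D G.height x v = inner ℝ (G.slope x) v / G.angle x := by
  rw [eq_div_iff (G.angle_pos' x).ne', mul_comm, G.angle_mul_D_height]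

theorem norm_D_immersion_sq (x : M) (v : Euc n) :
    ‖G.D F x v‖ ^ 2 = ‖v‖ ^ 2 + (inner ℝ (G.slope x) v / G.angle x) ^ 2 := by
  rw [norm_sq_eq_projCoord G.norm_dir G.inner_incl, G.D_immersion, G.D_height, map_add, map_smul,
    projCoord_incl, projCoord_dir G.inner_incl, inner_add_left, G.inner_incl, inner_smul_left,
    real_inner_self_eq_norm_sq, G.norm_dir]
  simp

theorem isGraphJet (x : M) :
    IsGraphJet (G.D G.slope x) (G.D G.angle x) (G.slope x) (G.angle x) := by
  have hx := G.proj_mem_target (G.mem_source x)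
  have h := isGraphJet_fderiv (G.chart x).open_target (G.contDiffOn_comp_symm G.contMDiff_slope x)
    (G.contDiffOn_comp_symm G.contMDiff_angle x) (G.contDiffOn_comp_symm G.contMDiff_height x)
    (fun a _ => G.angle_pos _) (fun a _ => G.angle_sq_add _)
    (fun a ha v => by
      rw [← G.D_symm _ ha]; exact G.angle_mul_D_height _ v) hx
  simpa [D, G.symm_proj (G.mem_source x)] using h

/-- The vector field `√g ∇⟨ν, e⟩`, where `√g = 1 / ⟨ν, e⟩`, in the coordinates given by the
projection to `e^⊥`. -/
noncomputable def flux (x : M) : Euc n := -G.D G.slope x (G.slope x)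

/-- The squared norm of the second fundamental form, as the trace of the square of the
Weingarten map. -/
noncomputable def normSqShape (x : M) : ℝ :=
  LinearMap.trace ℝ (Euc n) (G.D G.slope x ∘L G.D G.slope x : Euc n →L[ℝ] Euc n)

theorem D_angle_flux (x : M) : G.D G.angle x (G.flux x) = G.angle x * ‖G.D F x (G.flux x)‖ ^ 2 := by
  rw [norm_D_immersion_sq, flux, (G.isGraphJet x).deriv_apply_flux]
  simp [neg_div]

theorem flux_symm (x : M) {a : Euc n} (ha : a ∈ (G.chart x).target) :
    G.flux ((G.chart x).symm a) = -fderiv ℝ (G.slope ∘ (G.chart x).symm) a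
      ((G.slope ∘ (G.chart x).symm) a) := by
  rw [flux, G.D_symm _ ha]; rfl

theorem contDiffOn_D {u : M → V} (hu : ContMDiff (𝓡 n) 𝓘(ℝ, V) ∞ u) (x : M) :
    ContDiffOn ℝ ∞ (fun a => G.D u ((G.chart x).symm a)) (G.chart x).target :=
  ((G.contDiffOn_comp_symm hu x).fderiv_of_isOpen (G.chart x).open_target (m := ∞)
    (by simp)).congr fun a ha => G.D_symm u ha

theorem contDiffOn_flux (x : M) :
    ContDiffOn ℝ ∞ (G.flux ∘ (G.chart x).symm) (G.chart x).target :=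
  ((G.contDiffOn_D G.contMDiff_slope x).clm_apply
    (G.contDiffOn_comp_symm G.contMDiff_slope x)).neg

/-- The coordinate form of `Δ⟨ν, e⟩ = ⟨∇H, e⟩ - |A|² ⟨ν, e⟩`. -/
theorem divergence_flux (x : M) {a : Euc n} (ha : a ∈ (G.chart x).target) :
    euclideanDivergence (G.flux ∘ (G.chart x).symm) a
      = G.D (fun y => -LinearMap.trace ℝ (Euc n) (G.D G.slope y : Euc n →L[ℝ] Euc n))
          ((G.chart x).symm a) (G.slope ((G.chart x).symm a))
        - G.normSqShape ((G.chart x).symm a) := by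
  have hnhds := (G.chart x).open_target.mem_nhds ha
  have h1 : G.flux ∘ (G.chart x).symm =ᶠ[𝓝 a] fun y =>
      -fderiv ℝ (G.slope ∘ (G.chart x).symm) y ((G.slope ∘ (G.chart x).symm) y) := by
    filter_upwards [hnhds] with y hy using G.flux_symm x hy
  have h2 : (fun y => -LinearMap.trace ℝ (Euc n) (G.D G.slope y : Euc n →L[ℝ] Euc n)) ∘
      (G.chart x).symm =ᶠ[𝓝 a] fun y => -euclideanDivergence (G.slope ∘ (G.chart x).symm) y := by
    filter_upwards [hnhds] with y hy
    simp only [Function.comp_apply, euclideanDivergence, G.D_symm _ hy]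
  have h3 := euclideanDivergence_neg_fderiv_self
    ((G.contDiffOn_comp_symm G.contMDiff_slope x).contDiffAt hnhds)
  rw [euclideanDivergence, h1.fderiv_eq, ← euclideanDivergence, h3, G.D_symm _ ha, h2.fderiv_eq,
    normSqShape, G.D_symm _ ha]
  rfl

end GraphAtlas

/-! ### Mean curvature, and the supersolution `⟨ν, e⟩` -/

namespace GraphAtlas

variable {n : ℕ} {M : Type*} [TopologicalSpace M] [ChartedSpace (Euc n) M]
  {F ν : M → Euc (n + 1)} {e : Euc (n + 1)} (G : GraphAtlas F ν e)
  {V : Type*} [NormedAddCommGroup V] [NormedSpace ℝ V]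

theorem D_proj (x : M) (w : Euc n) : G.D G.proj x w = w := by
  have h : G.proj ∘ (G.chart x).symm =ᶠ[𝓝 (G.proj x)] id := by
    filter_upwards [(G.chart x).open_target.mem_nhds (G.proj_mem_target (G.mem_source x))]
      with a ha using G.proj_symm ha
  rw [D, h.fderiv_eq, fderiv_id]
  rfl

theorem mdifferentiableAt_of_comp_symm {u : M → V} {x : M}
    (hu : DifferentiableAt ℝ (u ∘ (G.chart x).symm) (G.proj x)) :
    MDifferentiableAt (𝓡 n) 𝓘(ℝ, V) u x := by
  have h1 : MDifferentiableAt (𝓡 n) 𝓘(ℝ, V) ((u ∘ (G.chart x).symm) ∘ G.proj) x :=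
    (mdifferentiableAt_iff_differentiableAt.2 hu).comp x
      ((G.contMDiff_proj x).mdifferentiableAt (by simp))
  refine h1.congr_of_eventuallyEq ?_
  filter_upwards [(G.chart x).open_source.mem_nhds (G.mem_source x)] with y hy
  simp [G.symm_proj hy]

/-- The differential of the projection to `e^⊥`, as a linear isomorphism. -/
noncomputable def projDeriv (x : M) : Euc n →ₗ[ℝ] Euc n :=
  let L : Euc n →L[ℝ] Euc n := mfderiv (𝓡 n) 𝓘(ℝ, Euc n) G.proj x
  L.toLinearMap

theorem D_projDeriv {u : M → V} {x : M} (hu : MDifferentiableAt (𝓡 n) 𝓘(ℝ, V) u x)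
    (v : Euc n) : G.D u x (G.projDeriv x v) = pushforward (n := n) u x v := by
  let τ' : Euc n →L[ℝ] Euc n := mfderiv 𝓘(ℝ, Euc n) (𝓡 n) (G.chart x).symm (G.proj x)
  let τ : Euc n →ₗ[ℝ] Euc n := τ'.toLinearMap
  let P : Euc n →ₗ[ℝ] Euc n := G.projDeriv x
  have h1 : P ∘ₗ τ = LinearMap.id := by
    ext1 w
    exact (G.D_apply_eq_pushforward ((G.contMDiff_proj x).mdifferentiableAt (by simp)) w).symm.trans
      (G.D_proj x w)
  have h2 : τ ∘ₗ P = LinearMap.id := (LinearMap.comp_eq_id_comm ℝ (Euc n)).1 h1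
  have h3 : τ (P v) = v := LinearMap.congr_fun h2 v
  rw [G.D_apply_eq_pushforward hu]
  exact congrArg (pushforward (n := n) u x) h3

theorem bijective_projDeriv (x : M) : Function.Bijective (G.projDeriv x) := by
  have hF : MDifferentiableAt (𝓡 n) 𝓘(ℝ, Euc (n + 1)) F x :=
    (G.immersed.smooth x).mdifferentiableAt (by simp)
  have hinj : Function.Injective (G.projDeriv x) := by
    intro v v' h
    refine G.immersed.immersion x ?_
    rw [← G.D_projDeriv hF, ← G.D_projDeriv hF, h]
  let P : Euc n →ₗ[ℝ] Euc n := G.projDeriv x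
  exact ⟨hinj, (LinearMap.injective_iff_surjective (f := P)).1 hinj⟩

/-- The coordinate vectors of the preferred chart at `x`, in the coordinates given by the
projection to `e^⊥`. -/
noncomputable def coordBasis (x : M) : Module.Basis (Fin n) ℝ (Euc n) :=
  (EuclideanSpace.basisFun (Fin n) ℝ).toBasis.map
    (LinearEquiv.ofBijective (G.projDeriv x) (G.bijective_projDeriv x))

theorem pderiv_eq {u : M → V} {x : M} (hu : MDifferentiableAt (𝓡 n) 𝓘(ℝ, V) u x) (i : Fin n) :
    pderiv u x i = G.D u x (G.coordBasis x i) := by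
  refine (G.D_projDeriv hu (EuclideanSpace.single i 1)).symm.trans ?_
  congr 1
  simp only [coordBasis, Module.Basis.map_apply, OrthonormalBasis.coe_toBasis,
    EuclideanSpace.basisFun_apply]
  rfl

/-- A vector orthogonal to the normal is tangent. -/
theorem eq_D_immersion_of_inner_eq_zero {x : M} {y : Euc (n + 1)} (hy : inner ℝ (ν x) y = 0) :
    y = G.D F x (projCoord G.incl y) := by
  have h1 := G.inner_normal_D x (projCoord G.incl y)
  rw [D_immersion] at h1 ⊢
  have h2 := incl_projCoord_add G.norm_dir G.inner_incl y
  have h3 : (inner ℝ y e - G.D G.height x (projCoord G.incl y)) * G.angle x = 0 := by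
    rw [← h2] at hy
    rw [inner_add_right, inner_smul_right] at hy h1
    rw [angle]
    linear_combination hy - h1
  have h4 := (mul_eq_zero.1 h3).resolve_right (G.angle_pos' x).ne'
  rw [← sub_eq_zero.1 h4, h2]

/-- The Weingarten equation: `-Dq` is the Weingarten map. -/
theorem D_normal (x : M) (w : Euc n) : G.D ν x w = G.D F x (-G.D G.slope x w) := by
  have dν := G.differentiableAt_comp_symm G.immersed.smooth_normal x
  have hsx := G.symm_proj (G.mem_source x)
  have h1 : inner ℝ (ν x) (G.D ν x w) = 0 := by
    have h2 : (fun a => inner ℝ ((ν ∘ (G.chart x).symm) a) ((ν ∘ (G.chart x).symm) a))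
        = fun _ => (1 : ℝ) := by
      funext a
      rw [real_inner_self_eq_norm_sq, Function.comp_apply, G.immersed.norm_normal, one_pow]
    have h3 := congrArg (fun L => fderiv ℝ L (G.proj x) w) h2
    simp only [fderiv_inner_apply ℝ dν dν, fderiv_const_apply, zero_apply] at h3
    rw [real_inner_comm, Function.comp_apply, hsx] at h3
    rw [real_inner_comm, D]
    linarith
  have h4 : projCoord G.incl (G.D ν x w) = -G.D G.slope x w := by
    have h5 : G.slope ∘ (G.chart x).symm
        = fun a => (-projCoord G.incl) ((ν ∘ (G.chart x).symm) a) := rfl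
    have h6 := ((-projCoord G.incl).hasFDerivAt.comp (G.proj x) dν.hasFDerivAt).fderiv
    rw [D, D, h5]
    erw [h6]
    simp
  rw [← h4]
  exact G.eq_D_immersion_of_inner_eq_zero h1

theorem metricMatrix_eq_gram (x : M) :
    metricMatrix F x = Matrix.gram ℝ fun i => G.D F x (G.coordBasis x i) := by
  have hF : MDifferentiableAt (𝓡 n) 𝓘(ℝ, Euc (n + 1)) F x :=
    (G.immersed.smooth x).mdifferentiableAt (by simp)
  ext i j
  simp only [metricMatrix, Matrix.of_apply, Matrix.gram_apply, G.pderiv_eq hF]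

theorem injective_D_immersion (x : M) : Function.Injective (G.D F x) := fun v w h => by
  have h1 := congrArg (projCoord G.incl) h
  simpa [D_immersion, projCoord_incl, projCoord_dir G.inner_incl] using h1

theorem isUnit_det_metricMatrix (G : GraphAtlas F ν e) (x : M) : IsUnit (metricMatrix F x).det := by
  rw [G.metricMatrix_eq_gram, isUnit_iff_ne_zero, Matrix.det_gram_ne_zero_iff_linearIndependent]
  exact (G.coordBasis x).linearIndependent.map' (G.D F x).toLinearMap
    (LinearMap.ker_eq_bot.2 (G.injective_D_immersion x))

theorem meanCurvature_eq (x : M) : meanCurvature F ν x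
    = -LinearMap.trace ℝ (Euc n) (G.D G.slope x : Euc n →L[ℝ] Euc n) := by
  have hν : MDifferentiableAt (𝓡 n) 𝓘(ℝ, Euc (n + 1)) ν x :=
    (G.immersed.smooth_normal x).mdifferentiableAt (by simp)
  have hF : MDifferentiableAt (𝓡 n) 𝓘(ℝ, Euc (n + 1)) F x :=
    (G.immersed.smooth x).mdifferentiableAt (by simp)
  let b := G.coordBasis x
  let A : Euc n →ₗ[ℝ] Euc n := -(G.D G.slope x).toLinearMap
  let a := LinearMap.toMatrix b b A
  have ha : ∀ i, A (b i) = ∑ k, a k i • b k := fun i => by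
    simp only [a, LinearMap.toMatrix_apply]
    exact (b.sum_repr _).symm
  have hh : secondFundamentalForm F ν x = a.transpose * metricMatrix F x := by
    ext i j
    simp only [secondFundamentalForm, metricMatrix, Matrix.mul_apply, Matrix.of_apply,
      Matrix.transpose_apply, G.pderiv_eq hν, G.pderiv_eq hF]
    rw [D_normal, show -G.D G.slope x (G.coordBasis x i) = A (b i) from rfl, ha, map_sum, sum_inner]
    refine Finset.sum_congr rfl fun k _ => ?_
    rw [map_smul, inner_smul_left]
    rfl
  rw [meanCurvature, hh, Matrix.trace_mul_comm, Matrix.mul_assoc,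
    Matrix.mul_nonsing_inv _ (G.isUnit_det_metricMatrix x), Matrix.mul_one, Matrix.trace_transpose,
    ← LinearMap.trace_eq_matrix_trace ℝ b A, map_neg]

theorem inner_tangentialGradient_D {u : M → ℝ} {x : M}
    (hu : MDifferentiableAt (𝓡 n) 𝓘(ℝ, ℝ) u x) (w : Euc n) :
    inner ℝ (tangentialGradient F u x) (G.D F x w) = G.D u x w := by
  have hF : MDifferentiableAt (𝓡 n) 𝓘(ℝ, Euc (n + 1)) F x :=
    (G.immersed.smooth x).mdifferentiableAt (by simp)
  let b := G.coordBasis x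
  have h : ((innerSL ℝ (tangentialGradient F u x)) ∘L G.D F x).toLinearMap
      = (G.D u x).toLinearMap := by
    refine b.ext fun k => ?_
    have h1 : ∀ i, (inner ℝ (pderiv F x i) (pderiv F x k) : ℝ) = metricMatrix F x k i := fun i => by
      rw [real_inner_comm]; rfl
    have h2 : inner ℝ (tangentialGradient F u x) (pderiv F x k) = pderiv u x k := by
      calc (inner ℝ (tangentialGradient F u x) (pderiv F x k) : ℝ)
          = ∑ i, ∑ j, ((metricMatrix F x)⁻¹ i j * pderiv u x j) * metricMatrix F x k i := by
            simp [tangentialGradient, sum_inner, inner_smul_left, h1]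
        _ = ∑ j, (metricMatrix F x * (metricMatrix F x)⁻¹) k j * pderiv u x j := by
            rw [Finset.sum_comm]
            refine Finset.sum_congr rfl fun j _ => ?_
            rw [Matrix.mul_apply, Finset.sum_mul]
            exact Finset.sum_congr rfl fun i _ => by ring
        _ = pderiv u x k := by
            rw [Matrix.mul_nonsing_inv _ (G.isUnit_det_metricMatrix x)]
            simp [Matrix.one_apply]
    rw [G.pderiv_eq hF, G.pderiv_eq hu] at h2
    exact h2
  exact LinearMap.congr_fun h w

/-- The tangential part of `e` is `⟨ν, e⟩ DF(q)`. -/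
theorem inner_tangentialGradient_dir {u : M → ℝ} {x : M}
    (hu : MDifferentiableAt (𝓡 n) 𝓘(ℝ, ℝ) u x) :
    inner ℝ (tangentialGradient F u x) e = G.angle x * G.D u x (G.slope x) := by
  have hF : MDifferentiableAt (𝓡 n) 𝓘(ℝ, Euc (n + 1)) F x :=
    (G.immersed.smooth x).mdifferentiableAt (by simp)
  have h1 : inner ℝ (ν x) (tangentialGradient F u x) = 0 := by
    simp only [tangentialGradient, inner_sum, inner_smul_right]
    refine Finset.sum_eq_zero fun i _ => Finset.sum_eq_zero fun j _ => ?_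
    rw [G.pderiv_eq hF, G.inner_normal_D, mul_zero]
  have h2 : inner ℝ (ν x) (e - G.angle x • ν x) = 0 := by
    rw [inner_sub_right, inner_smul_right, real_inner_self_eq_norm_sq, G.immersed.norm_normal,
      angle]
    simp
  have h3 := G.eq_D_immersion_of_inner_eq_zero h2
  have h4 : projCoord G.incl (e - G.angle x • ν x) = G.angle x • G.slope x := by
    rw [map_sub, projCoord_dir G.inner_incl, map_smul, slope, smul_neg, zero_sub]
  rw [h4] at h3
  have h5 : e = G.D F x (G.angle x • G.slope x) + G.angle x • ν x := by rw [← h3, sub_add_cancel]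
  conv_lhs => rw [h5]
  rw [inner_add_right, G.inner_tangentialGradient_D hu, inner_smul_right,
    real_inner_comm (ν x), h1, map_smul]
  simp

theorem differentiableAt_meanCurvature (x : M) :
    DifferentiableAt ℝ (meanCurvature F ν ∘ (G.chart x).symm) (G.proj x) := by
  have hx := G.proj_mem_target (G.mem_source x)
  have h1 : DifferentiableAt ℝ (fun a => G.D G.slope ((G.chart x).symm a)) (G.proj x) :=
    ((G.contDiffOn_D G.contMDiff_slope x).contDiffAt
      ((G.chart x).open_target.mem_nhds hx)).differentiableAt (by simp)
  let T : (Euc n →L[ℝ] Euc n) →ₗ[ℝ] ℝ :=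
    -(LinearMap.trace ℝ (Euc n) ∘ₗ ContinuousLinearMap.coeLM ℝ)
  have h2 : meanCurvature F ν ∘ (G.chart x).symm
      = fun a => T.toContinuousLinearMap (G.D G.slope ((G.chart x).symm a)) := by
    funext a
    exact G.meanCurvature_eq _
  rw [h2]
  exact T.toContinuousLinearMap.differentiableAt.comp _ h1

/-- A mean curvature that does not increase in the direction `e` makes `⟨ν, e⟩` a supersolution:
`Δ⟨ν, e⟩ ≤ -|A|² ⟨ν, e⟩`. -/
theorem divergence_flux_le (hH : ∀ x, inner ℝ (tangentialGradient F (meanCurvature F ν) x) e ≤ 0)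
    (x : M) {a : Euc n} (ha : a ∈ (G.chart x).target) :
    euclideanDivergence (G.flux ∘ (G.chart x).symm) a ≤ -G.normSqShape ((G.chart x).symm a) := by
  have h1 : (fun y => -LinearMap.trace ℝ (Euc n) (G.D G.slope y : Euc n →L[ℝ] Euc n))
      = meanCurvature F ν := funext fun y => (G.meanCurvature_eq y).symm
  set z := (G.chart x).symm a
  have h2 := hH z
  rw [G.inner_tangentialGradient_dir
    (G.mdifferentiableAt_of_comp_symm (G.differentiableAt_meanCurvature z))] at h2
  have h3 := nonpos_of_mul_nonpos_right h2 (G.angle_pos' z)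
  rw [G.divergence_flux x ha, h1]
  linarith

end GraphAtlas

/-! ### The induced distance -/

section InducedDistance

variable {n : ℕ} {M : Type*} [TopologicalSpace M] [ChartedSpace (Euc n) M]
  {F : M → Euc (n + 1)}

/-- The length of tangent vectors in the induced metric. -/
@[reducible] noncomputable def inducedENorm (F : M → Euc (n + 1)) (z : M) :
    ENorm (TangentSpace (𝓡 n) z) :=
  ⟨fun v => ‖pushforward F z v‖ₑ⟩

theorem inducedENorm_smulClass (F : M → Euc (n + 1)) (z : M) :
    let _ := inducedENorm F
    ENormSMulClass ℝ (TangentSpace (𝓡 n) z) := by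
  let _ := inducedENorm F
  refine ⟨fun r v => ?_⟩
  have h : pushforward F z (r • v) = r • pushforward F z v :=
    map_smul (mfderiv (𝓡 n) 𝓘(ℝ, Euc (n + 1)) F z) r v
  change ‖pushforward F z (r • v)‖ₑ = ‖r‖ₑ * ‖pushforward F z v‖ₑ
  rw [h, enorm_smul]

theorem inducedEDist_self (x : M) : inducedEDist F x x = 0 := by
  let _ := inducedENorm F
  have _ := inducedENorm_smulClass F
  exact riemannianEDist_self (I := 𝓡 n)

theorem inducedEDist_comm (x y : M) : inducedEDist F x y = inducedEDist F y x := by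
  let _ := inducedENorm F
  have _ := inducedENorm_smulClass F
  exact riemannianEDist_comm (I := 𝓡 n)

theorem inducedEDist_triangle (x y z : M) :
    inducedEDist F x z ≤ inducedEDist F x y + inducedEDist F y z := by
  let _ := inducedENorm F
  have _ := inducedENorm_smulClass F
  exact riemannianEDist_triangle (I := 𝓡 n)

theorem pathELength_inducedENorm (hF : ContMDiff (𝓡 n) 𝓘(ℝ, Euc (n + 1)) ∞ F) {γ : ℝ → M}
    {a b : ℝ} (hγ : ContMDiffOn 𝓘(ℝ, ℝ) (𝓡 n) 1 γ (Icc a b)) :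
    let _ := inducedENorm F
    pathELength (𝓡 n) γ a b = ∫⁻ t in Icc a b, ‖deriv (F ∘ γ) t‖ₑ := by
  intro _
  rw [pathELength_eq_lintegral_mfderiv_Ioo, ← restrict_Ioo_eq_restrict_Icc]
  refine setLIntegral_congr_fun measurableSet_Ioo fun t ht => ?_
  have h1 : MDifferentiableAt 𝓘(ℝ, ℝ) (𝓡 n) γ t :=
    ((hγ t ⟨ht.1.le, ht.2.le⟩).contMDiffAt (Icc_mem_nhds ht.1 ht.2)).mdifferentiableAt (by simp)
  have h2 : MDifferentiableAt (𝓡 n) 𝓘(ℝ, Euc (n + 1)) F (γ t) :=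
    (hF _).mdifferentiableAt (by simp)
  change ‖pushforward F (γ t) (mfderiv 𝓘(ℝ, ℝ) (𝓡 n) γ t (1 : ℝ))‖ₑ = _
  rw [← (fderiv_comp_eq_pushforward h2 h1).2 (1 : ℝ), fderiv_apply_one_eq_deriv]

theorem inducedEDist_le_lintegral (hF : ContMDiff (𝓡 n) 𝓘(ℝ, Euc (n + 1)) ∞ F) {γ : ℝ → M}
    {a b : ℝ} (hab : a ≤ b) (hγ : ContMDiffOn 𝓘(ℝ, ℝ) (𝓡 n) 1 γ (Icc a b)) :
    inducedEDist F (γ a) (γ b) ≤ ∫⁻ t in Icc a b, ‖deriv (F ∘ γ) t‖ₑ := by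
  let _ := inducedENorm F
  have _ := inducedENorm_smulClass F
  rw [← pathELength_inducedENorm hF hγ]
  exact riemannianEDist_le_pathELength hγ rfl rfl hab

theorem exists_path_of_inducedEDist_lt (hF : ContMDiff (𝓡 n) 𝓘(ℝ, Euc (n + 1)) ∞ F) {x y : M}
    {r : ℝ≥0∞} (h : inducedEDist F x y < r) :
    ∃ γ : ℝ → M, γ 0 = x ∧ γ 1 = y ∧ ContMDiff 𝓘(ℝ, ℝ) (𝓡 n) 1 γ ∧
      ∫⁻ t in Icc (0 : ℝ) 1, ‖deriv (F ∘ γ) t‖ₑ < r := by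
  let _ := inducedENorm F
  have _ := inducedENorm_smulClass F
  obtain ⟨γ, h0, h1, hγ, hl, -⟩ :=
    exists_lt_locally_constant_of_riemannianEDist_lt (I := 𝓡 n) h zero_lt_one
  exact ⟨γ, h0, h1, hγ, by rwa [← pathELength_inducedENorm hF hγ.contMDiffOn]⟩

theorem contDiff_comp_path (hF : ContMDiff (𝓡 n) 𝓘(ℝ, Euc (n + 1)) ∞ F) {γ : ℝ → M}
    (hγ : ContMDiff 𝓘(ℝ, ℝ) (𝓡 n) 1 γ) : ContDiff ℝ 1 (F ∘ γ) :=
  contMDiff_iff_contDiff.1 ((hF.of_le (by norm_cast)).comp hγ)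

theorem edist_le_inducedEDist (hF : ContMDiff (𝓡 n) 𝓘(ℝ, Euc (n + 1)) ∞ F) (x y : M) :
    edist (F x) (F y) ≤ inducedEDist F x y := by
  refine le_of_forall_gt fun r hr => ?_
  obtain ⟨γ, rfl, rfl, hγ, hl⟩ := exists_path_of_inducedEDist_lt hF hr
  rw [edist_comm, edist_eq_enorm_sub]
  exact lt_of_le_of_lt (enorm_sub_le_lintegral_deriv_of_contDiffOn_Icc
    (contDiff_comp_path hF hγ).contDiffOn zero_le_one) hl

end InducedDistance

namespace GraphAtlas

variable {n : ℕ} {M : Type*} [TopologicalSpace M] [ChartedSpace (Euc n) M]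
  {F ν : M → Euc (n + 1)} {e : Euc (n + 1)} (G : GraphAtlas F ν e)

/-- Straight segments in the coordinates given by the projection bound the induced distance. -/
theorem inducedEDist_symm_le (x : M) {a v : Euc n} {C : ℝ}
    (h : ∀ t ∈ Icc (0 : ℝ) 1, a + t • v ∈ (G.chart x).target ∧
      ‖G.D F ((G.chart x).symm (a + t • v)) v‖ ≤ C) :
    inducedEDist F ((G.chart x).symm a) ((G.chart x).symm (a + v)) ≤ ENNReal.ofReal C := by
  let γ : ℝ → M := fun t => (G.chart x).symm (a + t • v)
  have hγ : ContMDiffOn 𝓘(ℝ, ℝ) (𝓡 n) 1 γ (Icc 0 1) := by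
    have h1 : ContMDiffOn 𝓘(ℝ, ℝ) 𝓘(ℝ, Euc n) 1 (fun t : ℝ => a + t • v) (Icc 0 1) := by
      rw [contMDiffOn_iff_contDiffOn]
      fun_prop
    exact ((G.contMDiffOn_symm x).of_le (by norm_cast)).comp h1 fun t ht => (h t ht).1
  have h1 := inducedEDist_le_lintegral G.immersed.smooth zero_le_one hγ
  have h2 : γ 0 = (G.chart x).symm a := by simp [γ]
  have h3 : γ 1 = (G.chart x).symm (a + v) := by simp [γ]
  rw [h2, h3] at h1
  refine h1.trans ?_
  calc ∫⁻ t in Icc (0 : ℝ) 1, ‖deriv (F ∘ γ) t‖ₑ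
      ≤ ∫⁻ _ in Icc (0 : ℝ) 1, ENNReal.ofReal C := by
        refine setLIntegral_mono measurable_const fun t ht => ?_
        obtain ⟨hm, hC⟩ := h t ht
        have h4 : HasDerivAt (fun t : ℝ => a + t • v) v t := by
          simpa using ((hasDerivAt_id t).smul_const v).const_add a
        have h5 : DifferentiableAt ℝ (F ∘ (G.chart x).symm) (a + t • v) :=
          ((G.contDiffOn_comp_symm G.immersed.smooth x).contDiffAt
            ((G.chart x).open_target.mem_nhds hm)).differentiableAt (by simp)
        have h6 : deriv (F ∘ γ) t = G.D F ((G.chart x).symm (a + t • v)) v := by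
          rw [G.D_symm F hm]
          exact (h5.hasFDerivAt.comp_hasDerivAt t h4).deriv
        rw [h6, ← ofReal_norm]
        exact ENNReal.ofReal_le_ofReal hC
    _ = ENNReal.ofReal C := by simp

theorem norm_proj_sub_le (x y : M) : ‖G.proj x - G.proj y‖ ≤ ‖F x - F y‖ := by
  have h := norm_sq_eq_projCoord G.norm_dir G.inner_incl (F x - F y)
  rw [map_sub] at h
  exact abs_le_of_sq_le_sq' (by simp only [proj]; nlinarith [sq_nonneg (inner ℝ (F x - F y) e : ℝ)])
    (norm_nonneg _) |>.2

theorem edist_proj_le (x y : M) : edist (G.proj x) (G.proj y) ≤ edist (F x) (F y) := by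
  rw [edist_dist, edist_dist, dist_eq_norm, dist_eq_norm]
  exact ENNReal.ofReal_le_ofReal (G.norm_proj_sub_le x y)

theorem isLocalHomeomorph_proj : IsLocalHomeomorph G.proj :=
  IsLocalHomeomorph.mk _ fun x =>
    ⟨G.chart x, G.mem_source x, fun _ hy => (G.chart_eq_proj hy).symm⟩

theorem continuous_proj : Continuous G.proj := G.isLocalHomeomorph_proj.continuous

/-- The derivative of the immersion is locally bounded. -/
theorem exists_ball_norm_D_le (x : M) : ∃ ε > 0, ∃ C > 0,
    Metric.ball (G.proj x) ε ⊆ (G.chart x).target ∧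
    ∀ a ∈ Metric.ball (G.proj x) ε, ‖G.D F ((G.chart x).symm a)‖ ≤ C := by
  have hx := (G.chart x).open_target.mem_nhds (G.proj_mem_target (G.mem_source x))
  have h1 : ContinuousAt (fun a => ‖G.D F ((G.chart x).symm a)‖) (G.proj x) :=
    ((G.contDiffOn_D G.immersed.smooth x).continuousOn.continuousAt hx).norm
  have h2 := h1.eventually_lt_const (lt_add_one _)
  obtain ⟨ε, hε, hb⟩ := Metric.mem_nhds_iff.1 (Filter.inter_mem hx h2)
  exact ⟨ε, hε, _, by positivity, fun a ha => (hb ha).1, fun a ha => (le_of_lt (hb ha).2)⟩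

theorem eventually_inducedEDist_symm_le (G : GraphAtlas F ν e) (x : M) : ∃ ε > 0, ∃ C : ℝ≥0,
    Metric.ball (G.proj x) ε ⊆ (G.chart x).target ∧
    ∀ a ∈ Metric.ball (G.proj x) ε, ∀ b ∈ Metric.ball (G.proj x) ε,
      inducedEDist F ((G.chart x).symm a) ((G.chart x).symm b) ≤ C * edist a b := by
  obtain ⟨ε, hε, C, hC, hb, hD⟩ := G.exists_ball_norm_D_le x
  refine ⟨ε, hε, ⟨C, hC.le⟩, hb, fun a ha b hb' => ?_⟩
  have h := G.inducedEDist_symm_le x (a := a) (v := b - a) (C := C * ‖b - a‖) fun t ht => by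
    have hm : a + t • (b - a) ∈ Metric.ball (G.proj x) ε := by
      have := (convex_ball (G.proj x) ε).add_smul_sub_mem ha hb' ht
      exact this
    exact ⟨hb hm, (ContinuousLinearMap.le_opNorm _ _).trans (by gcongr; exact hD _ hm)⟩
  rw [add_sub_cancel] at h
  refine h.trans (le_of_eq ?_)
  rw [edist_comm, edist_eq_enorm_sub, ENNReal.ofReal_mul hC.le, ofReal_norm]
  congr 1
  rw [ENNReal.ofReal, Real.toNNReal_of_nonneg hC.le]
  rfl

theorem eventually_inducedEDist_lt (G : GraphAtlas F ν e) (x : M) {c : ℝ≥0∞} (hc : 0 < c) :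
    ∀ᶠ y in 𝓝 x, inducedEDist F x y < c := by
  obtain ⟨ε, hε, C, hb, h⟩ := G.eventually_inducedEDist_symm_le x
  have h1 : ∀ᶠ y in 𝓝 x, G.proj y ∈ Metric.ball (G.proj x) ε :=
    G.continuous_proj.continuousAt (Metric.ball_mem_nhds _ hε)
  have h2 : ∀ᶠ y in 𝓝 x, (C : ℝ≥0∞) * edist (G.proj x) (G.proj y) < c := by
    have hc' : Continuous fun y => (C : ℝ≥0∞) * edist (G.proj x) (G.proj y) :=
      (ENNReal.continuous_const_mul ENNReal.coe_ne_top).comp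
        (continuous_const.edist G.continuous_proj)
    refine hc'.continuousAt.eventually_lt_const ?_
    simpa using hc
  filter_upwards [h1, h2, (G.chart x).open_source.mem_nhds (G.mem_source x)] with y hy1 hy2 hy3
  refine lt_of_le_of_lt ?_ hy2
  have := h _ (Metric.mem_ball_self hε) _ hy1
  rwa [G.symm_proj (G.mem_source x), G.symm_proj hy3] at this

/-- Balls of the induced distance are small in the topology of `M`: a short path projects to a short
path in `e^⊥`, so it stays over a small coordinate ball. -/
theorem exists_inducedEDist_lt_subset (G : GraphAtlas F ν e) [T2Space M] (x : M) {s : Set M}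
    (hs : s ∈ 𝓝 x) :
    ∃ c : ℝ≥0∞, 0 < c ∧ {y | inducedEDist F x y < c} ⊆ s := by
  have hxt := G.proj_mem_target (G.mem_source x)
  have h1 : (G.chart x).symm ⁻¹' s ∈ 𝓝 (G.proj x) := by
    refine (G.chart x).continuousAt_symm hxt ?_
    rwa [G.symm_proj (G.mem_source x)]
  obtain ⟨ε, hε, hb⟩ := Metric.mem_nhds_iff.1
    (Filter.inter_mem ((G.chart x).open_target.mem_nhds hxt) h1)
  refine ⟨ENNReal.ofReal ε, by simpa using hε, fun y hy => ?_⟩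
  obtain ⟨γ, rfl, rfl, hγ, hl⟩ := exists_path_of_inducedEDist_lt G.immersed.smooth hy
  have hmem : ∀ t ∈ Icc (0 : ℝ) 1, G.proj (γ t) ∈ Metric.ball (G.proj (γ 0)) ε := fun t ht => by
    rw [Metric.mem_ball, ← ENNReal.ofReal_lt_ofReal_iff hε, ← edist_dist]
    refine lt_of_le_of_lt ((G.edist_proj_le _ _).trans ?_) hl
    rw [edist_eq_enorm_sub]
    refine (enorm_sub_le_lintegral_deriv_of_contDiffOn_Icc
      (contDiff_comp_path G.immersed.smooth hγ).contDiffOn ht.1).trans ?_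
    exact lintegral_mono_set (Icc_subset_Icc_right ht.2)
  -- a path that stays over the coordinate ball is the lift of its projection
  have hlift : EqOn γ (fun t => (G.chart (γ 0)).symm (G.proj (γ t))) (Icc 0 1) := by
    refine (T2Space.isSeparatedMap G.proj).eqOn_of_comp_eqOn
      G.isLocalHomeomorph_proj.isLocallyInjective isPreconnected_Icc hγ.continuous.continuousOn ?_
      (fun t ht => ?_) (left_mem_Icc.2 zero_le_one) (G.symm_proj (G.mem_source _)).symm
    · exact (G.chart (γ 0)).continuousOn_symm.comp
        (G.continuous_proj.comp hγ.continuous).continuousOn fun t ht => (hb (hmem t ht)).1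
    · exact (G.proj_symm (hb (hmem t ht)).1).symm
  have h1m := right_mem_Icc.2 (zero_le_one (α := ℝ))
  rw [hlift h1m]
  exact (hb (hmem 1 h1m)).2

/-- The extended distance of the induced metric, which induces the topology of `M`. -/
@[reducible] noncomputable def pseudoEMetricSpace (G : GraphAtlas F ν e) [T2Space M] :
    PseudoEMetricSpace M :=
  PseudoEMetricSpace.ofEDistOfTopology (inducedEDist F) inducedEDist_self inducedEDist_comm
    inducedEDist_triangle fun x => (𝓝 x).basis_sets.to_hasBasis'
      (fun _ hs => G.exists_inducedEDist_lt_subset x hs)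
      fun _ hc => G.eventually_inducedEDist_lt x hc

theorem continuous_inducedEDist (G : GraphAtlas F ν e) [T2Space M] (x : M) :
    Continuous (inducedEDist F x) := by
  let _ := G.pseudoEMetricSpace
  exact continuous_const.edist continuous_id

/-- The induced distance is a length distance. -/
theorem exists_inducedEDist_le_of_lt_add (G : GraphAtlas F ν e) [T2Space M] (x y : M)
    (a b : ℝ≥0∞) (ha : a ≠ ⊤) (hb : 0 < b) (h : inducedEDist F x y < a + b) :
    ∃ z, inducedEDist F x z ≤ a ∧ inducedEDist F z y < b := by
  by_cases hle : inducedEDist F x y ≤ a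
  · exact ⟨y, hle, by rwa [inducedEDist_self]⟩
  obtain ⟨γ, rfl, rfl, hγ, hl⟩ := exists_path_of_inducedEDist_lt G.immersed.smooth h
  have hc : ContinuousOn (fun t => inducedEDist F (γ 0) (γ t)) (Icc 0 1) :=
    ((G.continuous_inducedEDist (γ 0)).comp hγ.continuous).continuousOn
  obtain ⟨t, ht, hta⟩ := intermediate_value_Icc zero_le_one hc
    (show a ∈ Icc _ _ from ⟨by simp [inducedEDist_self], (not_le.1 hle).le⟩)
  have h1 : a ≤ ∫⁻ t in Icc (0 : ℝ) t, ‖deriv (F ∘ γ) t‖ₑ := by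
    rw [← hta]
    exact inducedEDist_le_lintegral G.immersed.smooth ht.1 (hγ.of_le le_rfl).contMDiffOn
  have h2 := inducedEDist_le_lintegral G.immersed.smooth ht.2 (hγ.of_le le_rfl).contMDiffOn
  have h3 : ∫⁻ t in Icc (0 : ℝ) 1, ‖deriv (F ∘ γ) t‖ₑ = (∫⁻ t in Icc (0 : ℝ) t, ‖deriv (F ∘ γ) t‖ₑ)
      + ∫⁻ t in Icc t 1, ‖deriv (F ∘ γ) t‖ₑ := by
    rw [← Icc_union_Ioc_eq_Icc ht.1 ht.2, lintegral_union measurableSet_Ioc,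
      restrict_Ioc_eq_restrict_Icc]
    exact disjoint_left.2 fun s hs hs' => (hs.2.trans_lt hs'.1).false
  refine ⟨γ t, hta.le, h2.trans_lt ?_⟩
  rw [h3] at hl
  exact (ENNReal.add_lt_add_iff_left ha).1 ((add_le_add_left h1 _).trans_lt hl)

/-- Completeness of the induced metric makes the closed balls compact. -/
theorem isCompact_inducedEDist_le (G : GraphAtlas F ν e) [T2Space M]
    (hcomplete : HasCompleteMetric F) (x : M) (r : ℝ≥0) :
    IsCompact {y | inducedEDist F x y ≤ r} := by
  let _ := G.pseudoEMetricSpace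
  have : LocallyCompactSpace M := ChartedSpace.locallyCompactSpace (Euc n) M
  have : CompleteSpace M := EMetric.complete_of_cauchySeq_tendsto fun u hu =>
    hcomplete u (EMetric.cauchySeq_iff.1 hu)
  have h := isCompact_closedEBall_of_length (X := M)
    (fun x y a b ha hb h => G.exists_inducedEDist_le_of_lt_add x y a b ha hb h) x r
  have h2 : Metric.closedEBall x (r : ℝ≥0∞) = {y | inducedEDist F x y ≤ r} := by
    ext y
    rw [Metric.mem_closedEBall, edist_comm]
    rfl
  rwa [h2] at h

end GraphAtlas

/-! ### The induced volume in graph coordinates -/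

section ChartMeasure

variable {M E : Type*} [TopologicalSpace M] [MeasurableSpace M] [BorelSpace M]
  [TopologicalSpace E] [MeasurableSpace E] [BorelSpace E]

theorem OpenPartialHomeomorph.measurableSet_target_inter_preimage
    (φ : OpenPartialHomeomorph M E) {A : Set M} (hA : MeasurableSet A) :
    MeasurableSet (φ.target ∩ φ.symm ⁻¹' A) := by
  have h := (continuousOn_iff_continuous_domRestrict.1 φ.continuousOn_symm).measurable hA
  rw [← Subtype.image_preimage_coe]
  exact φ.open_target.measurableSet.subtype_image h

theorem OpenPartialHomeomorph.map_symm_withDensity_apply (φ : OpenPartialHomeomorph M E)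
    (μ : Measure E) (ρ : E → ℝ≥0∞) {A : Set M} (hA : MeasurableSet A) :
    ((μ.withDensity ρ).restrict φ.target).map φ.symm A
      = ∫⁻ a in φ.target ∩ φ.symm ⁻¹' A, ρ a ∂μ := by
  have hm := φ.continuousOn_symm.aemeasurable (μ := μ.withDensity ρ) φ.open_target.measurableSet
  rw [Measure.map_apply_of_aemeasurable hm hA,
    Measure.restrict_apply' φ.open_target.measurableSet, inter_comm,
    withDensity_apply _ (φ.measurableSet_target_inter_preimage hA)]

end ChartMeasure

namespace GraphAtlas

variable {n : ℕ} {M : Type*} [TopologicalSpace M] [ChartedSpace (Euc n) M]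
  {F ν : M → Euc (n + 1)} {e : Euc (n + 1)} (G : GraphAtlas F ν e)

theorem inner_D_immersion (x : M) (v w : Euc n) : inner ℝ (G.D F x v) (G.D F x w)
    = inner ℝ v w + inner ℝ (G.slope x) v / G.angle x * (inner ℝ (G.slope x) w / G.angle x) := by
  rw [D_immersion, D_immersion, inner_add_left, inner_add_right, inner_add_right,
    G.incl.inner_map_map, inner_smul_right, inner_smul_left, inner_smul_left, inner_smul_right,
    G.inner_incl, real_inner_comm (G.incl w) e, G.inner_incl, real_inner_self_eq_norm_sq,
    G.norm_dir, D_height, D_height]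
  simp

/-- The volume density of the graph is `1 / ⟨ν, e⟩`, and it transforms with the determinant. -/
theorem sqrt_det_gram_D_immersion (x : M) (T : Euc n →L[ℝ] Euc n) :
    Real.sqrt (Matrix.gram ℝ fun i : Fin n =>
      G.D F x (T (EuclideanSpace.single i 1))).det = |T.det| * (G.angle x)⁻¹ := by
  let b := (EuclideanSpace.basisFun (Fin n) ℝ).toBasis
  let t : Matrix (Fin n) (Fin n) ℝ := LinearMap.toMatrix b b T.toLinearMap
  let r : Fin n → ℝ := fun k => G.slope x k / G.angle x
  have ht : ∀ k i, t k i = T (EuclideanSpace.single i 1) k := fun k i => by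
    simp [t, b, LinearMap.toMatrix_apply]
  have hin : ∀ v : Euc n, inner ℝ (G.slope x) v / G.angle x = ∑ k, r k * v k := fun v => by
    rw [PiLp.inner_apply, Finset.sum_div]
    refine Finset.sum_congr rfl fun k _ => ?_
    simp only [r, RCLike.inner_apply, conj_trivial]
    ring
  have hgram : (Matrix.gram ℝ fun i : Fin n => G.D F x (T (EuclideanSpace.single i 1)))
      = t.transpose * (1 + Matrix.replicateCol Unit r * Matrix.replicateRow Unit r) * t := by
    have h1 : (Matrix.replicateRow Unit r * t) = Matrix.replicateRow Unit
        (fun i => inner ℝ (G.slope x) (T (EuclideanSpace.single i 1)) / G.angle x) := by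
      ext _ i
      simp [Matrix.mul_apply, ht, hin]
    have h2 : (t.transpose * Matrix.replicateCol Unit r) = Matrix.replicateCol Unit
        (fun i => inner ℝ (G.slope x) (T (EuclideanSpace.single i 1)) / G.angle x) := by
      ext i _
      simp [Matrix.mul_apply, ht, hin, mul_comm]
    rw [Matrix.mul_add, Matrix.mul_one, Matrix.add_mul, ← Matrix.mul_assoc, h2, Matrix.mul_assoc,
      h1]
    ext i j
    rw [Matrix.gram_apply, inner_D_immersion, Matrix.add_apply]
    congr 1
    · rw [PiLp.inner_apply, Matrix.mul_apply]
      refine Finset.sum_congr rfl fun k _ => ?_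
      simp [ht, mul_comm]
    · simp [Matrix.mul_apply]
  have hr : 1 + r ⬝ᵥ r = (G.angle x)⁻¹ ^ 2 := by
    have h1 := G.angle_sq_add x
    have h2 : ‖G.slope x‖ ^ 2 = ∑ k, G.slope x k * G.slope x k := by
      rw [EuclideanSpace.norm_sq_eq]
      exact Finset.sum_congr rfl fun k _ => by rw [Real.norm_eq_abs, sq_abs, sq]
    have h3 : r ⬝ᵥ r = ‖G.slope x‖ ^ 2 / G.angle x ^ 2 := by
      rw [h2, Finset.sum_div]
      exact Finset.sum_congr rfl fun k _ => by simp only [r]; ring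
    have h4 := (G.angle_pos' x).ne'
    rw [h3]
    field_simp
    linarith
  have hdet : t.det = T.det := LinearMap.det_toMatrix b T.toLinearMap
  rw [hgram, Matrix.det_mul, Matrix.det_mul, Matrix.det_transpose,
    Matrix.det_one_add_replicateCol_mul_replicateRow, hr, hdet]
  rw [show T.det * (G.angle x)⁻¹ ^ 2 * T.det = (T.det * (G.angle x)⁻¹) ^ 2 by ring,
    Real.sqrt_sq_eq_abs, abs_mul, abs_of_pos (inv_pos.2 (G.angle_pos' x))]

variable [IsManifold (𝓡 n) ∞ M]

theorem contDiffOn_chartAt_symm {V : Type*} [NormedAddCommGroup V] [NormedSpace ℝ V] {u : M → V}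
    (hu : ContMDiff (𝓡 n) 𝓘(ℝ, V) ∞ u) (c : M) :
    ContDiffOn ℝ ∞ (u ∘ (chartAt (Euc n) c).symm) (chartAt (Euc n) c).target :=
  contMDiffOn_iff_contDiffOn.1 (hu.comp_contMDiffOn contMDiffOn_chart_symm)

theorem volumeDensity_eq (c : M) {y : Euc n} (hy : y ∈ (chartAt (Euc n) c).target) :
    volumeDensity F c y = |(fderiv ℝ (G.proj ∘ (chartAt (Euc n) c).symm) y).det|
      * (G.angle ((chartAt (Euc n) c).symm y))⁻¹ := by
  set φ := chartAt (Euc n) c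
  set z := φ.symm y with hz
  have hyn := φ.open_target.mem_nhds hy
  have hT : DifferentiableAt ℝ (G.proj ∘ φ.symm) y :=
    ((contDiffOn_chartAt_symm G.contMDiff_proj c).contDiffAt hyn).differentiableAt (by simp)
  have h1 : F ∘ φ.symm =ᶠ[𝓝 y] (F ∘ (G.chart z).symm) ∘ (G.proj ∘ φ.symm) := by
    have hc : ContinuousAt φ.symm y := φ.continuousAt_symm hy
    filter_upwards [hc ((G.chart z).open_source.mem_nhds (G.mem_source z))] with y' hy'
    simp only [Function.comp_apply, G.symm_proj (mem_preimage.1 hy')]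
  have h2 : fderiv ℝ (F ∘ φ.symm) y = G.D F z ∘L fderiv ℝ (G.proj ∘ φ.symm) y := by
    rw [h1.fderiv_eq]
    exact fderiv_comp (g := F ∘ (G.chart z).symm) y
      (G.differentiableAt_comp_symm G.immersed.smooth z) hT
  rw [volumeDensity, h2, ← G.sqrt_det_gram_D_immersion]
  rfl

variable [MeasurableSpace M] [BorelSpace M]

/-- The measure `(1 / ⟨ν, e⟩) dy` on the domain of a graph chart: the area of the graph. -/
noncomputable def graphVolume (x : M) : Measure M :=
  ((volume.withDensity fun a => ENNReal.ofReal (G.angle ((G.chart x).symm a))⁻¹).restrict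
    (G.chart x).target).map (G.chart x).symm

/-- The change of variables from a chart of `M` to graph coordinates. -/
theorem chartVolume_eq_graphVolume (c x : M) {A : Set M} (hA : MeasurableSet A)
    (hAc : A ⊆ (chartAt (Euc n) c).source) (hAx : A ⊆ (G.chart x).source) :
    chartVolume F c A = G.graphVolume x A := by
  set φ := chartAt (Euc n) c with hφ
  have hB := φ.measurableSet_target_inter_preimage hA
  rw [chartVolume, graphVolume, φ.map_symm_withDensity_apply _ _ hA,
    (G.chart x).map_symm_withDensity_apply _ _ hA]
  have himage : (G.chart x).target ∩ (G.chart x).symm ⁻¹' A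
      = (G.proj ∘ φ.symm) '' (φ.target ∩ φ.symm ⁻¹' A) := by
    ext a
    constructor
    · rintro ⟨ha, haA⟩
      refine ⟨φ ((G.chart x).symm a), ⟨φ.map_source (hAc haA), ?_⟩, ?_⟩
      · rw [mem_preimage, φ.left_inv (hAc haA)]; exact haA
      · rw [Function.comp_apply, φ.left_inv (hAc haA), G.proj_symm ha]
    · rintro ⟨y, ⟨-, hyA⟩, rfl⟩
      refine ⟨G.proj_mem_target (hAx hyA), ?_⟩
      rw [mem_preimage, Function.comp_apply, G.symm_proj (hAx hyA)]
      exact hyA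
  have hinj : InjOn (G.proj ∘ φ.symm) (φ.target ∩ φ.symm ⁻¹' A) := by
    rintro y ⟨hy, hyA⟩ y' ⟨hy', hyA'⟩ h
    have h1 : φ.symm y = φ.symm y' := by
      rw [← G.symm_proj (hAx hyA), ← G.symm_proj (hAx hyA')]
      exact congrArg _ h
    exact φ.symm.injOn hy hy' h1
  have hder : ∀ y ∈ φ.target ∩ φ.symm ⁻¹' A, HasFDerivWithinAt (G.proj ∘ φ.symm)
      (fderiv ℝ (G.proj ∘ φ.symm) y) (φ.target ∩ φ.symm ⁻¹' A) y := fun y hy =>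
    ((contDiffOn_chartAt_symm G.contMDiff_proj c).contDiffAt
      (φ.open_target.mem_nhds hy.1)).differentiableAt (by simp) |>.hasFDerivAt.hasFDerivWithinAt
  rw [himage, lintegral_image_eq_lintegral_abs_det_fderiv_mul volume hB hder hinj]
  refine setLIntegral_congr_fun hB fun y hy => ?_
  rw [G.volumeDensity_eq c hy.1, ENNReal.ofReal_mul (abs_nonneg _), Function.comp_apply,
    G.symm_proj (hAx hy.2)]

/-- The induced volume, a least upper bound of measures, is the area of the graph in each graph
chart. -/
theorem inducedVolume_restrict (x : M) :
    (inducedVolume F).restrict (G.chart x).source = G.graphVolume x := by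
  have hs := (G.chart x).open_source.measurableSet
  have hcon : ∀ A, MeasurableSet A →
      G.graphVolume x A = G.graphVolume x (A ∩ (G.chart x).source) := by
    intro A hA
    rw [graphVolume, (G.chart x).map_symm_withDensity_apply _ _ hA,
      (G.chart x).map_symm_withDensity_apply _ _ (hA.inter hs)]
    congr 2
    ext a
    exact ⟨fun h => ⟨h.1, h.2, (G.chart x).map_target h.1⟩, fun h => ⟨h.1, h.2.1⟩⟩
  have hchart : ∀ c A, MeasurableSet A →
      chartVolume F c A = chartVolume F c (A ∩ (chartAt (Euc n) c).source) := by
    intro c A hA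
    rw [chartVolume, (chartAt (Euc n) c).map_symm_withDensity_apply _ _ hA,
      (chartAt (Euc n) c).map_symm_withDensity_apply _ _
        (hA.inter (chartAt (Euc n) c).open_source.measurableSet)]
    congr 2
    ext a
    exact ⟨fun h => ⟨h.1, h.2, (chartAt (Euc n) c).map_target h.1⟩, fun h => ⟨h.1, h.2.1⟩⟩
  -- this measure bounds `chartVolume F c` for every `c`, and is the expected one on the chart
  have hle : inducedVolume F
      ≤ G.graphVolume x + (inducedVolume F).restrict (G.chart x).sourceᶜ := by
    refine iSup_le fun c => Measure.le_iff.2 fun A hA => ?_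
    rw [← measure_inter_add_sdiff A hs, Measure.add_apply]
    refine add_le_add ?_ ?_
    · rw [hchart c _ (hA.inter hs), G.chartVolume_eq_graphVolume c x
        ((hA.inter hs).inter (chartAt (Euc n) c).open_source.measurableSet)
        inter_subset_right (inter_subset_left.trans inter_subset_right)]
      exact measure_mono (inter_subset_left.trans inter_subset_left)
    · rw [Measure.restrict_apply hA, ← sdiff_eq]
      exact Measure.le_iff'.1 (le_iSup (chartVolume F) c) _
  refine le_antisymm (Measure.le_iff.2 fun A hA => ?_) (Measure.le_iff.2 fun A hA => ?_)
  · rw [Measure.restrict_apply hA]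
    refine (Measure.le_iff'.1 hle _).trans ?_
    rw [Measure.add_apply, Measure.restrict_apply (hA.inter hs), inter_assoc, inter_compl_self,
      inter_empty, measure_empty, add_zero]
    exact measure_mono inter_subset_left
  · rw [hcon A hA, Measure.restrict_apply hA, ← G.chartVolume_eq_graphVolume x x (hA.inter hs)
      (inter_subset_right.trans (G.source_subset x)) inter_subset_right]
    exact Measure.le_iff'.1 (le_iSup (chartVolume F) x) _

/-- The measure `⟨ν, e⟩ dv_g`, the pullback of Lebesgue measure under the projection to `e^⊥`. -/
noncomputable def baseVolume : Measure M :=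
  (inducedVolume F).withDensity fun x => ENNReal.ofReal (G.angle x)

theorem baseVolume_restrict (x : M) : G.baseVolume.restrict (G.chart x).source
    = (volume.restrict (G.chart x).target).map (G.chart x).symm := by
  have hs := (G.chart x).open_source.measurableSet
  have ht := (G.chart x).open_target.measurableSet
  have hang : Measurable fun x => ENNReal.ofReal (G.angle x) :=
    (ENNReal.continuous_ofReal.comp G.contMDiff_angle.continuous).measurable
  have hsm : ∀ μ : Measure (Euc n), AEMeasurable (G.chart x).symm (μ.restrict (G.chart x).target) :=
    fun μ => (G.chart x).continuousOn_symm.aemeasurable ht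
  have hinv : AEMeasurable (fun a => ENNReal.ofReal (G.angle ((G.chart x).symm a))⁻¹)
      (volume.restrict (G.chart x).target) :=
    ((hang.comp_aemeasurable (hsm volume)).inv).congr <| Eventually.of_forall fun a =>
      (ENNReal.ofReal_inv_of_pos (G.angle_pos' _)).symm
  rw [baseVolume, restrict_withDensity hs, G.inducedVolume_restrict]
  ext A hA
  rw [withDensity_apply _ hA, ← lintegral_indicator hA, graphVolume,
    lintegral_map' (hang.indicator hA).aemeasurable (hsm _), restrict_withDensity ht]
  refine (lintegral_withDensity_eq_lintegral_mul₀ hinv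
      ((hang.indicator hA).comp_aemeasurable (hsm volume))).trans ?_
  rw [← lintegral_indicator_one hA,
    lintegral_map' ((measurable_one.indicator hA).aemeasurable) (hsm _)]
  refine lintegral_congr fun a => ?_
  simp only [Pi.mul_apply, Function.comp_apply, indicator]
  split_ifs
  · rw [← ENNReal.ofReal_mul (inv_pos.2 (G.angle_pos' _)).le, inv_mul_cancel₀ (G.angle_pos' _).ne']
    simp
  · simp

end GraphAtlas

/-! ### Locally Lipschitz functions -/

section LipschitzNear

/-- The map `f` is Lipschitz on a neighbourhood of `a`. -/
def LipschitzNear {X Y : Type*} [PseudoEMetricSpace X] [PseudoEMetricSpace Y] (f : X → Y) (a : X) :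
    Prop :=
  ∃ K : ℝ≥0, ∃ t ∈ 𝓝 a, LipschitzOnWith K f t

variable {X Y Z : Type*} [PseudoEMetricSpace X] [PseudoEMetricSpace Y] [PseudoEMetricSpace Z]

theorem LipschitzNear.congr {f g : X → Y} {a : X} (hf : LipschitzNear f a) (h : f =ᶠ[𝓝 a] g) :
    LipschitzNear g a := by
  obtain ⟨K, t, ht, hK⟩ := hf
  refine ⟨K, _, inter_mem ht h, fun x hx y hy => ?_⟩
  have hx' : f x = g x := hx.2
  have hy' : f y = g y := hy.2
  rw [← hx', ← hy']
  exact hK hx.1 hy.1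

theorem LipschitzNear.continuousAt {f : X → Y} {a : X} (hf : LipschitzNear f a) :
    ContinuousAt f a := by
  obtain ⟨K, t, ht, hK⟩ := hf
  exact hK.continuousOn.continuousAt ht

theorem LipschitzNear.comp {g : Y → Z} {f : X → Y} {a : X} (hg : LipschitzNear g (f a))
    (hf : LipschitzNear f a) : LipschitzNear (g ∘ f) a := by
  have hfc := hf.continuousAt
  obtain ⟨K, t, ht, hK⟩ := hf
  obtain ⟨L, s, hs, hL⟩ := hg
  exact ⟨L * K, t ∩ f ⁻¹' s, inter_mem ht (hfc hs),
    hL.comp (hK.mono inter_subset_left) fun x hx => hx.2⟩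

theorem LipschitzNear.prodMk {f : X → Y} {g : X → Z} {a : X} (hf : LipschitzNear f a)
    (hg : LipschitzNear g a) : LipschitzNear (fun x => (f x, g x)) a := by
  obtain ⟨K, t, ht, hK⟩ := hf
  obtain ⟨L, s, hs, hL⟩ := hg
  exact ⟨max K L, t ∩ s, inter_mem ht hs,
    (hK.mono inter_subset_left).prodMk (hL.mono inter_subset_right)⟩

theorem ContDiffAt.lipschitzNear {E V : Type*} [NormedAddCommGroup E] [NormedSpace ℝ E]
    [NormedAddCommGroup V] [NormedSpace ℝ V] {f : E → V} {a : E} (hf : ContDiffAt ℝ 1 f a) :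
    LipschitzNear f a :=
  hf.exists_lipschitzOnWith

theorem LipschitzNear.mul {f g : X → ℝ} {a : X} (hf : LipschitzNear f a)
    (hg : LipschitzNear g a) : LipschitzNear (fun x => f x * g x) a :=
  LipschitzNear.comp (g := fun q : ℝ × ℝ => q.1 * q.2)
    (contDiff_fst.mul contDiff_snd).contDiffAt.lipschitzNear (hf.prodMk hg)

variable {E : Type*} [NormedAddCommGroup E] [NormedSpace ℝ E] [FiniteDimensional ℝ E]

/-- A locally Lipschitz function with compact support is Lipschitz. -/
theorem exists_lipschitzWith_of_hasCompactSupport {η : E → ℝ} (h : ∀ a, LipschitzNear η a)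
    (hc : HasCompactSupport η) : ∃ C, LipschitzWith C η := by
  have hll : LocallyLipschitz η := h
  obtain ⟨R, hR, hsupp⟩ := hc.isBounded.subset_closedBall_lt 0 0
  obtain ⟨K, hK⟩ := (hll.locallyLipschitzOn (s := Metric.closedBall 0 (R + 1)))
    |>.exists_lipschitzOnWith_of_compact (isCompact_closedBall _ _)
  obtain ⟨B, hB⟩ := hc.exists_bound_of_continuous hll.continuous
  have hB0 : 0 ≤ B := (norm_nonneg _).trans (hB 0)
  have hfar : ∀ x y, x ∈ Metric.closedBall (0 : E) R → y ∉ Metric.closedBall (0 : E) (R + 1) →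
      dist (η x) (η y) ≤ B * dist x y := by
    intro x y hx hy
    have hy0 : η y = 0 := image_eq_zero_of_notMem_tsupport fun hy' =>
      hy (Metric.closedBall_subset_closedBall (by linarith) (hsupp hy'))
    have hd : 1 ≤ dist x y := by
      rw [Metric.mem_closedBall] at hx hy
      have := dist_triangle y x 0
      rw [dist_comm y x] at this
      linarith
    rw [hy0, dist_zero_right]
    exact (hB x).trans (le_mul_of_one_le_right hB0 hd)
  refine ⟨max K B.toNNReal, LipschitzWith.of_dist_le_mul fun x y => ?_⟩
  have hmax1 : (K : ℝ) ≤ (max K B.toNNReal : ℝ≥0) := by exact_mod_cast le_max_left _ _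
  have hmax2 : B ≤ (max K B.toNNReal : ℝ≥0) := (Real.le_coe_toNNReal B).trans (by
    exact_mod_cast le_max_right _ _)
  by_cases hx : x ∈ Metric.closedBall (0 : E) (R + 1)
  · by_cases hy : y ∈ Metric.closedBall (0 : E) (R + 1)
    · exact (hK.dist_le_mul x hx y hy).trans (by gcongr)
    · by_cases hx' : x ∈ Metric.closedBall (0 : E) R
      · exact (hfar x y hx' hy).trans (by gcongr)
      · rw [image_eq_zero_of_notMem_tsupport fun h => hx' (hsupp h),
          image_eq_zero_of_notMem_tsupport fun h =>
            hy (Metric.closedBall_subset_closedBall (by linarith) (hsupp h)), dist_self]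
        positivity
  · by_cases hy : y ∈ Metric.closedBall (0 : E) R
    · rw [dist_comm, dist_comm x]
      exact (hfar y x hy hx).trans (by gcongr)
    · rw [image_eq_zero_of_notMem_tsupport fun h => hy (hsupp h),
          image_eq_zero_of_notMem_tsupport fun h =>
            hx (Metric.closedBall_subset_closedBall (by linarith) (hsupp h)), dist_self]
      positivity

/-- Rademacher's theorem for locally Lipschitz functions. -/
theorem ae_differentiableAt_of_lipschitzNear [MeasurableSpace E] [BorelSpace E] (μ : Measure E)
    [μ.IsAddHaarMeasure] {η : E → ℝ} {V : Set E} (hV : MeasurableSet V)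
    (h : ∀ a ∈ V, LipschitzNear η a) : ∀ᵐ a ∂μ.restrict V, DifferentiableAt ℝ η a := by
  rw [ae_restrict_iff' hV]
  suffices h0 : μ {a | a ∈ V ∧ ¬DifferentiableAt ℝ η a} = 0 by
    refine (ae_iff.2 ?_)
    simpa only [Classical.not_imp] using h0
  refine measure_null_of_locally_null _ fun a ha => ?_
  obtain ⟨K, t, ht, hK⟩ := h a ha.1
  have h1 := (hK.mono interior_subset).ae_differentiableWithinAt_of_mem (μ := μ)
  refine ⟨interior t ∩ {a | a ∈ V ∧ ¬DifferentiableAt ℝ η a},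
    inter_mem (mem_nhdsWithin_of_mem_nhds (interior_mem_nhds.2 ht)) self_mem_nhdsWithin,
    measure_mono_null ?_ (ae_iff.1 h1)⟩
  rintro b ⟨hb, -, hb'⟩ hd
  exact hb' ((hd hb).differentiableAt (isOpen_interior.mem_nhds hb))

end LipschitzNear

/-! ### Locally Lipschitz functions on the hypersurface -/

namespace GraphAtlas

variable {n : ℕ} {M : Type*} [TopologicalSpace M] [ChartedSpace (Euc n) M]
  {F ν : M → Euc (n + 1)} {e : Euc (n + 1)} (G : GraphAtlas F ν e)

/-- The function `u` is locally Lipschitz in the coordinates given by the projection to `e^⊥`. -/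
def IsLocLip (u : M → ℝ) : Prop :=
  ∀ x, LipschitzNear (u ∘ (G.chart x).symm) (G.proj x)

variable {G}

theorem IsLocLip.lipschitzNear_symm {u : M → ℝ} (hu : G.IsLocLip u) {x : M} {a : Euc n}
    (ha : a ∈ (G.chart x).target) : LipschitzNear (u ∘ (G.chart x).symm) a := by
  have h := (hu ((G.chart x).symm a)).congr
    ((G.symm_eventuallyEq ((G.chart x).map_target ha)).fun_comp u)
  rwa [G.proj_symm ha] at h

theorem IsLocLip.mul {u v : M → ℝ} (hu : G.IsLocLip u) (hv : G.IsLocLip v) :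
    G.IsLocLip fun x => u x * v x := fun x => (hu x).mul (hv x)

theorem IsLocLip.comp {u : M → ℝ} (hu : G.IsLocLip u) {g : ℝ → ℝ}
    (hg : ∀ x, LipschitzNear g (u x)) : G.IsLocLip fun x => g (u x) := fun x =>
  LipschitzNear.comp (f := u ∘ (G.chart x).symm) (by
    rw [Function.comp_apply, G.symm_proj (G.mem_source x)]; exact hg x) (hu x)

variable (G) in
theorem isLocLip_of_contMDiff {u : M → ℝ} (hu : ContMDiff (𝓡 n) 𝓘(ℝ, ℝ) ∞ u) : G.IsLocLip u :=
  fun x => ((G.contDiffAt_comp_symm hu x).of_le (by simp)).lipschitzNear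

variable (G) in
theorem differentiableAt_iff (u : M → ℝ) {x y : M} (hy : y ∈ (G.chart x).source) :
    DifferentiableAt ℝ (u ∘ (G.chart y).symm) (G.proj y)
      ↔ DifferentiableAt ℝ (u ∘ (G.chart x).symm) (G.proj y) :=
  ((G.symm_eventuallyEq hy).fun_comp u).differentiableAt_iff

theorem D_eq_zero_of_eventuallyEq {u : M → ℝ} {x : M} (h : u =ᶠ[𝓝 x] 0) : G.D u x = 0 := by
  have hc : ContinuousAt (G.chart x).symm (G.proj x) :=
    (G.chart x).continuousAt_symm (G.proj_mem_target (G.mem_source x))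
  have h1 : u ∘ (G.chart x).symm =ᶠ[𝓝 (G.proj x)] fun _ => 0 := by
    rw [ContinuousAt, G.symm_proj (G.mem_source x)] at hc
    exact hc.eventually h
  rw [D, h1.fderiv_eq, fderiv_fun_const]
  rfl

variable (G) in
theorem continuous_normSqShape : Continuous G.normSqShape := by
  refine continuous_iff_continuousAt.2 fun x => ?_
  have htr : Continuous fun A : Euc n →L[ℝ] Euc n =>
      LinearMap.trace ℝ (Euc n) (A : Euc n →ₗ[ℝ] Euc n) :=
    LinearMap.continuous_of_finiteDimensional
      ((LinearMap.trace ℝ (Euc n)).comp (ContinuousLinearMap.coeLM ℝ))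
  have h1 : ContinuousAt (fun a => G.D G.slope ((G.chart x).symm a)) (G.chart x x) :=
    (G.contDiffOn_D G.contMDiff_slope x).continuousOn.continuousAt
      ((G.chart x).open_target.mem_nhds ((G.chart x).map_source (G.mem_source x)))
  have h2 := ContinuousAt.comp (g := fun a => G.D G.slope ((G.chart x).symm a)) h1
    ((G.chart x).continuousAt (G.mem_source x))
  have h3 : ContinuousAt (G.D G.slope) x := h2.congr <| by
    filter_upwards [(G.chart x).open_source.mem_nhds (G.mem_source x)] with y hy
    simp only [Function.comp_apply, (G.chart x).left_inv hy]
  exact htr.continuousAt.comp (h3.clm_comp h3)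

variable [MeasurableSpace M] [BorelSpace M]

variable (G) in
theorem aemeasurable_chart (x : M) :
    AEMeasurable (G.chart x) (G.baseVolume.restrict (G.chart x).source) :=
  (G.chart x).continuousOn.aemeasurable (G.chart x).open_source.measurableSet

variable [IsManifold (𝓡 n) ∞ M]

variable (G) in
theorem map_baseVolume_restrict (x : M) :
    (G.baseVolume.restrict (G.chart x).source).map (G.chart x)
      = volume.restrict (G.chart x).target := by
  have ht := (G.chart x).open_target.measurableSet
  have h1 := G.aemeasurable_chart x
  rw [G.baseVolume_restrict] at h1 ⊢
  rw [AEMeasurable.map_map_of_aemeasurable h1 ((G.chart x).continuousOn_symm.aemeasurable ht)]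
  refine (Measure.map_congr ?_).trans Measure.map_id
  filter_upwards [ae_restrict_mem ht] with a ha using (G.chart x).right_inv ha

variable (G) in
theorem integrableOn_source {h : M → ℝ} {x : M}
    (hi : IntegrableOn (h ∘ (G.chart x).symm) (G.chart x).target) :
    IntegrableOn h (G.chart x).source G.baseVolume ∧
    ∫ y in (G.chart x).source, h y ∂G.baseVolume
      = ∫ a in (G.chart x).target, h ((G.chart x).symm a) := by
  have hm := G.map_baseVolume_restrict x
  have hae := G.aemeasurable_chart x
  have hs := (G.chart x).open_source.measurableSet
  rw [IntegrableOn, ← hm] at hi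
  have heq : (h ∘ (G.chart x).symm) ∘ G.chart x =ᵐ[G.baseVolume.restrict (G.chart x).source] h := by
    filter_upwards [ae_restrict_mem hs] with y hy
    simp only [Function.comp_apply, (G.chart x).left_inv hy]
  refine ⟨(hi.comp_aemeasurable hae).congr heq, ?_⟩
  rw [← hm]
  exact (integral_congr_ae heq).symm.trans (integral_map hae hi.aestronglyMeasurable).symm

theorem IsLocLip.ae_differentiableAt [SecondCountableTopology M] {u : M → ℝ} (hu : G.IsLocLip u) :
    ∀ᵐ x ∂G.baseVolume, DifferentiableAt ℝ (u ∘ (G.chart x).symm) (G.proj x) := by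
  refine ae_iff.2 (measure_null_of_locally_null _ fun x _ => ?_)
  have hs := (G.chart x).open_source
  have h1 := ae_differentiableAt_of_lipschitzNear volume (G.chart x).open_target.measurableSet
    fun a ha => hu.lipschitzNear_symm (x := x) ha
  rw [← G.map_baseVolume_restrict] at h1
  have h2 := ae_of_ae_map (G.aemeasurable_chart x) h1
  rw [ae_restrict_iff' hs.measurableSet] at h2
  refine ⟨(G.chart x).source ∩ {y | ¬DifferentiableAt ℝ (u ∘ (G.chart y).symm) (G.proj y)},
    inter_mem (mem_nhdsWithin_of_mem_nhds (hs.mem_nhds (G.mem_source x))) self_mem_nhdsWithin,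
    measure_mono_null ?_ (ae_iff.1 h2)⟩
  rintro y ⟨hy, hy'⟩ h
  have h3 := h hy
  rw [G.chart_eq_proj hy] at h3
  exact hy' ((G.differentiableAt_iff u hy).2 h3)

/-- The Green inequality for a test function supported in one graph chart. -/
theorem IsLocLip.integral_mul_normSqShape_le_of_chart [T2Space M]
    (hH : ∀ x, inner ℝ (tangentialGradient F (meanCurvature F ν) x) e ≤ 0) {u : M → ℝ}
    (hu : G.IsLocLip u) (hu0 : ∀ x, 0 ≤ u x) (hc : HasCompactSupport u) {x : M}
    (hsub : tsupport u ⊆ (G.chart x).source) :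
    Integrable (fun y => u y * G.normSqShape y) G.baseVolume ∧
    Integrable (fun y => G.D u y (G.flux y)) G.baseVolume ∧
    ∫ y, u y * G.normSqShape y ∂G.baseVolume ≤ ∫ y, G.D u y (G.flux y) ∂G.baseVolume := by
  set φ := G.chart x with hφ
  have ht := φ.open_target
  set K : Set (Euc n) := φ '' tsupport u with hKdef
  have hK : IsCompact K := hc.isCompact.image_of_continuousOn (φ.continuousOn.mono hsub)
  have hKt : K ⊆ φ.target := by
    rintro _ ⟨y, hy, rfl⟩
    exact φ.map_source (hsub hy)
  have huK : ∀ a ∈ φ.target, a ∉ K → φ.symm a ∉ tsupport u := fun a ha haK h =>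
    haK ⟨_, h, φ.right_inv ha⟩
  -- `u` in graph coordinates, extended by `0`
  set η : Euc n → ℝ := φ.target.indicator (u ∘ φ.symm) with hη
  have hηt : ∀ a ∈ φ.target, η =ᶠ[𝓝 a] u ∘ φ.symm := fun a ha => by
    filter_upwards [ht.mem_nhds ha] with b hb using indicator_of_mem hb _
  have hη0 : ∀ a ∉ K, η a = 0 := fun a ha => by
    by_cases hat : a ∈ φ.target
    · rw [hη, indicator_of_mem hat]
      exact image_eq_zero_of_notMem_tsupport (f := u) (huK a hat ha)
    · exact indicator_of_notMem hat _
  have htsupp : tsupport η ⊆ K :=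
    closure_minimal (fun a ha => by_contra fun h => ha (hη0 a h)) hK.isClosed
  have hηc : HasCompactSupport η := hK.of_isClosed_subset (isClosed_tsupport _) htsupp
  have hηnear : ∀ a, LipschitzNear η a := fun a => by
    by_cases hat : a ∈ φ.target
    · exact (hu.lipschitzNear_symm hat).congr (hηt a hat).symm
    · have h0 : (fun _ => (0 : ℝ)) =ᶠ[𝓝 a] η := by
        filter_upwards [hK.isClosed.isOpen_compl.mem_nhds fun h => hat (hKt h)] with b hb
        exact (hη0 b hb).symm
      exact (contDiff_const.contDiffAt.lipschitzNear).congr h0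
  obtain ⟨C, hC⟩ := exists_lipschitzWith_of_hasCompactSupport hηnear hηc
  obtain ⟨i1, i2, i3⟩ := integral_fderiv_apply_eq_neg ht (G.contDiffOn_flux x) hC hηc
    (htsupp.trans hKt)
  set S := G.flux ∘ φ.symm with hS
  have hDs : ∀ a ∈ φ.target, fderiv ℝ η a (S a) = G.D u (φ.symm a) (G.flux (φ.symm a)) :=
    fun a ha => by rw [G.D_symm u ha, (hηt a ha).fderiv_eq]; rfl
  have hDz : ∀ y ∉ φ.source, G.D u y (G.flux y) = 0 := fun y hy => by
    rw [D_eq_zero_of_eventuallyEq (notMem_tsupport_iff_eventuallyEq.1 fun h => hy (hsub h))]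
    rfl
  have hTz : ∀ y ∉ φ.source, u y * G.normSqShape y = 0 := fun y hy => by
    rw [image_eq_zero_of_notMem_tsupport fun h => hy (hsub h), zero_mul]
  have hfz : ∀ a ∉ φ.target, fderiv ℝ η a (S a) = 0 := fun a ha => by
    have h0 : η =ᶠ[𝓝 a] fun _ => (0 : ℝ) := by
      filter_upwards [hK.isClosed.isOpen_compl.mem_nhds fun h => ha (hKt h)] with b hb
      exact hη0 b hb
    rw [h0.fderiv_eq, fderiv_fun_const]
    rfl
  obtain ⟨j1, j2⟩ := G.integrableOn_source (h := fun y => G.D u y (G.flux y)) (x := x)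
    (i1.integrableOn.congr_fun hDs ht.measurableSet)
  have hTint : IntegrableOn (fun a => η a * G.normSqShape (φ.symm a)) φ.target := by
    have hcont : ContinuousOn (fun a => η a * G.normSqShape (φ.symm a)) K :=
      hC.continuous.continuousOn.mul
        (G.continuous_normSqShape.comp_continuousOn (φ.continuousOn_symm.mono hKt))
    refine (IntegrableOn.integrable_of_forall_notMem_eq_zero (s := K)
      (hcont.integrableOn_compact hK) fun a ha => ?_).integrableOn
    rw [hη0 a ha, zero_mul]
  obtain ⟨k1, k2⟩ := G.integrableOn_source (h := fun y => u y * G.normSqShape y) (x := x)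
    (hTint.congr_fun (fun a ha => by
      simp only [hη, indicator_of_mem ha, Function.comp_apply]; rfl) ht.measurableSet)
  refine ⟨k1.integrable_of_forall_notMem_eq_zero hTz,
    j1.integrable_of_forall_notMem_eq_zero hDz, ?_⟩
  rw [← setIntegral_eq_integral_of_forall_compl_eq_zero hTz,
    ← setIntegral_eq_integral_of_forall_compl_eq_zero hDz, k2, j2,
    ← setIntegral_congr_fun ht.measurableSet hDs,
    setIntegral_eq_integral_of_forall_compl_eq_zero hfz, i3, ← integral_neg,
    ← setIntegral_eq_integral_of_forall_compl_eq_zero (s := φ.target)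
      (f := fun a => -(η a * euclideanDivergence S a)) (fun a ha => by
        rw [hη0 a fun h => ha (hKt h), zero_mul, neg_zero])]
  refine setIntegral_mono_on (hTint.congr_fun (fun a ha => by
      simp only [hη, indicator_of_mem ha, Function.comp_apply]
      rfl) ht.measurableSet)
    i2.neg.integrableOn ht.measurableSet fun a ha => ?_
  have h1 := G.divergence_flux_le hH x ha
  have h2 := mul_le_mul_of_nonneg_left h1 (hu0 (φ.symm a))
  rw [hη, indicator_of_mem ha, Function.comp_apply]
  rw [mul_neg] at h2
  linarith

end GraphAtlas

/-! ### The Green and Caccioppoli inequalities -/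

namespace GraphAtlas

variable {n : ℕ} {M : Type*} [TopologicalSpace M] [ChartedSpace (Euc n) M]
  {F ν : M → Euc (n + 1)} {e : Euc (n + 1)} {G : GraphAtlas F ν e}

theorem IsLocLip.angle_rpow (p : ℝ) : G.IsLocLip fun x => G.angle x ^ p :=
  IsLocLip.comp (g := fun t => t ^ p) (G.isLocLip_of_contMDiff G.contMDiff_angle) fun x =>
    (Real.contDiffAt_rpow_const_of_ne (G.angle_pos' x).ne').lipschitzNear

/-- The pointwise estimate behind the Caccioppoli inequality. The term with `|∇f|²` has the
coefficient `p < 0` and absorbs the mixed term. -/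
theorem D_sq_mul_rpow_flux_le {p : ℝ} (hp : p < 0) {ζ : M → ℝ} {x : M} {c : ℝ}
    (hd : DifferentiableAt ℝ (ζ ∘ (G.chart x).symm) (G.proj x))
    (hc : 0 ≤ c) (hζ : ∀ v, G.D ζ x v ^ 2 ≤ c * ‖G.D F x v‖ ^ 2) :
    G.D (fun y => ζ y * ζ y * G.angle y ^ p) x (G.flux x) ≤ 1 / (-p) * (G.angle x ^ p * c) := by
  set σ := (G.chart x).symm with hσ
  have hxs : σ (G.proj x) = x := G.symm_proj (G.mem_source x)
  have hf := (G.differentiableAt_comp_symm G.contMDiff_angle x).hasFDerivAt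
  have hpos := G.angle_pos' x
  have h1 := hf.rpow_const (p := p) (Or.inl (by
    rw [Function.comp_apply, hxs]; exact hpos.ne'))
  have h2 := (hd.hasFDerivAt.fun_mul hd.hasFDerivAt).fun_mul h1
  have h3 : G.D (fun y => ζ y * ζ y * G.angle y ^ p) x (G.flux x)
      = G.angle x ^ p * (2 * (ζ x * G.D ζ x (G.flux x)))
        + p * ζ x ^ 2 * (G.angle x ^ (p - 1) * G.D G.angle x (G.flux x)) := by
    have h4 : G.D (fun y => ζ y * ζ y * G.angle y ^ p) x = _ := h2.fderiv
    rw [h4]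
    simp only [Function.comp_apply, ← hσ, hxs, add_apply, smul_apply, smul_eq_mul, D]
    ring
  have h5 : G.angle x ^ (p - 1) * G.angle x = G.angle x ^ p := by
    rw [← Real.rpow_add_one hpos.ne', sub_add_cancel]
  have h6 := hζ (G.flux x)
  set a := G.D ζ x (G.flux x)
  set N := ‖G.D F x (G.flux x)‖
  rw [h3, G.D_angle_flux, ← mul_assoc (G.angle x ^ (p - 1)), h5]
  have hfp : 0 < G.angle x ^ p := Real.rpow_pos_of_pos hpos p
  have hN : 0 ≤ N ^ 2 := sq_nonneg _
  have hp' : 0 < -p := neg_pos.2 hp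
  suffices h7 : 2 * (ζ x * a) ≤ -p * (ζ x ^ 2 * N ^ 2) + c / (-p) by
    have h8 := mul_le_mul_of_nonneg_left h7 hfp.le
    have h9 : 1 / (-p) * (G.angle x ^ p * c) = G.angle x ^ p * (c / (-p)) := by ring
    rw [h9]
    linarith
  have h10 : 2 * (ζ x * a) * (-p) ≤ (-p) ^ 2 * (ζ x ^ 2 * N ^ 2) + c := by
    refine le_of_abs_le (abs_le_of_sq_le_sq ?_ (by positivity))
    have h11 := mul_le_mul_of_nonneg_left h6 (by positivity : 0 ≤ 4 * (-p) ^ 2 * ζ x ^ 2)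
    nlinarith [sq_nonneg ((-p) ^ 2 * (ζ x ^ 2 * N ^ 2) - c)]
  rw [← sub_nonneg] at h10 ⊢
  have h12 : -p * (ζ x ^ 2 * N ^ 2) + c / -p - 2 * (ζ x * a)
      = ((-p) ^ 2 * (ζ x ^ 2 * N ^ 2) + c - 2 * (ζ x * a) * -p) / -p := by
    have := hp.ne
    field_simp
    ring
  rw [h12]
  exact div_nonneg h10 hp'.le

variable [MeasurableSpace M] [BorelSpace M]

/-- The Green inequality `∫ u |A|² f ≤ ∫ ⟨∇u, ∇f⟩` for `f = ⟨ν, e⟩` and a nonnegative locally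
Lipschitz function `u` with compact support. -/
theorem IsLocLip.integral_mul_normSqShape_le [IsManifold (𝓡 n) ∞ M] [T2Space M]
    [SecondCountableTopology M]
    (hH : ∀ x, inner ℝ (tangentialGradient F (meanCurvature F ν) x) e ≤ 0) {u : M → ℝ}
    (hu : G.IsLocLip u) (hu0 : ∀ x, 0 ≤ u x) (hc : HasCompactSupport u) :
    Integrable (fun y => u y * G.normSqShape y) G.baseVolume ∧
    Integrable (fun y => G.D u y (G.flux y)) G.baseVolume ∧
    ∫ y, u y * G.normSqShape y ∂G.baseVolume ≤ ∫ y, G.D u y (G.flux y) ∂G.baseVolume := by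
  have _ : LocallyCompactSpace M := ChartedSpace.locallyCompactSpace (Euc n) M
  obtain ⟨χ, hχ⟩ := SmoothPartitionOfUnity.exists_isSubordinate (𝓡 n) (isClosed_univ (X := M))
    (fun x => (G.chart x).source) (fun x => (G.chart x).open_source)
    fun x _ => mem_iUnion.2 ⟨x, G.mem_source x⟩
  have hfin := χ.locallyFinite.finite_nonempty_inter_compact hc.isCompact
  set s := hfin.toFinset with hs
  have hsum : ∀ y, u y = ∑ i ∈ s, χ i y * u y := fun y => by
    by_cases hy : y ∈ tsupport u
    · rw [← Finset.sum_mul, ← finsum_eq_sum_of_support_subset, χ.sum_eq_one (mem_univ y), one_mul]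
      intro i hi
      rw [hs, Finite.coe_toFinset]
      exact ⟨y, hi, hy⟩
    · simp [image_eq_zero_of_notMem_tsupport hy]
  have hχs : ∀ i, G.IsLocLip fun y => χ i y := fun i => G.isLocLip_of_contMDiff (χ i).contMDiff
  have hpart := fun i => ((hχs i).mul hu).integral_mul_normSqShape_le_of_chart hH
    (fun y => mul_nonneg (χ.nonneg i y) (hu0 y)) hc.mul_left
    ((tsupport_mul_subset_left (f := fun y => χ i y)).trans (hχ i))
  have h1 : (fun y => u y * G.normSqShape y)
      = fun y => ∑ i ∈ s, χ i y * u y * G.normSqShape y := by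
    funext y
    rw [← Finset.sum_mul, ← hsum]
  have h2 : (fun y => G.D u y (G.flux y))
      =ᵐ[G.baseVolume] fun y => ∑ i ∈ s, G.D (fun z => χ i z * u z) y (G.flux y) := by
    filter_upwards [hu.ae_differentiableAt] with y hy
    have h3 : ∀ i ∈ s, DifferentiableAt ℝ ((fun z => χ i z * u z) ∘ (G.chart y).symm) (G.proj y) :=
      fun i _ => (G.differentiableAt_comp_symm (χ i).contMDiff y).mul hy
    have h4 : u ∘ (G.chart y).symm
        = fun a => ∑ i ∈ s, ((fun z => χ i z * u z) ∘ (G.chart y).symm) a := funext fun a => hsum _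
    rw [D, h4, fderiv_fun_sum h3, sum_apply]
    rfl
  refine ⟨?_, ?_, ?_⟩
  · rw [h1]
    exact integrable_finsetSum _ fun i _ => (hpart i).1
  · exact (integrable_finsetSum _ fun i _ => (hpart i).2.1).congr h2.symm
  · rw [integral_congr_ae h2, h1, integral_finsetSum _ fun i _ => (hpart i).1,
      integral_finsetSum _ fun i _ => (hpart i).2.1]
    exact Finset.sum_le_sum fun i _ => (hpart i).2.2

theorem integrable_baseVolume_iff {h : M → ℝ} :
    Integrable h G.baseVolume ↔ Integrable (fun x => G.angle x * h x) (inducedVolume F) := by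
  rw [baseVolume, integrable_withDensity_iff_integrable_smul'
    G.contMDiff_angle.continuous.measurable.ennreal_ofReal (by simp)]
  simp only [ENNReal.toReal_ofReal (G.angle_pos' _).le, smul_eq_mul]

theorem integral_baseVolume (h : M → ℝ) :
    ∫ x, h x ∂G.baseVolume = ∫ x, G.angle x * h x ∂inducedVolume F := by
  rw [baseVolume, integral_withDensity_eq_integral_toReal_smul₀
    G.contMDiff_angle.continuous.measurable.ennreal_ofReal.aemeasurable (by simp)]
  simp only [ENNReal.toReal_ofReal (G.angle_pos' _).le, smul_eq_mul]

/-- The Caccioppoli inequality for the supersolution `f = ⟨ν, e⟩`: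
`∫ ζ² f ^ (p + 1) |A|² ≤ |p|⁻¹ ∫ f ^ (p + 1) |∇ζ|²`, with `Φ` a bound of `|∇ζ|²`. -/
theorem IsLocLip.caccioppoli [IsManifold (𝓡 n) ∞ M] [T2Space M] [SecondCountableTopology M]
    (hH : ∀ x, inner ℝ (tangentialGradient F (meanCurvature F ν) x) e ≤ 0) {p : ℝ} (hp : p < 0)
    {ζ Φ : M → ℝ} (hζ : G.IsLocLip ζ) (hc : HasCompactSupport ζ) (hΦ0 : ∀ x, 0 ≤ Φ x)
    (hΦ : ∀ x v, G.D ζ x v ^ 2 ≤ Φ x * ‖G.D F x v‖ ^ 2)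
    (hint : Integrable (fun x => G.angle x ^ (p + 1) * Φ x) (inducedVolume F)) :
    Integrable (fun x => ζ x * ζ x * G.angle x ^ p * G.normSqShape x) G.baseVolume ∧
    ∫ x, ζ x * ζ x * G.angle x ^ p * G.normSqShape x ∂G.baseVolume
      ≤ 1 / (-p) * ∫ x, G.angle x ^ (p + 1) * Φ x ∂inducedVolume F := by
  have hf : ∀ x, 0 ≤ G.angle x ^ p := fun x => Real.rpow_nonneg (G.angle_pos' x).le p
  obtain ⟨h1, h2, h3⟩ := ((hζ.mul hζ).mul (IsLocLip.angle_rpow p)).integral_mul_normSqShape_le hH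
    (fun x => mul_nonneg (mul_self_nonneg _) (hf x)) (hc.mul_left.mul_right)
  have hpow : (fun x => G.angle x * (G.angle x ^ p * Φ x))
      = fun x => G.angle x ^ (p + 1) * Φ x := by
    funext x
    rw [Real.rpow_add_one (G.angle_pos' x).ne']
    ring
  have h4 : Integrable (fun x => 1 / (-p) * (G.angle x ^ p * Φ x)) G.baseVolume :=
    (integrable_baseVolume_iff.2 (hpow ▸ hint)).const_mul _
  refine ⟨h1, h3.trans ?_⟩
  rw [← hpow, ← integral_baseVolume, ← integral_const_mul]
  refine integral_mono_ae h2 h4 ?_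
  filter_upwards [hζ.ae_differentiableAt] with x hx
  exact D_sq_mul_rpow_flux_le hp hx (hΦ0 x) (hΦ x)

end GraphAtlas

/-! ### Gradient bounds and cutoff functions -/

namespace GraphAtlas

variable {n : ℕ} {M : Type*} [TopologicalSpace M] [ChartedSpace (Euc n) M]
  {F ν : M → Euc (n + 1)} {e : Euc (n + 1)} (G : GraphAtlas F ν e)

/-- A function that is `κ`-Lipschitz at `x` for the induced distance has gradient at most `κ`. -/
theorem abs_D_le_of_edist_le {u : M → ℝ} {x : M} {κ : ℝ≥0}
    (h : ∀ᶠ y in 𝓝 x, edist (u x) (u y) ≤ κ * inducedEDist F x y) (v : Euc n) :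
    |G.D u x v| ≤ κ * ‖G.D F x v‖ := by
  set σ := (G.chart x).symm with hσ
  set a := G.proj x with ha
  have hxt : a ∈ (G.chart x).target := G.proj_mem_target (G.mem_source x)
  have hxs : σ a = x := G.symm_proj (G.mem_source x)
  have hσc : ContinuousAt σ a := (G.chart x).continuousAt_symm hxt
  by_cases hd : DifferentiableAt ℝ (u ∘ σ) a
  swap
  -- `D` is `0` where `u` is not differentiable
  · rw [D, fderiv_zero_of_not_differentiableAt hd]
    simp only [zero_apply, abs_zero]
    positivity
  refine le_of_forall_pos_le_add fun δ hδ => ?_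
  obtain ⟨δ', hδ', hδκ⟩ : ∃ δ' > 0, κ * δ' ≤ δ :=
    ⟨δ / (κ + 1), by positivity, by
      rw [mul_div_assoc', div_le_iff₀ (by positivity)]
      nlinarith [κ.coe_nonneg]⟩
  set C := ‖G.D F x v‖ + δ' with hC
  have hDc : ContinuousAt (fun b => ‖G.D F (σ b) v‖) a := by
    have h1 : ContinuousAt (fun b => G.D F (σ b)) a :=
      (G.contDiffOn_D G.immersed.smooth x).continuousOn.continuousAt
        ((G.chart x).open_target.mem_nhds hxt)
    exact (h1.clm_apply continuousAt_const).norm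
  have hlt : ‖G.D F (σ a) v‖ < C := by rw [hxs, hC]; linarith
  have hev : ∀ᶠ b in 𝓝 a, b ∈ (G.chart x).target ∧ ‖G.D F (σ b) v‖ < C ∧
      edist (u x) (u (σ b)) ≤ κ * inducedEDist F x (σ b) := by
    have h' : ∀ᶠ y in 𝓝 (σ a), edist (u x) (u y) ≤ κ * inducedEDist F x y := by rwa [hxs]
    exact ((G.chart x).open_target.eventually_mem hxt).and
      ((hDc.eventually_lt_const hlt).and (hσc.eventually h'))
  obtain ⟨ε, hε, hball⟩ := Metric.eventually_nhds_iff.1 hev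
  have hline : HasDerivAt (fun t : ℝ => a + t • v) v 0 := by
    simpa using ((hasDerivAt_id (0 : ℝ)).smul_const v).const_add a
  have hder : HasDerivAt ((u ∘ σ) ∘ fun t : ℝ => a + t • v) (G.D u x v) 0 := by
    refine HasFDerivAt.comp_hasDerivAt (0 : ℝ) ?_ hline
    rw [zero_smul, add_zero]
    exact hd.hasFDerivAt
  have hC0 : 0 ≤ C := by positivity
  have hsmall : ∀ᶠ t : ℝ in 𝓝 0, ‖t • v‖ < ε := by
    have hc : Continuous fun t : ℝ => ‖t • v‖ := by fun_prop
    exact hc.continuousAt.eventually_lt_const (by simpa using hε)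
  have hbound : |G.D u x v| ≤ κ * C := by
    refine HasDerivAt.le_of_lip' hder (by positivity) ?_
    filter_upwards [hsmall] with t ht
    have hmem : ∀ s ∈ Icc (0 : ℝ) 1, dist (a + s • t • v) a < ε := fun s hs => by
      rw [dist_eq_norm, add_sub_cancel_left, norm_smul, Real.norm_of_nonneg hs.1]
      exact (mul_le_of_le_one_left (norm_nonneg _) hs.2).trans_lt ht
    have h1 := G.inducedEDist_symm_le x (a := a) (v := t • v) (C := |t| * C) fun s hs => by
      obtain ⟨p1, p2, -⟩ := hball (hmem s hs)
      refine ⟨p1, ?_⟩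
      rw [map_smul, norm_smul, Real.norm_eq_abs]
      exact mul_le_mul_of_nonneg_left p2.le (abs_nonneg t)
    have h2 := (hball (by simpa using hmem 1 ⟨zero_le_one, le_rfl⟩ : dist (a + t • v) a < ε)).2.2
    rw [← hσ, hxs] at h1
    have h3 := h2.trans (mul_le_mul_right h1 _)
    have h4 : (κ : ℝ≥0∞) = ENNReal.ofReal κ := (ENNReal.ofReal_coe_nnreal).symm
    rw [h4, ← ENNReal.ofReal_mul κ.coe_nonneg, edist_dist,
      ENNReal.ofReal_le_ofReal_iff (by positivity), dist_comm, Real.dist_eq] at h3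
    simp only [Function.comp_apply, zero_smul, add_zero, sub_zero, hxs, Real.norm_eq_abs]
    linarith
  calc |G.D u x v| ≤ κ * C := hbound
    _ = κ * ‖G.D F x v‖ + κ * δ' := by rw [hC]; ring
    _ ≤ κ * ‖G.D F x v‖ + δ := by linarith

theorem isLocLip_of_edist_le {u : M → ℝ} {κ : ℝ≥0}
    (h : ∀ x y, edist (u x) (u y) ≤ κ * inducedEDist F x y) : G.IsLocLip u := by
  intro x
  obtain ⟨ε, hε, C, -, hC⟩ := G.eventually_inducedEDist_symm_le x
  refine ⟨κ * C, _, Metric.ball_mem_nhds _ hε, fun a ha b hb => ?_⟩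
  refine (h _ _).trans ((mul_le_mul_right (hC a ha b hb) _).trans ?_)
  rw [ENNReal.coe_mul, mul_assoc]

theorem D_eq_zero_of_forall_le {u : M → ℝ} {x : M} (h : ∀ y, u x ≤ u y) : G.D u x = 0 := by
  refine IsLocalMin.fderiv_eq_zero (Eventually.of_forall fun a => ?_)
  rw [Function.comp_apply, G.symm_proj (G.mem_source x)]
  exact h _

end GraphAtlas

section Cutoff

/-- The cutoff function that is `1` on `M_R`, `0` outside `M_2R` and affine in `|F|` between. -/
noncomputable def extrinsicCutoff {M V : Type*} [NormedAddCommGroup V] (F : M → V) (R : ℝ) (x : M) :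
    ℝ :=
  max (min (2 - ‖F x‖ / R) 1) 0

/-- The cutoff function `1 - d(x₀, x) / r`, and `0` where `d(x₀, x) ≥ r`. The distance is truncated
at `r` before it becomes a real number, which keeps infinite distances harmless. -/
noncomputable def intrinsicCutoff {n : ℕ} {M : Type*} [TopologicalSpace M] [ChartedSpace (Euc n) M]
    (F : M → Euc (n + 1)) (x₀ : M) (r : ℝ≥0) (x : M) : ℝ :=
  1 - (min (inducedEDist F x₀ x) r).toReal / r

section

variable {M V : Type*} [NormedAddCommGroup V] {F : M → V} {x : M} {R : ℝ}

theorem extrinsicCutoff_nonneg : 0 ≤ extrinsicCutoff F R x := le_max_right _ _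

theorem extrinsicCutoff_le_one : extrinsicCutoff F R x ≤ 1 :=
  max_le (min_le_right _ _) zero_le_one

theorem extrinsicCutoff_eq_one (hR : 0 < R) (h : ‖F x‖ ≤ R) : extrinsicCutoff F R x = 1 := by
  have h1 : ‖F x‖ / R ≤ 1 := (div_le_one hR).2 h
  rw [extrinsicCutoff, min_eq_right (by linarith), max_eq_left zero_le_one]

theorem extrinsicCutoff_eq_zero (hR : 0 < R) (h : 2 * R ≤ ‖F x‖) : extrinsicCutoff F R x = 0 := by
  have h1 : 2 ≤ ‖F x‖ / R := (le_div_iff₀ hR).2 h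
  exact max_eq_right ((min_le_left _ _).trans (by linarith))

end

variable {n : ℕ} {M : Type*} [TopologicalSpace M] [ChartedSpace (Euc n) M]
  {F : M → Euc (n + 1)} {x₀ x : M} {R : ℝ} {r : ℝ≥0}

theorem edist_extrinsicCutoff_le (hF : ContMDiff (𝓡 n) 𝓘(ℝ, Euc (n + 1)) ∞ F) (hR : 0 < R)
    (x y : M) : edist (extrinsicCutoff F R x) (extrinsicCutoff F R y)
      ≤ (R⁻¹).toNNReal * inducedEDist F x y := by
  refine le_trans ?_ (mul_le_mul_right (edist_le_inducedEDist hF x y) _)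
  rw [edist_dist, edist_dist, ← ENNReal.ofReal, ← ENNReal.ofReal_mul (inv_pos.2 hR).le]
  refine ENNReal.ofReal_le_ofReal ?_
  have h1 : |extrinsicCutoff F R x - extrinsicCutoff F R y|
      ≤ |(2 - ‖F x‖ / R) - (2 - ‖F y‖ / R)| :=
    (abs_max_sub_max_le_abs _ _ _).trans (by
      have := abs_min_sub_min_le_max (2 - ‖F x‖ / R) 1 (2 - ‖F y‖ / R) 1
      simpa using this)
  rw [Real.dist_eq, dist_eq_norm]
  refine h1.trans ?_
  have h2 : (2 - ‖F x‖ / R) - (2 - ‖F y‖ / R) = R⁻¹ * (‖F y‖ - ‖F x‖) := by ring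
  rw [h2, abs_mul, abs_of_pos (inv_pos.2 hR), abs_sub_comm]
  exact mul_le_mul_of_nonneg_left (abs_norm_sub_norm_le _ _) (inv_pos.2 hR).le

theorem intrinsicCutoff_le_one : intrinsicCutoff F x₀ r x ≤ 1 := by
  rw [intrinsicCutoff]
  have : 0 ≤ (min (inducedEDist F x₀ x) r).toReal / r := by positivity
  linarith

theorem intrinsicCutoff_nonneg : 0 ≤ intrinsicCutoff F x₀ r x := by
  rw [intrinsicCutoff, sub_nonneg]
  refine div_le_one_of_le₀ ?_ r.coe_nonneg
  exact ENNReal.toReal_mono ENNReal.coe_ne_top (min_le_right _ _)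

theorem intrinsicCutoff_eq_zero (hr : 0 < r) (h : r ≤ inducedEDist F x₀ x) :
    intrinsicCutoff F x₀ r x = 0 := by
  rw [intrinsicCutoff, min_eq_right h, ENNReal.coe_toReal, div_self (by positivity), sub_self]

theorem half_le_intrinsicCutoff (hr : 2 ≤ r) (h : inducedEDist F x₀ x ≤ 1) :
    1 / 2 ≤ intrinsicCutoff F x₀ r x := by
  have h1 : (min (inducedEDist F x₀ x) r).toReal ≤ 1 := by
    rw [← ENNReal.toReal_one]
    exact ENNReal.toReal_mono ENNReal.one_ne_top ((min_le_left _ _).trans h)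
  have hr' : (2 : ℝ) ≤ r := by exact_mod_cast hr
  have h2 : (min (inducedEDist F x₀ x) r).toReal / r ≤ 1 / 2 := by
    rw [div_le_div_iff₀ (by linarith) (by norm_num)]
    linarith
  rw [intrinsicCutoff]
  linarith

theorem edist_intrinsicCutoff_le (hr : 0 < r) (x y : M) :
    edist (intrinsicCutoff F x₀ r x) (intrinsicCutoff F x₀ r y)
      ≤ (r⁻¹ : ℝ≥0) * inducedEDist F x y := by
  by_cases htop : inducedEDist F x y = ⊤
  · rw [htop, ENNReal.mul_top (by simpa using hr.ne')]
    exact le_top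
  have hmin : ∀ y z : M, inducedEDist F y z ≠ ⊤ → (min (inducedEDist F x₀ z) r).toReal
      ≤ (min (inducedEDist F x₀ y) r).toReal + (inducedEDist F y z).toReal := fun y z h => by
    have hne : min (inducedEDist F x₀ y) r ≠ ⊤ :=
      ne_top_of_le_ne_top ENNReal.coe_ne_top (min_le_right _ _)
    rw [← ENNReal.toReal_add hne h]
    refine ENNReal.toReal_mono (ENNReal.add_ne_top.2 ⟨hne, h⟩) ?_
    rw [min_add]
    exact min_le_min (inducedEDist_triangle _ _ _) le_self_add
  have h1 := hmin x y htop
  have h2 := hmin y x (by rwa [inducedEDist_comm])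
  rw [inducedEDist_comm y x] at h2
  have hr' : (0 : ℝ) < r := hr
  have h3 : dist (intrinsicCutoff F x₀ r x) (intrinsicCutoff F x₀ r y)
      ≤ (r : ℝ)⁻¹ * (inducedEDist F x y).toReal := by
    have h4 : intrinsicCutoff F x₀ r x - intrinsicCutoff F x₀ r y = (r : ℝ)⁻¹ *
        ((min (inducedEDist F x₀ y) r).toReal - (min (inducedEDist F x₀ x) r).toReal) := by
      rw [intrinsicCutoff, intrinsicCutoff]; ring
    rw [Real.dist_eq, h4, abs_mul, abs_of_pos (inv_pos.2 hr')]
    exact mul_le_mul_of_nonneg_left (abs_le.2 ⟨by linarith, by linarith⟩) (inv_pos.2 hr').le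
  rw [edist_dist]
  refine (ENNReal.ofReal_le_ofReal h3).trans_eq ?_
  rw [ENNReal.ofReal_mul (inv_pos.2 hr').le, ENNReal.ofReal_toReal htop, ← NNReal.coe_inv,
    ENNReal.ofReal_coe_nnreal]

end Cutoff

/-! ### Vanishing of the second fundamental form -/

namespace GraphAtlas

variable {n : ℕ} {M : Type*} [TopologicalSpace M] [ChartedSpace (Euc n) M]
  {F ν : M → Euc (n + 1)} {e : Euc (n + 1)} (G : GraphAtlas F ν e)

theorem normSqShape_nonneg (x : M) : 0 ≤ G.normSqShape x := (G.isGraphJet x).trace_comp_self.1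

/-- The product of the two cutoff functions. The extrinsic one controls the weight; it need not
have compact support, since the immersion need not be proper. The intrinsic one has, since `M` is
complete. -/
noncomputable def cutoff (_ : GraphAtlas F ν e) (x₀ : M) (R : ℝ) (r : ℝ≥0) (x : M) : ℝ :=
  extrinsicCutoff F R x * intrinsicCutoff F x₀ r x

variable {R : ℝ} {r : ℝ≥0}

theorem isLocLip_cutoff (x₀ : M) (hR : 0 < R) (hr : 0 < r) : G.IsLocLip (G.cutoff x₀ R r) :=
  (G.isLocLip_of_edist_le (edist_extrinsicCutoff_le G.immersed.smooth hR)).mul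
    (G.isLocLip_of_edist_le (edist_intrinsicCutoff_le hr))

theorem hasCompactSupport_cutoff [T2Space M] (hcomplete : HasCompleteMetric F) (x₀ : M)
    (hr : 0 < r) : HasCompactSupport (G.cutoff x₀ R r) := by
  refine HasCompactSupport.intro (G.isCompact_inducedEDist_le hcomplete x₀ r) fun x hx => ?_
  rw [cutoff, intrinsicCutoff_eq_zero hr (not_le.1 hx).le, mul_zero]

/-- A bound of `|∇ζ|²` for the cutoff function `ζ`: the extrinsic factor varies only in
`M_2R \ M_R`, with slope `1 / R`, and the intrinsic one has slope `1 / r`. -/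
noncomputable def cutoffGradBound (_ : GraphAtlas F ν e) (R : ℝ) (r : ℝ≥0) (x : M) : ℝ :=
  2 / R ^ 2 * (ballPart F (2 * R) \ ballPart F R).indicator 1 x
    + 2 / r ^ 2 * (ballPart F (2 * R)).indicator 1 x

theorem cutoffGradBound_nonneg (x : M) : 0 ≤ G.cutoffGradBound R r x :=
  add_nonneg (mul_nonneg (by positivity) (indicator_nonneg (fun _ _ => zero_le_one) _))
    (mul_nonneg (by positivity) (indicator_nonneg (fun _ _ => zero_le_one) _))

theorem D_cutoff_sq_le (x₀ : M) (hR : 0 < R) (hr : 0 < r) (x : M) (v : Euc n) :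
    G.D (G.cutoff x₀ R r) x v ^ 2 ≤ G.cutoffGradBound R r x * ‖G.D F x v‖ ^ 2 := by
  have hFc : Continuous F := G.immersed.smooth.continuous
  have hsq : ∀ {κ : ℝ≥0} {c : ℝ}, |G.D (G.cutoff x₀ R r) x v| ≤ κ * ‖G.D F x v‖ →
      (κ : ℝ) ^ 2 ≤ c → G.D (G.cutoff x₀ R r) x v ^ 2 ≤ c * ‖G.D F x v‖ ^ 2 := fun h1 h2 => by
    rw [← sq_abs]
    refine (pow_le_pow_left₀ (abs_nonneg _) h1 2).trans ?_
    rw [mul_pow]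
    exact mul_le_mul_of_nonneg_right h2 (sq_nonneg _)
  have hr2 : (0 : ℝ) ≤ 1 / r ^ 2 := by positivity
  have hmem : ∀ {ρ : ℝ}, x ∈ ballPart F ρ ↔ ‖F x‖ < ρ := by simp [ballPart]
  by_cases h2 : x ∈ ballPart F (2 * R)
  · by_cases h1 : x ∈ ballPart F R
    -- near a point of `M_R` only the intrinsic factor varies
    · refine hsq (κ := r⁻¹) (G.abs_D_le_of_edist_le ?_ v) ?_
      · filter_upwards [hFc.norm.continuousAt.eventually_lt_const (hmem.1 h1)] with y hy
        rw [cutoff, cutoff, extrinsicCutoff_eq_one hR (hmem.1 h1).le,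
          extrinsicCutoff_eq_one hR hy.le, one_mul, one_mul]
        exact edist_intrinsicCutoff_le hr x y
      · rw [cutoffGradBound, indicator_of_notMem (fun h => h.2 h1), indicator_of_mem h2, mul_zero,
          zero_add, Pi.one_apply, mul_one, NNReal.coe_inv, inv_pow, ← one_div]
        rw [show (2 : ℝ) / r ^ 2 = 2 * (1 / r ^ 2) by ring]
        linarith
    · refine hsq (κ := (R⁻¹).toNNReal + r⁻¹) (G.abs_D_le_of_edist_le (Eventually.of_forall
        fun y => ?_) v) ?_
      · have h3 := edist_extrinsicCutoff_le G.immersed.smooth hR x y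
        have h4 := edist_intrinsicCutoff_le (F := F) (x₀ := x₀) hr x y
        rw [ENNReal.coe_add, add_mul]
        refine le_trans ?_ (add_le_add h3 h4)
        rw [edist_dist, edist_dist, edist_dist, ← ENNReal.ofReal_add dist_nonneg dist_nonneg]
        refine ENNReal.ofReal_le_ofReal ?_
        rw [Real.dist_eq, Real.dist_eq, Real.dist_eq, cutoff, cutoff]
        set a := extrinsicCutoff F R x
        set b := extrinsicCutoff F R y
        set c := intrinsicCutoff F x₀ r x
        set d := intrinsicCutoff F x₀ r y
        have hc : |c| ≤ 1 := abs_le.2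
          ⟨by linarith [intrinsicCutoff_nonneg (F := F) (x₀ := x₀) (r := r) (x := x)],
            intrinsicCutoff_le_one⟩
        have hb : |b| ≤ 1 := abs_le.2
          ⟨by linarith [extrinsicCutoff_nonneg (F := F) (R := R) (x := y)], extrinsicCutoff_le_one⟩
        calc |a * c - b * d| = |(a - b) * c + b * (c - d)| := by congr 1; ring
          _ ≤ |a - b| * |c| + |b| * |c - d| := by
            rw [← abs_mul, ← abs_mul]; exact abs_add_le _ _
          _ ≤ |a - b| * 1 + 1 * |c - d| := by gcongr
          _ = |a - b| + |c - d| := by ring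
      · have hann : x ∈ ballPart F (2 * R) \ ballPart F R := And.intro h2 h1
        rw [cutoffGradBound, indicator_of_mem hann, indicator_of_mem h2,
          NNReal.coe_add, NNReal.coe_inv, Real.coe_toNNReal _ (inv_pos.2 hR).le]
        simp only [Pi.one_apply, mul_one]
        rw [show 2 / R ^ 2 + 2 / (r : ℝ) ^ 2 = 2 * (R⁻¹ ^ 2 + (r : ℝ)⁻¹ ^ 2) by
          field_simp]
        exact add_sq_le
  -- outside `M_2R` the cutoff function attains its minimum `0`, so its derivative vanishes
  · have h3 : G.cutoff x₀ R r x = 0 := by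
      rw [cutoff, extrinsicCutoff_eq_zero hR (not_lt.1 (hmem.not.1 h2)), zero_mul]
    rw [G.D_eq_zero_of_forall_le fun y => h3 ▸
      mul_nonneg extrinsicCutoff_nonneg intrinsicCutoff_nonneg, zero_apply, sq, mul_zero]
    exact mul_nonneg (G.cutoffGradBound_nonneg x) (sq_nonneg _)

variable [MeasurableSpace M] [BorelSpace M]

theorem integral_cutoffGradBound (R : ℝ) (r : ℝ≥0) {w : M → ℝ}
    (hint : IntegrableOn w (ballPart F (2 * R)) (inducedVolume F)) :
    Integrable (fun x => w x * G.cutoffGradBound R r x) (inducedVolume F) ∧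
    ∫ x, w x * G.cutoffGradBound R r x ∂inducedVolume F
      = 2 * (1 / R ^ 2 * ∫ x in ballPart F (2 * R) \ ballPart F R, w x ∂inducedVolume F)
        + 2 / r ^ 2 * ∫ x in ballPart F (2 * R), w x ∂inducedVolume F := by
  have hm : ∀ ρ, MeasurableSet (ballPart F ρ) := fun ρ =>
    (Metric.isOpen_ball.preimage G.immersed.smooth.continuous).measurableSet
  have ha := MeasurableSet.diff (hm (2 * R)) (hm R)
  have h1 := hint.mono_set (sdiff_subset (s := ballPart F (2 * R)) (t := ballPart F R))
  have h2 : (fun x => w x * G.cutoffGradBound R r x)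
      = fun x => 2 / R ^ 2 * (ballPart F (2 * R) \ ballPart F R).indicator w x
        + 2 / r ^ 2 * (ballPart F (2 * R)).indicator w x := by
    funext x
    simp only [cutoffGradBound, indicator, Pi.one_apply]
    split_ifs <;> ring
  have h3 := ((integrable_indicator_iff ha).2 h1).const_mul (2 / R ^ 2)
  have h4 := ((integrable_indicator_iff (hm _)).2 hint).const_mul (2 / (r : ℝ) ^ 2)
  rw [h2]
  refine ⟨h3.add h4, ?_⟩
  rw [integral_add h3 h4, integral_const_mul, integral_const_mul,
    integral_indicator ha, integral_indicator (hm _)]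
  ring

variable [IsManifold (𝓡 n) ∞ M]

theorem baseVolume_pos_of_isOpen {O : Set M} (hO : IsOpen O) (hne : O.Nonempty) :
    0 < G.baseVolume O := by
  obtain ⟨x, hx⟩ := hne
  set φ := G.chart x
  have h1 : G.baseVolume.restrict φ.source O = volume (φ.target ∩ φ.symm ⁻¹' O) := by
    rw [G.baseVolume_restrict, Measure.map_apply_of_aemeasurable
      (φ.continuousOn_symm.aemeasurable φ.open_target.measurableSet) hO.measurableSet,
      Measure.restrict_apply' φ.open_target.measurableSet, inter_comm]
  refine lt_of_lt_of_le ?_ (Measure.restrict_apply_le φ.source O)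
  rw [h1]
  refine (φ.isOpen_inter_preimage_symm hO).measure_pos _ ⟨φ x, φ.map_source (G.mem_source x), ?_⟩
  rw [mem_preimage, φ.left_inv (G.mem_source x)]
  exact hx

/-- The hypersurface is totally geodesic. -/
theorem normSqShape_eq_zero [T2Space M] [SecondCountableTopology M]
    (hcomplete : HasCompleteMetric F)
    (hH : ∀ x, inner ℝ (tangentialGradient F (meanCurvature F ν) x) e ≤ 0) {p : ℝ} (hp : p < 0)
    (hint : ∀ R : ℝ, 0 < R →
      IntegrableOn (fun x => G.angle x ^ (p + 1)) (ballPart F R) (inducedVolume F))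
    (hlim : Tendsto
      (fun R : ℝ => 1 / R ^ 2 *
        ∫ x in ballPart F (2 * R) \ ballPart F R, G.angle x ^ (p + 1) ∂inducedVolume F)
      atTop (𝓝 0)) (x₀ : M) : G.normSqShape x₀ = 0 := by
  set O : Set M := {x | inducedEDist F x₀ x < 1} with hO
  have hOo : IsOpen O := isOpen_lt (G.continuous_inducedEDist x₀) continuous_const
  have hx₀ : x₀ ∈ O := by simp [hO, inducedEDist_self]
  set w : M → ℝ := fun x => G.angle x ^ p * G.normSqShape x with hw
  have hw0 : ∀ x, 0 ≤ w x := fun x =>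
    mul_nonneg (Real.rpow_nonneg (G.angle_pos' x).le p) (G.normSqShape_nonneg x)
  have hwc : Continuous w := (G.contMDiff_angle.continuous.rpow_const fun x =>
    Or.inl (G.angle_pos' x).ne').mul G.continuous_normSqShape
  set A : ℝ → ℝ := fun R => 1 / R ^ 2 *
    ∫ x in ballPart F (2 * R) \ ballPart F R, G.angle x ^ (p + 1) ∂inducedVolume F with hA
  set B : ℝ → ℝ := fun R => ∫ x in ballPart F (2 * R), G.angle x ^ (p + 1) ∂inducedVolume F with hB
  -- on `O` the cutoff function is at least `1 / 2` once `R ≥ ‖F x₀‖ + 1` and `r ≥ 2`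
  have key : ∀ R : ℝ, ‖F x₀‖ + 1 ≤ R → ∀ r : ℝ≥0, 2 ≤ r → IntegrableOn w O G.baseVolume ∧
      ∫ x in O, w x ∂G.baseVolume ≤ 4 * (1 / (-p) * (2 * A R + 2 / r ^ 2 * B R)) := by
    intro R hR r hr
    have hR0 : 0 < R := by linarith [norm_nonneg (F x₀)]
    have hr0 : 0 < r := lt_of_lt_of_le two_pos hr
    obtain ⟨i1, i2⟩ := G.integral_cutoffGradBound R r (hint (2 * R) (by linarith))
    obtain ⟨j1, j2⟩ := (G.isLocLip_cutoff x₀ hR0 hr0).caccioppoli hH hp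
      (G.hasCompactSupport_cutoff hcomplete x₀ hr0) G.cutoffGradBound_nonneg
      (G.D_cutoff_sq_le x₀ hR0 hr0) i1
    set z : M → ℝ := fun x =>
      G.cutoff x₀ R r x * G.cutoff x₀ R r x * G.angle x ^ p * G.normSqShape x
      with hz
    have hz0 : ∀ x, 0 ≤ z x := fun x => by
      rw [hz]
      dsimp only
      rw [mul_assoc]
      exact mul_nonneg (mul_self_nonneg _) (hw0 x)
    have hle : ∀ x ∈ O, w x ≤ 4 * z x := fun x hx => by
      have hx' : inducedEDist F x₀ x < 1 := hx
      have h1 : ‖F x‖ ≤ R := by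
        have h2 := (edist_le_inducedEDist G.immersed.smooth x₀ x).trans hx'.le
        rw [edist_dist, ENNReal.ofReal_le_one, dist_eq_norm, norm_sub_rev] at h2
        have := norm_sub_norm_le (F x) (F x₀)
        linarith
      have h2 : 1 / 2 ≤ G.cutoff x₀ R r x := by
        rw [cutoff, extrinsicCutoff_eq_one hR0 h1, one_mul]
        exact half_le_intrinsicCutoff hr hx'.le
      have h3 : 1 ≤ 4 * (G.cutoff x₀ R r x * G.cutoff x₀ R r x) := by nlinarith
      calc w x ≤ 4 * (G.cutoff x₀ R r x * G.cutoff x₀ R r x) * w x :=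
            le_mul_of_one_le_left (hw0 x) h3
        _ = 4 * z x := by rw [hz, hw]; ring
    have hzi := j1.const_mul 4
    have hwi : IntegrableOn w O G.baseVolume :=
      Integrable.mono' hzi.integrableOn hwc.aestronglyMeasurable
        (by
          filter_upwards [ae_restrict_mem hOo.measurableSet] with x hx
          rw [Real.norm_of_nonneg (hw0 x)]
          exact hle x hx)
    refine ⟨hwi, ?_⟩
    calc ∫ x in O, w x ∂G.baseVolume ≤ ∫ x in O, 4 * z x ∂G.baseVolume :=
          setIntegral_mono_on hwi hzi.integrableOn hOo.measurableSet hle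
      _ ≤ ∫ x, 4 * z x ∂G.baseVolume :=
          setIntegral_le_integral hzi (Eventually.of_forall fun x =>
            mul_nonneg (by norm_num) (hz0 x))
      _ = 4 * ∫ x, z x ∂G.baseVolume := integral_const_mul _ _
      _ ≤ _ := by
        rw [← i2]
        exact mul_le_mul_of_nonneg_left j2 (by norm_num)
  have hlimr : ∀ R, ‖F x₀‖ + 1 ≤ R →
      ∫ x in O, w x ∂G.baseVolume ≤ 4 * (1 / (-p) * (2 * A R)) := fun R hR => by
    have h1 : Tendsto (fun k : ℕ => 4 * (1 / (-p) * (2 * A R + 2 / ((k : ℝ≥0) : ℝ) ^ 2 * B R)))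
        atTop (𝓝 (4 * (1 / (-p) * (2 * A R + 0 * B R)))) := by
      have h2 : Tendsto (fun k : ℕ => 2 / ((k : ℝ≥0) : ℝ) ^ 2) atTop (𝓝 0) := by
        simp only [NNReal.coe_natCast]
        exact Tendsto.div_atTop tendsto_const_nhds
          ((tendsto_pow_atTop two_ne_zero).comp tendsto_natCast_atTop_atTop)
      exact (((h2.mul_const _).const_add _).const_mul _).const_mul _
    rw [zero_mul, add_zero] at h1
    refine ge_of_tendsto h1 ?_
    filter_upwards [eventually_ge_atTop 2] with k hk
    exact (key R hR k (by exact_mod_cast hk)).2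
  have hnonpos : ∫ x in O, w x ∂G.baseVolume ≤ 0 := by
    have h1 : Tendsto (fun R => 4 * (1 / (-p) * (2 * A R))) atTop
        (𝓝 (4 * (1 / (-p) * (2 * 0)))) := ((hlim.const_mul _).const_mul _).const_mul _
    rw [mul_zero, mul_zero, mul_zero] at h1
    refine ge_of_tendsto h1 ?_
    filter_upwards [eventually_ge_atTop (‖F x₀‖ + 1)] with R hR using hlimr R hR
  have hwi := (key _ le_rfl 2 le_rfl).1
  have hzero := le_antisymm hnonpos (setIntegral_nonneg hOo.measurableSet fun x _ => hw0 x)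
  rw [setIntegral_eq_zero_iff_of_nonneg_ae (Eventually.of_forall hw0) hwi] at hzero
  by_contra hT
  have hpos : 0 < w x₀ := mul_pos (Real.rpow_pos_of_pos (G.angle_pos' x₀) p)
    (lt_of_le_of_ne (G.normSqShape_nonneg x₀) (Ne.symm hT))
  have hopen : IsOpen (O ∩ {x | 0 < w x}) := hOo.inter (isOpen_lt continuous_const hwc)
  refine (G.baseVolume_pos_of_isOpen hopen ⟨x₀, hx₀, hpos⟩).ne' ?_
  rw [EventuallyEq, ae_restrict_iff' hOo.measurableSet] at hzero
  refine measure_mono_null ?_ (ae_iff.1 hzero)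
  rintro x ⟨hxO, hxw⟩ h
  have hxw' : 0 < w x := hxw
  rw [h hxO] at hxw'
  exact lt_irrefl _ hxw'

end GraphAtlas

/-! ### Totally geodesic hypersurfaces -/

namespace GraphAtlas

variable {n : ℕ} {M : Type*} [TopologicalSpace M] [ChartedSpace (Euc n) M]
  {F ν : M → Euc (n + 1)} {e : Euc (n + 1)} (G : GraphAtlas F ν e)

theorem eq_of_D_eq_zero [ConnectedSpace M] {V : Type*} [NormedAddCommGroup V] [NormedSpace ℝ V]
    {u : M → V} (hu : ContMDiff (𝓡 n) 𝓘(ℝ, V) ∞ u) (h : ∀ x, G.D u x = 0) (x y : M) :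
    u x = u y := by
  refine IsLocallyConstant.apply_eq_of_preconnectedSpace
    ((IsLocallyConstant.iff_eventually_eq u).2 fun z => ?_) x y
  obtain ⟨ε, hε, hb⟩ := Metric.mem_nhds_iff.1
    ((G.chart z).open_target.mem_nhds (G.proj_mem_target (G.mem_source z)))
  have hball : ∀ᶠ w in 𝓝 z, G.proj w ∈ Metric.ball (G.proj z) ε :=
    G.continuous_proj.continuousAt (Metric.ball_mem_nhds _ hε)
  filter_upwards [hball, (G.chart z).open_source.mem_nhds (G.mem_source z)] with w hw hws
  have h1 := Metric.isOpen_ball.is_const_of_fderiv_eq_zero (convex_ball _ _).isPreconnected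
    (((G.contDiffOn_comp_symm hu z).mono hb).differentiableOn (by simp))
    (fun a ha => by rw [← G.D_symm u (hb ha), h]; rfl) hw (Metric.mem_ball_self hε)
  rwa [Function.comp_apply, Function.comp_apply, G.symm_proj hws,
    G.symm_proj (G.mem_source z)] at h1

theorem norm_D_immersion_le (x : M) (v : Euc n) :
    ‖G.D F x v‖ ≤ (1 + 1 / G.angle x) * ‖v‖ := by
  have hpos := G.angle_pos' x
  have hq : ‖G.slope x‖ ≤ 1 := abs_le_of_sq_le_sq' (by
    nlinarith [G.angle_sq_add x, sq_nonneg (G.angle x)]) zero_le_one |>.2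
  have h1 : |(inner ℝ (G.slope x) v : ℝ)| ≤ ‖v‖ :=
    (abs_real_inner_le_norm _ _).trans (mul_le_of_le_one_left (norm_nonneg _) hq)
  have h2 : (inner ℝ (G.slope x) v / G.angle x) ^ 2 ≤ (1 / G.angle x * ‖v‖) ^ 2 := by
    rw [div_eq_mul_one_div, mul_comm, mul_pow, mul_pow]
    exact mul_le_mul_of_nonneg_left (sq_le_sq.2 (by rwa [abs_norm])) (sq_nonneg _)
  refine abs_le_of_sq_le_sq' ?_ (by positivity) |>.2
  rw [G.norm_D_immersion_sq]
  have h3 : 0 ≤ 1 / G.angle x * ‖v‖ * ‖v‖ := by positivity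
  nlinarith

/-- The segment `s ↦ proj x + s • v`, `0 ≤ s ≤ t`, has a lift to `M` starting at `x` that ends
within distance `C ‖v‖ t` of `x`. -/
def HasSegmentLift (x : M) (v : Euc n) (C t : ℝ) : Prop :=
  ∃ γ : ℝ → M, ContinuousOn γ (Icc 0 t) ∧ γ 0 = x ∧
    (∀ s ∈ Icc 0 t, G.proj (γ s) = G.proj x + s • v) ∧
    inducedEDist F x (γ t) ≤ ENNReal.ofReal (C * ‖v‖ * t)

variable {G} in
/-- A lift of a segment can be continued inside a graph chart around its end point. -/
theorem HasSegmentLift.extend {x y : M} {v : Euc n} {C t t' : ℝ} (hC : 0 ≤ C)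
    (hD : ∀ z w, ‖G.D F z w‖ ≤ C * ‖w‖) (ht : 0 ≤ t) (htt' : t ≤ t') {γ : ℝ → M}
    (hγc : ContinuousOn γ (Icc 0 t)) (hγ0 : γ 0 = x)
    (hγ : ∀ s ∈ Icc 0 t, G.proj (γ s) = G.proj x + s • v)
    (hd : inducedEDist F x (γ t) ≤ ENNReal.ofReal (C * ‖v‖ * t))
    (hy : γ t ∈ (G.chart y).source)
    (hmem : ∀ s ∈ Icc t t', G.proj x + s • v ∈ (G.chart y).target) :
    G.HasSegmentLift x v C t' := by
  set σ := (G.chart y).symm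
  have hjoin : σ (G.proj x + t • v) = γ t := by
    rw [← hγ t ⟨ht, le_rfl⟩]; exact G.symm_proj hy
  set δ : ℝ → M := fun s => if s ≤ t then γ s else σ (G.proj x + s • v) with hδ
  have h1 : EqOn δ γ (Icc 0 t) := fun s hs => if_pos hs.2
  have h2 : EqOn δ (fun s => σ (G.proj x + s • v)) (Icc t t') := fun s hs => by
    rcases hs.1.eq_or_lt with rfl | h
    · exact (if_pos le_rfl).trans hjoin.symm
    · exact if_neg (not_le.2 h)
  have ht0 : (0 : ℝ) ∈ Icc 0 t := ⟨le_rfl, ht⟩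
  have ht1 : t' ∈ Icc t t' := ⟨htt', le_rfl⟩
  refine ⟨δ, ?_, (h1 ht0).trans hγ0, fun s hs => ?_, ?_⟩
  · rw [← Icc_union_Icc_eq_Icc ht htt']
    refine ContinuousOn.union_of_isClosed (hγc.congr h1) (ContinuousOn.congr ?_ h2) isClosed_Icc
      isClosed_Icc
    exact (G.chart y).continuousOn_symm.comp (by fun_prop) hmem
  · rcases le_total s t with h | h
    · rw [h1 ⟨hs.1, h⟩, hγ s ⟨hs.1, h⟩]
    · rw [h2 ⟨h, hs.2⟩]
      exact G.proj_symm (hmem s ⟨h, hs.2⟩)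
  · have h3 := G.inducedEDist_symm_le y (a := G.proj x + t • v) (v := (t' - t) • v)
      (C := C * ‖v‖ * (t' - t)) fun s hs => by
        have h4 : G.proj x + t • v + s • (t' - t) • v = G.proj x + (t + s * (t' - t)) • v := by
          rw [smul_smul, add_assoc, ← add_smul]
        refine ⟨?_, (hD _ _).trans_eq ?_⟩
        · rw [h4]
          exact hmem _ ⟨by nlinarith [hs.1], by nlinarith [hs.2]⟩
        · rw [norm_smul, Real.norm_of_nonneg (sub_nonneg.2 htt')]; ring
    have h5 : G.proj x + t • v + (t' - t) • v = G.proj x + t' • v := by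
      rw [add_assoc, ← add_smul]; congr 2; ring
    rw [h5] at h3
    have h6 : δ t' = σ (G.proj x + t' • v) := h2 ht1
    have h7 : σ (G.proj x + t • v) = γ t := hjoin
    rw [h6]
    refine (inducedEDist_triangle x (γ t) _).trans ((add_le_add hd (h7 ▸ h3)).trans_eq ?_)
    rw [← ENNReal.ofReal_add (by positivity)
      (mul_nonneg (by positivity) (sub_nonneg.2 htt'))]
    congr 1
    ring

/-- The end points of the lifts stay in a compact ball by completeness, so they accumulate at a
point as the parameter tends to its supremum. The chart there extends a lift beyond the supremum. -/
theorem hasSegmentLift [T2Space M] (hcomplete : HasCompleteMetric F) {C : ℝ} (hC : 0 ≤ C)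
    (hD : ∀ z w, ‖G.D F z w‖ ≤ C * ‖w‖) (x : M) (v : Euc n) : G.HasSegmentLift x v C 1 := by
  set S : Set ℝ := {t | t ∈ Icc (0 : ℝ) 1 ∧ G.HasSegmentLift x v C t} with hS
  have h0 : (0 : ℝ) ∈ S := ⟨⟨le_rfl, zero_le_one⟩, fun _ => x, continuousOn_const, rfl,
    fun s hs => by
    rw [le_antisymm hs.2 hs.1, zero_smul, add_zero], by simp [inducedEDist_self]⟩
  have hbdd : BddAbove S := ⟨1, fun t ht => ht.1.2⟩
  set τ := sSup S with hτ
  have hτ1 : τ ≤ 1 := csSup_le ⟨0, h0⟩ fun t ht => ht.1.2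
  obtain ⟨u, -, hu, huS⟩ := exists_seq_tendsto_sSup ⟨0, h0⟩ hbdd
  choose γ hγc hγ0 hγ hd using fun k => (huS k).2
  have hK := G.isCompact_inducedEDist_le hcomplete x (C * ‖v‖).toNNReal
  have hmemK : ∀ k, γ k (u k) ∈ {y | inducedEDist F x y ≤ (C * ‖v‖).toNNReal} := fun k =>
    (hd k).trans (ENNReal.ofReal_le_ofReal
      (mul_le_of_le_one_right (by positivity) (huS k).1.2))
  obtain ⟨y, -, hy⟩ := hK.exists_mapClusterPt (f := atTop) (u := fun k => γ k (u k))
    (tendsto_principal.2 (Eventually.of_forall hmemK))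
  have hproj : Tendsto (fun k => G.proj (γ k (u k))) atTop (𝓝 (G.proj x + τ • v)) := by
    have h1 : Tendsto (fun k => G.proj x + u k • v) atTop (𝓝 (G.proj x + τ • v)) :=
      (hu.smul_const v).const_add _
    exact h1.congr fun k => (hγ k (u k) ⟨(huS k).1.1, le_rfl⟩).symm
  have hyτ : G.proj y = G.proj x + τ • v := by
    have h1 : MapClusterPt (G.proj y) atTop fun k => G.proj (γ k (u k)) :=
      hy.continuousAt_comp G.continuous_proj.continuousAt
    exact eq_of_nhds_neBot (ClusterPt.mono h1 hproj)
  obtain ⟨ε, hε, hball⟩ : ∃ ε > 0, ∀ s, dist s τ < ε → G.proj x + s • v ∈ (G.chart y).target := by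
    have hc : Continuous fun s : ℝ => G.proj x + s • v := by fun_prop
    refine Metric.eventually_nhds_iff.1 (hc.continuousAt.eventually_mem
      ((G.chart y).open_target.mem_nhds ?_))
    rw [← hyτ]
    exact G.proj_mem_target (G.mem_source y)
  obtain ⟨k, hk1, hk2⟩ := ((hy.frequently
    ((G.chart y).open_source.mem_nhds (G.mem_source y))).and_eventually
      (hu.eventually (Metric.ball_mem_nhds τ hε))).exists
  have hkτ : u k ≤ τ := le_csSup hbdd (huS k)
  have hext : ∀ t', u k ≤ t' → t' < τ + ε → G.HasSegmentLift x v C t' := fun t' h1 h2 =>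
    HasSegmentLift.extend hC hD (huS k).1.1 h1 (hγc k) (hγ0 k) (hγ k) (hd k) hk1 fun s hs => by
      refine hball s ?_
      rw [Real.dist_eq, abs_lt] at hk2
      rw [Real.dist_eq, abs_lt]
      exact ⟨by linarith [hs.1, hk2.1], by linarith [hs.2]⟩
  rcases hτ1.eq_or_lt with h | h
  · exact h ▸ hext τ hkτ (by linarith)
  · have hmin : τ < min 1 (τ + ε / 2) := lt_min h (by linarith)
    have hmem : min 1 (τ + ε / 2) ∈ S :=
      ⟨⟨(h0.1.1.trans (le_csSup hbdd h0)).trans hmin.le, min_le_left _ _⟩,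
        hext _ (hkτ.trans hmin.le) ((min_le_right _ _).trans_lt (by linarith))⟩
    exact absurd (le_csSup hbdd hmem) (not_le.2 hmin)

/-- If the differential of the immersion is bounded, the lifts of the segments from a base point
form a continuous section of the projection to `e^⊥`. The image of the section is open and closed, so
it is `M`. -/
theorem bijective_proj [T2Space M] [ConnectedSpace M] (hcomplete : HasCompleteMetric F) {C : ℝ}
    (hC : 0 ≤ C) (hD : ∀ z w, ‖G.D F z w‖ ≤ C * ‖w‖) : Function.Bijective G.proj := by
  obtain ⟨x⟩ := (inferInstance : Nonempty M)
  choose γ hγc hγ0 hγ _ using G.hasSegmentLift hcomplete hC hD x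
  let f : C(unitInterval × Euc n, Euc n) :=
    ⟨fun q => G.proj x + (q.1 : ℝ) • q.2, by fun_prop⟩
  have hlift : Continuous fun q : unitInterval × Euc n => γ q.2 q.1 := by
    refine G.isLocalHomeomorph_proj.continuous_lift (T2Space.isSeparatedMap _) f ?_ ?_ fun v => ?_
    · ext1 q
      exact hγ q.2 q.1 q.1.2
    · exact continuous_const.congr fun v => (hγ0 v).symm
    · exact (hγc v).comp_continuous continuous_subtype_val fun t => t.2
  set s : Euc n → M := fun a => γ (a - G.proj x) 1 with hs
  have hsc : Continuous s := hlift.comp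
    ((continuous_const (y := (1 : unitInterval))).prodMk (continuous_id.sub continuous_const))
  have hsr : ∀ a, G.proj (s a) = a := fun a => by
    rw [hs]
    dsimp only
    rw [hγ _ 1 ⟨zero_le_one, le_rfl⟩, one_smul, add_sub_cancel]
  have hclopen : IsClopen {y | s (G.proj y) = y} := by
    refine ⟨isClosed_eq (hsc.comp G.continuous_proj) continuous_id,
      isOpen_iff_mem_nhds.2 fun y hy => ?_⟩
    have hy' : s (G.proj y) = y := hy
    have hnear : ∀ᶠ z in 𝓝 y, s (G.proj z) ∈ (G.chart y).source := by
      refine (hsc.comp G.continuous_proj).continuousAt.eventually_mem ?_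
      rw [Function.comp_apply, hy']
      exact (G.chart y).open_source.mem_nhds (G.mem_source y)
    filter_upwards [hnear, (G.chart y).open_source.mem_nhds (G.mem_source y)] with z h1 h2
    exact (G.chart y).injOn h1 h2 (by
      rw [G.chart_eq_proj h1, G.chart_eq_proj h2, hsr])
  have huniv := hclopen.eq_univ ⟨s 0, congrArg s (hsr 0)⟩
  exact ⟨Function.LeftInverse.injective (g := s) fun y => huniv.ge (mem_univ y),
    Function.RightInverse.surjective hsr⟩

/-- A complete totally geodesic hypersurface that is locally a graph is a hyperplane. -/
theorem injective_and_isHyperplane_range [T2Space M] [ConnectedSpace M] [IsManifold (𝓡 n) ∞ M]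
    (hcomplete : HasCompleteMetric F) (hT : ∀ x, G.normSqShape x = 0) :
    Function.Injective F ∧ IsHyperplane (range F) := by
  obtain ⟨x₀⟩ := (inferInstance : Nonempty M)
  have hν : ∀ x, ν x = ν x₀ := fun x => by
    refine G.eq_of_D_eq_zero G.immersed.smooth_normal (fun y => ?_) x x₀
    ext1 w
    rw [G.D_normal, (G.isGraphJet y).trace_comp_self.2 (hT y)]
    simp
  have hF : ∀ x, inner ℝ (ν x₀) (F x) = (inner ℝ (ν x₀) (F x₀) : ℝ) := fun x => by
    have hsm : ContMDiff (𝓡 n) 𝓘(ℝ, ℝ) ∞ fun x => (inner ℝ (ν x₀) (F x) : ℝ) :=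
      (innerSL ℝ (ν x₀)).contMDiff.comp G.immersed.smooth
    refine G.eq_of_D_eq_zero hsm (fun y => ?_) x x₀
    ext1 w
    have h1 := ((innerSL ℝ (ν x₀)).hasFDerivAt.comp _
      (G.differentiableAt_comp_symm G.immersed.smooth y).hasFDerivAt).fderiv
    have h2 : G.D (fun x => (inner ℝ (ν x₀) (F x) : ℝ)) y = innerSL ℝ (ν x₀) ∘L G.D F y := h1
    rw [h2, ContinuousLinearMap.comp_apply, innerSL_apply_apply, ← hν y, G.inner_normal_D]
    rfl
  have hang : ∀ x, G.angle x = G.angle x₀ := fun x => by rw [angle, angle, hν]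
  obtain ⟨hinj, hsurj⟩ := G.bijective_proj hcomplete (C := 1 + 1 / G.angle x₀)
    (by have := G.angle_pos' x₀; positivity) fun z w => hang z ▸ G.norm_D_immersion_le z w
  refine ⟨fun x y h => hinj (congrArg (projCoord G.incl) h), ν x₀, inner ℝ (ν x₀) (F x₀),
    fun h => ?_, ?_⟩
  · have := G.immersed.norm_normal x₀
    simp [h] at this
  · ext y
    refine ⟨?_, fun hy => ?_⟩
    · rintro ⟨x, rfl⟩
      exact hF x
    · obtain ⟨x, hx⟩ := hsurj (projCoord G.incl y)
      refine ⟨x, ?_⟩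
      have hx' : projCoord G.incl (F x) = projCoord G.incl y := hx
      have h1 := incl_projCoord_add G.norm_dir G.inner_incl (F x)
      have h2 := incl_projCoord_add G.norm_dir G.inner_incl y
      have h3 : F x - y = (inner ℝ (F x) e - inner ℝ y e : ℝ) • e := by
        nth_rw 1 [← h1, ← h2]
        rw [hx', sub_smul]
        abel
      have hy' : inner ℝ (ν x₀) y = (inner ℝ (ν x₀) (F x₀) : ℝ) := hy
      have h4 : (inner ℝ (F x) e - inner ℝ y e : ℝ) * inner ℝ (ν x₀) e = 0 := by
        rw [← inner_smul_right, ← h3, inner_sub_right, hF, hy', sub_self]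
      rw [(mul_eq_zero.1 h4).resolve_right (G.angle_pos x₀).ne', zero_smul] at h3
      exact sub_eq_zero.1 h3

end GraphAtlas

theorem theorem1p5 {n : ℕ} {M : Type*} [TopologicalSpace M] [T2Space M]
    [SecondCountableTopology M] [ConnectedSpace M] [MeasurableSpace M] [BorelSpace M]
    [ChartedSpace (Euc n) M] [IsManifold (𝓡 n) ∞ M]
    (F ν : M → Euc (n + 1)) (hF : IsImmersedHypersurface F ν) (hcomplete : HasCompleteMetric F)
    (W : Euc (n + 1)) (hW : IsTranslatingSoliton F ν W)
    (e : Euc (n + 1)) (he : ‖e‖ = 1)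
    (hH : ∀ x, inner ℝ (tangentialGradient F (meanCurvature F ν) x) e ≤ 0)
    (hν : ∀ x, 0 < inner ℝ (ν x) e)
    (p : ℝ) (hp : p < 0)
    (hint : ∀ R : ℝ, 0 < R →
      IntegrableOn (fun x => (inner ℝ (ν x) e : ℝ) ^ (p + 1)) (ballPart F R) (inducedVolume F))
    (hlim : Tendsto
      (fun R : ℝ => 1 / R ^ 2 *
        ∫ x in ballPart F (2 * R) \ ballPart F R, (inner ℝ (ν x) e : ℝ) ^ (p + 1) ∂inducedVolume F)
      atTop (𝓝 0)) :
    Function.Injective F ∧ IsHyperplane (range F) := by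
  obtain ⟨G⟩ := exists_graphAtlas hF he hν
  exact G.injective_and_isHyperplane_range hcomplete fun x =>
    G.normSqShape_eq_zero hcomplete hH hp hint hlim x
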